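/- Let $\mathbb O$ be the octonions with imaginary units $i,j,k,k\ell,j\ell,i\ell,\ell$, and let $\mathbb O'$ be the split octonions with imaginary units $I,J,K,KL,JL,IL,L$ ($L^2=+1$); both are Cayley–Dickson doubles of the quaternions. Let $\mathfrak e_8=\mathfrak e_{8(-24)}\cong\mathfrak{su}(3,\mathbb O'\otimes\mathbb O)$ be the Lie algebra of generalized $3\times3$ matrices over $\mathbb O'\otimes\mathbb O$. It is spanned by the anti-Hermitian matrices $X_p$ ($p$ at position $(1,2)$, $-\bar p$ at $(2,1)$), $Y_p$ ($p$ at $(2,3)$, $-\bar p$ at $(3,2)$), $Z_p$ ($p$ at $(3,1)$, $-\bar p$ at $(1,3)$), $p\in\mathbb O'\otimes\mathbb O$, and by the commutators $[X_p,X_q]$, $[Y_p,Y_q]$, $[Z_p,Z_q]$, computed with products of entries read as compositions of left multiplications (written $p\circ q$); these commutators span the diagonal part $\mathfrak{so}(4,4)\oplus\mathfrak{so}(8)$. Each diagonal element is identified with its action on the off-diagonal matrices (triality), and $[X_p,Y_q]=Z_{-\overline{pq}}$, $[Y_p,Z_q]=X_{-\overline{pq}}$, $[Z_p,X_q]=Y_{-\overline{pq}}$.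 Put $$D_q=\tfrac12[X_1,X_q],\quad E_q=\tfrac12[Y_1,Y_q],\quad F_q=\tfrac12[Z_1,Z_q],\quad S_q=E_q-F_q,$$ $$D_{p,q}=\tfrac12[X_p,X_q],\quad E_{p,q}=\tfrac12[Y_p,Y_q],\quad F_{p,q}=\tfrac12[Z_p,Z_q],\quad (p\circ q)\,\mathcal I=\tfrac12(D_{p,q}+E_{p,q}+F_{p,q}),$$ the last for orthogonal imaginary $p,q$. An ordinary anti-Hermitian trace-free matrix $M$ over $\mathbb O'\otimes\mathbb O$ is the element $X_{M_{12}}+Y_{M_{23}}+Z_{M_{31}}+D_{M_{11}}-E_{M_{33}}$. For each imaginary unit $p$ of $\mathbb O$ let $(a(p),b(p),c(p))$ be the three pairs of units generating the quaternionic subalgebras containing $p$: $i:(j,k),(k\ell,j\ell),(\ell,i\ell)$; $j:(k,i),(i\ell,k\ell),(\ell,j\ell)$; $k:(i,j),(j\ell,i\ell),(\ell,k\ell)$; $k\ell:(j\ell,i),(j,i\ell),(k,\ell)$; $j\ell:(i\ell,k),(i,k\ell),(j,\ell)$; $i\ell:(k\ell,j),(k,j\ell),(i,\ell)$; $\ell:(i\ell,i),(j\ell,j),(k\ell,k)$.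 Put $-A_p=D_{a(p)}-D_{b(p)}$ and $-G_p=D_{a(p)}+D_{b(p)}-2D_{c(p)}$, where $D_{(u,v)}$ means $D_{u,v}$. For $Q\in\mathrm{span}\{I,J,K,KL,JL,IL\}$ put $G_Q=-2\,(QL\circ L)\,\mathcal I$ and $$\mathrm H_Q=\langle X_{pQ},\,Y_{pQ},\,Z_{pQ}\ (p\in\{1,i,j,k,k\ell,j\ell,i\ell,\ell\}),\ D_Q,\,S_Q,\,G_Q\rangle .$$ Let $\mathfrak e_6=\mathfrak e_{6(-26)}\subset\mathfrak e_8$ be the Lie subalgebra generated by the 78 elements $A_p,G_p,S_p,D_p$ ($p$ an imaginary unit of $\mathbb O$), $X_q,Y_q,Z_q,X_{qL},Y_{qL},Z_{qL}$ ($q$ such a unit or $1$), $D_L$, $S_L$. Let $\mathrm H_3(\mathbb O)$ be the Albert algebra of $3\times3$ octonionic Hermitian matrices. For an octonionic matrix $\mathcal M$ let $\rho(\mathcal M)$ be the operator $\mathcal P\mapsto\mathcal M\mathcal P+\mathcal P\mathcal M^\dagger$ on $\mathrm H_3(\mathbb O)$, and let $\mathfrak{sl}(3,\mathbb O)\subset\mathfrak{gl}(\mathrm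 H_3(\mathbb O))$ be the Lie algebra generated by all $\rho(\mathcal M)$ with $\mathcal M$ trace-free and anti-Hermitian or Hermitian. For $Q$ as above and $\mathcal P=\mathcal P_0+\frac{\operatorname{tr}\mathcal P}{3}\mathcal I\in\mathrm H_3(\mathbb O)$ with $\mathcal P_0$ trace-free, let $Q\mathcal P\in\mathfrak e_8$ be the anti-Hermitian matrix $Q\mathcal P_0$ plus $\frac{\operatorname{tr}\mathcal P}{3}\cdot(-\frac12G_Q)$; that is, "$Q\mathcal I$" is read as $-\frac12G_Q$. Then: 1. The 78 generators of $\mathfrak e_6$ are linearly independent and their span is closed under the commutator. 2. There is an isomorphism of Lie algebras $\Phi:\mathfrak e_6\to\mathfrak{sl}(3,\mathbb O)$ such that, for every trace-free anti-Hermitian octonionic matrix $\mathcal A$ and every trace-free Hermitian octonionic matrix $\mathcal B$, the matrices $\mathcal A$ and $\mathcal BL$ lie in $\mathfrak e_6$, and $\Phi(\mathcal A)=\rho(\mathcal A)$, $\Phi(\mathcal BL)=\rho(\mathcal B)$. 3. For each of the six null labels $Q$ with $2Q\in\{I\pm IL,\,J\pm JL,\,K\pm KL\}$, the space $\mathrm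 H_Q$ has dimension 27 and is a representation of $\mathfrak e_6$ under the commutator of $\mathfrak e_8$. The map $\mathcal P\mapsto Q\mathcal P$ is a linear bijection $\mathrm H_3(\mathbb O)\to\mathrm H_Q$, and for all $\mathcal A$, $\mathcal B$ as in 2 and all $\mathcal P\in\mathrm H_3(\mathbb O)$ $$[\mathcal A,Q\mathcal P]=Q\,(\mathcal A\mathcal P+\mathcal P\mathcal A^\dagger),\qquad[\mathcal BL,Q\mathcal P]=(LQ)\,(\mathcal B\mathcal P+\mathcal P\mathcal B^\dagger).$$ 4. Each label satisfies $LQ=Q$ or $LQ=-Q$, and three labels satisfy each. If $LQ=Q$, then $[x,Q\mathcal P]=Q\,\Phi(x)\mathcal P$ for all $x\in\mathfrak e_6$ and $\mathcal P\in\mathrm H_3(\mathbb O)$, so $\mathrm H_Q$ is equivalent to the action of $\mathfrak e_6$ on the Albert algebra (the $27$). If $LQ=-Q$, then $\mathrm H_Q$ is equivalent to the dual of that representation (the $\overline{27}$). For two labels $Q,R$ the representations $\mathrm H_Q$ and $\mathrm H_R$ are equivalent if and only if the signs in $LQ=\pm Q$ and $LR=\pm R$ agree. -/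

import Mathlib

open scoped TensorProduct Quaternion Matrix
attribute [local instance 100] LieRing.ofAssociativeRing

noncomputable section
set_option linter.unusedSectionVars false

/-! ## Octonions and split octonions -/

/-- The Cayley-Dickson double `ℍ ⊕ ℍℓ` of the quaternions with `ℓ² = γ`; the pair `(a, b)` stands
for `a + bℓ`.  The octonions are the case `γ = -1`, the split octonions the case `γ = 1`. -/
def Oct (_γ : ℝ) : Type := ℍ[ℝ] × ℍ[ℝ]

namespace Oct
variable {γ : ℝ}

instance : AddCommGroup (Oct γ) := inferInstanceAs (AddCommGroup (ℍ[ℝ] × ℍ[ℝ]))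
instance : Module ℝ (Oct γ) := inferInstanceAs (Module ℝ (ℍ[ℝ] × ℍ[ℝ]))
instance : Mul (Oct γ) :=
  ⟨fun x y => (x.1 * y.1 + γ • (star y.2 * x.2), y.2 * x.1 + x.2 * star y.1)⟩
instance : One (Oct γ) := ⟨(1, 0)⟩
/-- Octonionic conjugation. -/
instance : Star (Oct γ) := ⟨fun x => (star x.1, -x.2)⟩

theorem ext {x y : Oct γ} (h1 : x.1 = y.1) (h2 : x.2 = y.2) : x = y := Prod.ext h1 h2
@[simp] theorem mul_fst (x y : Oct γ) : (x * y).1 = x.1 * y.1 + γ • (star y.2 * x.2) := rfl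
@[simp] theorem mul_snd (x y : Oct γ) : (x * y).2 = y.2 * x.1 + x.2 * star y.1 := rfl
@[simp] theorem star_fst (x : Oct γ) : (star x).1 = star x.1 := rfl
@[simp] theorem star_snd (x : Oct γ) : (star x).2 = -x.2 := rfl
@[simp] theorem one_fst : (1 : Oct γ).1 = 1 := rfl
@[simp] theorem one_snd : (1 : Oct γ).2 = 0 := rfl
@[simp] theorem zero_fst : (0 : Oct γ).1 = 0 := rfl
@[simp] theorem zero_snd : (0 : Oct γ).2 = 0 := rfl
@[simp] theorem add_fst (x y : Oct γ) : (x + y).1 = x.1 + y.1 := rfl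
@[simp] theorem add_snd (x y : Oct γ) : (x + y).2 = x.2 + y.2 := rfl
@[simp] theorem neg_fst (x : Oct γ) : (-x).1 = -x.1 := rfl
@[simp] theorem neg_snd (x : Oct γ) : (-x).2 = -x.2 := rfl
@[simp] theorem smul_fst (r : ℝ) (x : Oct γ) : (r • x).1 = r • x.1 := rfl
@[simp] theorem smul_snd (r : ℝ) (x : Oct γ) : (r • x).2 = r • x.2 := rfl

instance : NonAssocRing (Oct γ) :=
  { (inferInstance : AddCommGroup (Oct γ)), (inferInstance : Mul (Oct γ)),
    (inferInstance : One (Oct γ)) with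
    left_distrib := fun x y z => by apply ext <;> simp [mul_add, add_mul] <;> abel
    right_distrib := fun x y z => by apply ext <;> simp [mul_add, add_mul] <;> abel
    zero_mul := fun x => by apply ext <;> simp
    mul_zero := fun x => by apply ext <;> simp
    one_mul := fun x => by apply ext <;> simp
    mul_one := fun x => by apply ext <;> simp }

instance : SMulCommClass ℝ (Oct γ) (Oct γ) :=
  ⟨fun r x y => by apply ext <;> simp [smul_smul, mul_comm]⟩
instance : IsScalarTower ℝ (Oct γ) (Oct γ) :=
  ⟨fun r x y => by apply ext <;> simp [smul_smul, mul_comm]⟩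

instance : StarRing (Oct γ) where
  star_involutive x := by apply ext <;> simp
  star_mul x y := by apply ext <;> simp [add_comm]
  star_add x y := by apply ext <;> simp [add_comm]

instance : StarModule ℝ (Oct γ) := ⟨fun r x => by apply ext <;> simp⟩


/-- The polarised norm `⟨x, y⟩ = Re (x ȳ)`. -/
def ip (x y : Oct γ) : ℝ := (x * star y).1.re

end Oct

/-! ## Composition operators -/

section Composition
/-- Conjugation as a real linear map. -/
def conjL (A : Type*) [NonAssocRing A] [StarRing A] [Module ℝ A] [StarModule ℝ A] :
    A →ₗ[ℝ] A where
  toFun := star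
  map_add' := star_add
  map_smul' r a := by simp

@[simp] theorem conjL_apply {A : Type*} [NonAssocRing A] [StarRing A] [Module ℝ A]
    [StarModule ℝ A] (a : A) : conjL A a = star a := rfl

variable {A : Type*} [NonAssocRing A] [StarRing A] [Module ℝ A] [SMulCommClass ℝ A A]
  [IsScalarTower ℝ A A] [StarModule ℝ A]

/-!
For `a ∈ A` let `X_a` be the `2 × 2` anti-Hermitian matrix with rows `(0, a)` and `(-ā, 0)`.  When
products of entries are read as compositions of left multiplications, the commutator
`X_a X_b - X_b X_a` is the diagonal generalized matrix with entries `topEntry a b`, `botEntry a b`.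
-/

/-- The `(1,1)` entry `b ∘ ā - a ∘ b̄` of `X_a X_b - X_b X_a`. -/
def topEntry (a b : A) : Module.End ℝ A :=
  LinearMap.mulLeft ℝ b ∘ₗ LinearMap.mulLeft ℝ (star a) -
    LinearMap.mulLeft ℝ a ∘ₗ LinearMap.mulLeft ℝ (star b)

/-- The `(2,2)` entry `b̄ ∘ a - ā ∘ b` of `X_a X_b - X_b X_a`. -/
def botEntry (a b : A) : Module.End ℝ A :=
  LinearMap.mulLeft ℝ (star b) ∘ₗ LinearMap.mulLeft ℝ a -
    LinearMap.mulLeft ℝ (star a) ∘ₗ LinearMap.mulLeft ℝ b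

/-!
The action of that commutator, placed in the first two rows of a `3 × 3` matrix, on the three kinds
of off-diagonal matrices `X_c` (entry `c` at `(1,2)`), `Y_c` (entry `c` at `(2,3)`) and `Z_c` (entry
`c` at `(3,1)`, hence `-c̄` at `(1,3)`) is by `X_c ↦ X_{own a b c}`, `Y_c ↦ Y_{next a b c}` and
`Z_c ↦ Z_{prev a b c}`.
-/

/-- The `(1,2)` entry of the commutator of `diag (topEntry a b, botEntry a b)` with `X_c` is the
operator `topEntry a b ∘ c - c ∘ botEntry a b`; evaluated at `1`, it is the element `own a b c`. -/
def own (a b : A) : Module.End ℝ A :=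
  topEntry a b - LinearMap.mulRight ℝ (botEntry a b 1)

/-- The action of `botEntry a b` on the `(2,3)` entry. -/
def next (a b : A) : Module.End ℝ A := botEntry a b

/-- The action of `topEntry a b` on the `(1,3)` entry `-c̄`, read off at the `(3,1)` entry. -/
def prev (a b : A) : Module.End ℝ A := conjL A ∘ₗ topEntry a b ∘ₗ conjL A

theorem own_apply (a b c : A) : own a b c =
    b * (star a * c) - a * (star b * c) + c * (star a * b) - c * (star b * a) := by
  simp [own, topEntry, botEntry, mul_sub]; abel

theorem next_apply (a b c : A) : next a b c = star b * (a * c) - star a * (b * c) := by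
  simp [next, botEntry]

theorem prev_apply (a b c : A) : prev a b c = (c * a) * star b - (c * b) * star a := by
  simp [prev, topEntry]

end Composition

namespace Oct
variable {γ : ℝ}

/-- A quaternion from its coordinates. -/
def mkq (a b c d : ℝ) : ℍ[ℝ] := ⟨a, b, c, d⟩
@[simp] theorem mkq_re (a b c d : ℝ) : (mkq a b c d).re = a := rfl
@[simp] theorem mkq_imI (a b c d : ℝ) : (mkq a b c d).imI = b := rfl
@[simp] theorem mkq_imJ (a b c d : ℝ) : (mkq a b c d).imJ = c := rfl
@[simp] theorem mkq_imK (a b c d : ℝ) : (mkq a b c d).imK = d := rfl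

/-- The element with coordinates `a0, …, a7` in the basis `1, i, j, k, ℓ, iℓ, jℓ, kℓ`. -/
def co (a0 a1 a2 a3 a4 a5 a6 a7 : ℝ) : Oct γ := (mkq a0 a1 a2 a3, mkq a4 a5 a6 a7)
@[simp] theorem co_fst (a0 a1 a2 a3 a4 a5 a6 a7 : ℝ) :
    (co a0 a1 a2 a3 a4 a5 a6 a7 : Oct γ).1 = mkq a0 a1 a2 a3 := rfl
@[simp] theorem co_snd (a0 a1 a2 a3 a4 a5 a6 a7 : ℝ) :
    (co a0 a1 a2 a3 a4 a5 a6 a7 : Oct γ).2 = mkq a4 a5 a6 a7 := rfl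

theorem eq_co (a : Oct γ) : ∃ a0 a1 a2 a3 a4 a5 a6 a7, a = co a0 a1 a2 a3 a4 a5 a6 a7 :=
  ⟨_, _, _, _, _, _, _, _, rfl⟩

theorem co_ext {a b : Oct γ} (h0 : a.1.re = b.1.re) (h1 : a.1.imI = b.1.imI)
    (h2 : a.1.imJ = b.1.imJ) (h3 : a.1.imK = b.1.imK) (h4 : a.2.re = b.2.re)
    (h5 : a.2.imI = b.2.imI) (h6 : a.2.imJ = b.2.imJ) (h7 : a.2.imK = b.2.imK) : a = b :=
  ext (Quaternion.ext _ _ h0 h1 h2 h3) (Quaternion.ext _ _ h4 h5 h6 h7)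

theorem co_mul (a0 a1 a2 a3 a4 a5 a6 a7 b0 b1 b2 b3 b4 b5 b6 b7 : ℝ) :
    (co a0 a1 a2 a3 a4 a5 a6 a7 * co b0 b1 b2 b3 b4 b5 b6 b7 : Oct γ) =
    co (a0*b0-a1*b1-a2*b2-a3*b3 + γ * (b4*a4+b5*a5+b6*a6+b7*a7))
     (a0*b1+a1*b0+a2*b3-a3*b2 + γ * (b4*a5-b5*a4-b6*a7+b7*a6))
     (a0*b2-a1*b3+a2*b0+a3*b1 + γ * (b4*a6+b5*a7-b6*a4-b7*a5))
     (a0*b3+a1*b2-a2*b1+a3*b0 + γ * (b4*a7-b5*a6+b6*a5-b7*a4))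
     (b4*a0-b5*a1-b6*a2-b7*a3 + (a4*b0+a5*b1+a6*b2+a7*b3))
     (b4*a1+b5*a0+b6*a3-b7*a2 + (-a4*b1+a5*b0-a6*b3+a7*b2))
     (b4*a2-b5*a3+b6*a0+b7*a1 + (-a4*b2+a5*b3+a6*b0-a7*b1))
     (b4*a3+b5*a2-b6*a1+b7*a0 + (-a4*b3-a5*b2+a6*b1+a7*b0)) := by
  apply co_ext <;> simp [-mul_eq_mul_left_iff] <;> ring

theorem co_star (a0 a1 a2 a3 a4 a5 a6 a7 : ℝ) : star (co a0 a1 a2 a3 a4 a5 a6 a7 : Oct γ) =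
    co a0 (-a1) (-a2) (-a3) (-a4) (-a5) (-a6) (-a7) := by
  apply co_ext <;> simp

theorem co_add (a0 a1 a2 a3 a4 a5 a6 a7 b0 b1 b2 b3 b4 b5 b6 b7 : ℝ) :
    (co a0 a1 a2 a3 a4 a5 a6 a7 + co b0 b1 b2 b3 b4 b5 b6 b7 : Oct γ) =
    co (a0+b0) (a1+b1) (a2+b2) (a3+b3) (a4+b4) (a5+b5) (a6+b6) (a7+b7) := by
  apply co_ext <;> simp

theorem co_sub (a0 a1 a2 a3 a4 a5 a6 a7 b0 b1 b2 b3 b4 b5 b6 b7 : ℝ) :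
    (co a0 a1 a2 a3 a4 a5 a6 a7 - co b0 b1 b2 b3 b4 b5 b6 b7 : Oct γ) =
    co (a0-b0) (a1-b1) (a2-b2) (a3-b3) (a4-b4) (a5-b5) (a6-b6) (a7-b7) := by
  rw [sub_eq_iff_eq_add, co_add]; simp

theorem co_smul (r a0 a1 a2 a3 a4 a5 a6 a7 : ℝ) : r • (co a0 a1 a2 a3 a4 a5 a6 a7 : Oct γ) =
    co (r*a0) (r*a1) (r*a2) (r*a3) (r*a4) (r*a5) (r*a6) (r*a7) := by
  apply co_ext <;> simp

theorem co_ip (a0 a1 a2 a3 a4 a5 a6 a7 b0 b1 b2 b3 b4 b5 b6 b7 : ℝ) :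
    ip (co a0 a1 a2 a3 a4 a5 a6 a7) (co b0 b1 b2 b3 b4 b5 b6 b7 : Oct γ) =
    a0*b0+a1*b1+a2*b2+a3*b3 - γ * (a4*b4+a5*b5+a6*b6+a7*b7) := by
  rw [ip, co_star, co_mul]; simp; ring

theorem co_congr {a0 a1 a2 a3 a4 a5 a6 a7 b0 b1 b2 b3 b4 b5 b6 b7 : ℝ} (h0 : a0 = b0)
    (h1 : a1 = b1) (h2 : a2 = b2) (h3 : a3 = b3) (h4 : a4 = b4) (h5 : a5 = b5) (h6 : a6 = b6)
    (h7 : a7 = b7) : (co a0 a1 a2 a3 a4 a5 a6 a7 : Oct γ) = co b0 b1 b2 b3 b4 b5 b6 b7 := by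
  subst_vars; rfl

theorem comp_left (a b c : Oct γ) : star a * (b * c) + star b * (a * c) = (2 * ip a b) • c := by
  obtain ⟨a0, a1, a2, a3, a4, a5, a6, a7, rfl⟩ := eq_co a
  obtain ⟨b0, b1, b2, b3, b4, b5, b6, b7, rfl⟩ := eq_co b
  obtain ⟨c0, c1, c2, c3, c4, c5, c6, c7, rfl⟩ := eq_co c
  simp only [co_mul, co_star, co_add, co_smul, co_ip]
  apply co_congr <;> ring

theorem ip_star (a b : Oct γ) : ip (star a) (star b) = ip a b := by
  obtain ⟨a0, a1, a2, a3, a4, a5, a6, a7, rfl⟩ := eq_co a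
  obtain ⟨b0, b1, b2, b3, b4, b5, b6, b7, rfl⟩ := eq_co b
  simp only [co_star, co_ip]; ring

theorem ip_comm (a b : Oct γ) : ip a b = ip b a := by
  obtain ⟨a0, a1, a2, a3, a4, a5, a6, a7, rfl⟩ := eq_co a
  obtain ⟨b0, b1, b2, b3, b4, b5, b6, b7, rfl⟩ := eq_co b
  simp only [co_ip]; ring

theorem ip_cyc (a b c : Oct γ) : ip a (star (b * c)) = ip b (star (c * a)) := by
  obtain ⟨a0, a1, a2, a3, a4, a5, a6, a7, rfl⟩ := eq_co a
  obtain ⟨b0, b1, b2, b3, b4, b5, b6, b7, rfl⟩ := eq_co b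
  obtain ⟨c0, c1, c2, c3, c4, c5, c6, c7, rfl⟩ := eq_co c
  simp only [co_mul, co_star, co_ip]; ring

theorem comp_left' (a b c : Oct γ) : a * (star b * c) + b * (star a * c) = (2 * ip a b) • c := by
  simpa [ip_star] using comp_left (star a) (star b) c

theorem comp_right (a b c : Oct γ) : (c * a) * star b + (c * b) * star a = (2 * ip a b) • c := by
  simpa [ip_comm b a] using congrArg star (comp_left' b a (star c))

theorem comp_right' (a b c : Oct γ) : (c * star a) * b + (c * star b) * a = (2 * ip a b) • c := by
  simpa [ip_star] using comp_right (star a) (star b) c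

theorem own_eq (a b c : Oct γ) : own a b c = (4 * ip a c) • b - (4 * ip b c) • a := by
  rw [own_apply]
  obtain ⟨a0, a1, a2, a3, a4, a5, a6, a7, rfl⟩ := eq_co a
  obtain ⟨b0, b1, b2, b3, b4, b5, b6, b7, rfl⟩ := eq_co b
  obtain ⟨c0, c1, c2, c3, c4, c5, c6, c7, rfl⟩ := eq_co c
  simp only [co_mul, co_star, co_add, co_sub, co_smul, co_ip]
  apply co_congr <;> ring

theorem own_cyc (a b c y : Oct γ) :
    own a (star (b * c)) y + prev b (star (c * a)) y + next c (star (a * b)) y = 0 := by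
  rw [own_eq, prev_apply, next_apply]
  have h1 := comp_right b (star (c * a)) y
  have h2 := comp_left c (star (a * b)) y
  have h3 := congrArg (star c * ·) (comp_right (star a) (star y) (star b))
  have h4 := comp_left c (star (y * b)) a
  rw [ip_cyc b c a] at h1
  rw [ip_star] at h3
  rw [ip_cyc c y b, ip_comm] at h4
  simp only [star_mul, star_star, mul_add, mul_smul_comm] at h1 h2 h3 h4 ⊢
  linear_combination (norm := module) (-1 : ℝ) • h1 + h2 - (2 : ℝ) • h3 + (2 : ℝ) • h4

theorem tri_own (a b x y : Oct γ) :
    own a b (star (x * y)) = star (next a b x * y) + star (x * prev a b y) := by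
  rw [own_eq, prev_apply, next_apply]
  apply star_injective
  have h1 := congrArg (· * y) (comp_left a b x)
  have h2 := congrArg (x * ·) (comp_right a b y)
  have h3 := comp_left (star x) (y * a) (star b)
  have h4 := comp_right (b * x) (star y) (star a)
  rw [ip_comm, ← ip_star, star_star, ip_comm, ← ip_cyc] at h3
  rw [ip_comm, ← ip_star, star_star, ip_cyc] at h4
  rw [star_add, star_star, star_star]
  simp only [star_sub, star_smul, star_mul, mul_add, add_mul, mul_sub, sub_mul,
    mul_smul_comm, smul_mul_assoc, star_trivial] at h1 h2 h3 h4 ⊢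
  linear_combination (norm := module) (-1 : ℝ) • h1 + h2 - (2 : ℝ) • h3 + (2 : ℝ) • h4

theorem tri_next (a b x y : Oct γ) :
    next a b (star (x * y)) = star (prev a b x * y) + star (x * own a b y) := by
  rw [own_eq, prev_apply, next_apply]
  apply star_injective
  have h1 := comp_right' a b (x * y)
  have h2 := congrArg (· * y) (comp_right a b x)
  have h3 := congrArg (· * b) (comp_right a y x)
  have h4 := comp_right' y b (x * a)
  rw [ip_comm y b] at h4
  simp only [star_add, star_sub, star_smul, star_mul, star_star, add_mul, mul_sub,
    sub_mul, mul_smul_comm, smul_mul_assoc, star_trivial] at h1 h2 h3 h4 ⊢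
  linear_combination (norm := module) (-1 : ℝ) • h1 + h2 + (2 : ℝ) • h3 - (2 : ℝ) • h4

theorem star_prev (a b x : Oct γ) : star (prev a b x) = next (star a) (star b) (star x) := by
  simp [prev_apply, next_apply]

theorem star_next (a b x : Oct γ) : star (next a b x) = prev (star a) (star b) (star x) := by
  simp [prev_apply, next_apply]

theorem star_own (a b x : Oct γ) : star (own a b x) = own (star a) (star b) (star x) := by
  simp [own_eq, ip_star]

theorem tri_prev (a b x y : Oct γ) :
    prev a b (star (x * y)) = star (own a b x * y) + star (x * next a b y) := by
  have h := tri_next (star a) (star b) (star y) (star x)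
  apply star_injective
  rw [star_prev]
  simp only [star_add, star_mul, star_star, star_next, star_own] at h ⊢
  rw [h]; abel

end Oct

/-! ## The algebra `𝕆' ⊗ 𝕆` -/

section Additive
variable {A : Type*} [NonAssocRing A] [StarRing A] [Module ℝ A] [SMulCommClass ℝ A A]
  [IsScalarTower ℝ A A] [StarModule ℝ A]

theorem own_add_left (a a' b : A) : own (a + a') b = own a b + own a' b := by
  ext c; simp only [own_apply, LinearMap.add_apply, star_add, add_mul, mul_add]; abel
theorem own_add_right (a b b' : A) : own a (b + b') = own a b + own a b' := by
  ext c; simp only [own_apply, LinearMap.add_apply, star_add, add_mul, mul_add]; abel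
theorem next_add_left (a a' b : A) : next (a + a') b = next a b + next a' b := by
  ext c; simp only [next_apply, LinearMap.add_apply, star_add, add_mul, mul_add]; abel
theorem next_add_right (a b b' : A) : next a (b + b') = next a b + next a b' := by
  ext c; simp only [next_apply, LinearMap.add_apply, star_add, add_mul, mul_add]; abel
theorem prev_add_left (a a' b : A) : prev (a + a') b = prev a b + prev a' b := by
  ext c; simp only [prev_apply, LinearMap.add_apply, star_add, add_mul, mul_add]; abel
theorem prev_add_right (a b b' : A) : prev a (b + b') = prev a b + prev a b' := by
  ext c; simp only [prev_apply, LinearMap.add_apply, star_add, add_mul, mul_add]; abel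
theorem own_smul_left (r : ℝ) (a b : A) : own (r • a) b = r • own a b := by
  ext c; simp only [own_apply, LinearMap.smul_apply, star_smul, star_trivial, smul_mul_assoc,
    mul_smul_comm]; module
theorem own_smul_right (r : ℝ) (a b : A) : own a (r • b) = r • own a b := by
  ext c; simp only [own_apply, LinearMap.smul_apply, star_smul, star_trivial, smul_mul_assoc,
    mul_smul_comm]; module
theorem next_smul_left (r : ℝ) (a b : A) : next (r • a) b = r • next a b := by
  ext c; simp only [next_apply, LinearMap.smul_apply, star_smul, star_trivial, smul_mul_assoc,
    mul_smul_comm]; module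
theorem next_smul_right (r : ℝ) (a b : A) : next a (r • b) = r • next a b := by
  ext c; simp only [next_apply, LinearMap.smul_apply, star_smul, star_trivial, smul_mul_assoc,
    mul_smul_comm]; module
theorem prev_smul_left (r : ℝ) (a b : A) : prev (r • a) b = r • prev a b := by
  ext c; simp only [prev_apply, LinearMap.smul_apply, star_smul, star_trivial, smul_mul_assoc,
    mul_smul_comm]; module
theorem prev_smul_right (r : ℝ) (a b : A) : prev a (r • b) = r • prev a b := by
  ext c; simp only [prev_apply, LinearMap.smul_apply, star_smul, star_trivial, smul_mul_assoc,
    mul_smul_comm]; module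
theorem own_sub_left (a a' b : A) : own (a - a') b = own a b - own a' b := by
  rw [eq_sub_iff_add_eq, ← own_add_left, sub_add_cancel]
theorem own_sub_right (a b b' : A) : own a (b - b') = own a b - own a b' := by
  rw [eq_sub_iff_add_eq, ← own_add_right, sub_add_cancel]
theorem next_sub_left (a a' b : A) : next (a - a') b = next a b - next a' b := by
  rw [eq_sub_iff_add_eq, ← next_add_left, sub_add_cancel]
theorem next_sub_right (a b b' : A) : next a (b - b') = next a b - next a b' := by
  rw [eq_sub_iff_add_eq, ← next_add_right, sub_add_cancel]
theorem prev_sub_left (a a' b : A) : prev (a - a') b = prev a b - prev a' b := by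
  rw [eq_sub_iff_add_eq, ← prev_add_left, sub_add_cancel]
theorem prev_sub_right (a b b' : A) : prev a (b - b') = prev a b - prev a b' := by
  rw [eq_sub_iff_add_eq, ← prev_add_right, sub_add_cancel]
theorem own_self (a : A) : own a a = 0 := by ext c; simp [own_apply]
theorem next_self (a : A) : next a a = 0 := by ext c; simp [next_apply]
theorem prev_self (a : A) : prev a a = 0 := by ext c; simp [prev_apply]
theorem own_swap (a b : A) : own b a = -own a b := by
  ext c; simp only [own_apply, LinearMap.neg_apply]; abel
theorem next_swap (a b : A) : next b a = -next a b := by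
  ext c; simp only [next_apply, LinearMap.neg_apply]; abel
theorem prev_swap (a b : A) : prev b a = -prev a b := by
  ext c; simp only [prev_apply, LinearMap.neg_apply]; abel
end Additive

/-- `𝕆' ⊗ 𝕆`, with the split octonions as left factor. -/
abbrev BiOct : Type := Oct 1 ⊗[ℝ] Oct (-1)

namespace BiOct
open Oct

theorem next_tmul (P R S : Oct 1) (p r s : Oct (-1)) :
    next (P ⊗ₜ[ℝ] p) (R ⊗ₜ[ℝ] r) (S ⊗ₜ[ℝ] s) =
      ip P R • (S ⊗ₜ[ℝ] next p r s) + ip p r • (next P R S ⊗ₜ[ℝ] s) := by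
  simp only [next_apply, Algebra.TensorProduct.tmul_mul_tmul, TensorProduct.star_tmul]
  rw [eq_sub_of_add_eq' (comp_left P R S), eq_sub_of_add_eq' (comp_left p r s)]
  simp only [TensorProduct.sub_tmul, TensorProduct.tmul_sub, ← TensorProduct.smul_tmul',
    TensorProduct.tmul_smul]
  module

theorem prev_tmul (P R S : Oct 1) (p r s : Oct (-1)) :
    prev (P ⊗ₜ[ℝ] p) (R ⊗ₜ[ℝ] r) (S ⊗ₜ[ℝ] s) =
      ip P R • (S ⊗ₜ[ℝ] prev p r s) + ip p r • (prev P R S ⊗ₜ[ℝ] s) := by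
  simp only [prev_apply, Algebra.TensorProduct.tmul_mul_tmul, TensorProduct.star_tmul]
  rw [eq_sub_of_add_eq (comp_right P R S), eq_sub_of_add_eq (comp_right p r s)]
  simp only [TensorProduct.sub_tmul, TensorProduct.tmul_sub, ← TensorProduct.smul_tmul',
    TensorProduct.tmul_smul]
  module

theorem mul_ip {γ : ℝ} (a b c : Oct γ) : c * (star a * b) + c * (star b * a) = (2 * ip a b) • c := by
  have := congrArg (c * ·) (comp_left a b 1)
  simpa [mul_add] using this

theorem own_tmul (P R S : Oct 1) (p r s : Oct (-1)) :
    own (P ⊗ₜ[ℝ] p) (R ⊗ₜ[ℝ] r) (S ⊗ₜ[ℝ] s) =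
      ip P R • (S ⊗ₜ[ℝ] own p r s) + ip p r • (own P R S ⊗ₜ[ℝ] s) := by
  simp only [own_apply, Algebra.TensorProduct.tmul_mul_tmul, TensorProduct.star_tmul]
  rw [eq_sub_of_add_eq' (comp_left' P R S), eq_sub_of_add_eq' (comp_left' p r s),
    eq_sub_of_add_eq' (mul_ip P R S), eq_sub_of_add_eq' (mul_ip p r s)]
  simp only [TensorProduct.sub_tmul, TensorProduct.tmul_sub, TensorProduct.add_tmul,
    TensorProduct.tmul_add, ← TensorProduct.smul_tmul', TensorProduct.tmul_smul]
  module

theorem mul_tmul (P R : Oct 1) (p r : Oct (-1)) :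
    (P ⊗ₜ[ℝ] p) * (R ⊗ₜ[ℝ] r) = (P * R) ⊗ₜ[ℝ] (p * r) :=
  Algebra.TensorProduct.tmul_mul_tmul P R p r

theorem tri_own (a b x y : BiOct) :
    own a b (star (x * y)) = star (next a b x * y) + star (x * prev a b y) := by
  induction a using TensorProduct.induction_on with
  | zero => simp [own_apply, next_apply, prev_apply]
  | add a a' h h' =>
    simp only [own_add_left, next_add_left, prev_add_left, LinearMap.add_apply, add_mul, mul_add,
      star_add, h, h']; abel
  | tmul P p =>
  induction b using TensorProduct.induction_on with
  | zero => simp [own_apply, next_apply, prev_apply]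
  | add a a' h h' =>
    simp only [own_add_right, next_add_right, prev_add_right, LinearMap.add_apply, add_mul,
      mul_add, star_add, h, h']; abel
  | tmul R r =>
  induction x using TensorProduct.induction_on with
  | zero => simp
  | add a a' h h' => simp only [map_add, add_mul, star_add, h, h']; abel
  | tmul S s =>
  induction y using TensorProduct.induction_on with
  | zero => simp
  | add a a' h h' => simp only [map_add, mul_add, star_add, h, h']; abel
  | tmul W w =>
  simp only [mul_tmul, TensorProduct.star_tmul, own_tmul, next_tmul, prev_tmul, Oct.tri_own,
    TensorProduct.tmul_add, TensorProduct.add_tmul, add_mul, mul_add, smul_mul_assoc,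
    mul_smul_comm, star_add, star_smul, star_trivial]
  module

theorem tri_next (a b x y : BiOct) :
    next a b (star (x * y)) = star (prev a b x * y) + star (x * own a b y) := by
  induction a using TensorProduct.induction_on with
  | zero => simp [own_apply, next_apply, prev_apply]
  | add a a' h h' =>
    simp only [own_add_left, next_add_left, prev_add_left, LinearMap.add_apply, add_mul, mul_add,
      star_add, h, h']; abel
  | tmul P p =>
  induction b using TensorProduct.induction_on with
  | zero => simp [own_apply, next_apply, prev_apply]
  | add a a' h h' =>
    simp only [own_add_right, next_add_right, prev_add_right, LinearMap.add_apply, add_mul,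
      mul_add, star_add, h, h']; abel
  | tmul R r =>
  induction x using TensorProduct.induction_on with
  | zero => simp
  | add a a' h h' => simp only [map_add, add_mul, star_add, h, h']; abel
  | tmul S s =>
  induction y using TensorProduct.induction_on with
  | zero => simp
  | add a a' h h' => simp only [map_add, mul_add, star_add, h, h']; abel
  | tmul W w =>
  simp only [mul_tmul, TensorProduct.star_tmul, own_tmul, next_tmul, prev_tmul, Oct.tri_next,
    TensorProduct.tmul_add, TensorProduct.add_tmul, add_mul, mul_add, smul_mul_assoc,
    mul_smul_comm, star_add, star_smul, star_trivial]
  module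

theorem tri_prev (a b x y : BiOct) :
    prev a b (star (x * y)) = star (own a b x * y) + star (x * next a b y) := by
  induction a using TensorProduct.induction_on with
  | zero => simp [own_apply, next_apply, prev_apply]
  | add a a' h h' =>
    simp only [own_add_left, next_add_left, prev_add_left, LinearMap.add_apply, add_mul, mul_add,
      star_add, h, h']; abel
  | tmul P p =>
  induction b using TensorProduct.induction_on with
  | zero => simp [own_apply, next_apply, prev_apply]
  | add a a' h h' =>
    simp only [own_add_right, next_add_right, prev_add_right, LinearMap.add_apply, add_mul,
      mul_add, star_add, h, h']; abel
  | tmul R r =>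
  induction x using TensorProduct.induction_on with
  | zero => simp
  | add a a' h h' => simp only [map_add, add_mul, star_add, h, h']; abel
  | tmul S s =>
  induction y using TensorProduct.induction_on with
  | zero => simp
  | add a a' h h' => simp only [map_add, mul_add, star_add, h, h']; abel
  | tmul W w =>
  simp only [mul_tmul, TensorProduct.star_tmul, own_tmul, next_tmul, prev_tmul, Oct.tri_prev,
    TensorProduct.tmul_add, TensorProduct.add_tmul, add_mul, mul_add, smul_mul_assoc,
    mul_smul_comm, star_add, star_smul, star_trivial]
  module

theorem own_cyc (a b c y : BiOct) :
    own a (star (b * c)) y + prev b (star (c * a)) y + next c (star (a * b)) y = 0 := by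
  induction a using TensorProduct.induction_on with
  | zero => simp [own_apply, next_apply, prev_apply]
  | add a a' h h' =>
    simp only [own_add_left, next_add_right, prev_add_right, LinearMap.add_apply, add_mul,
      mul_add, star_add]
    linear_combination (norm := abel) h + h'
  | tmul P p =>
  induction b using TensorProduct.induction_on with
  | zero => simp [own_apply, next_apply, prev_apply]
  | add a a' h h' =>
    simp only [own_add_right, next_add_right, prev_add_left, LinearMap.add_apply, add_mul,
      mul_add, star_add]
    linear_combination (norm := abel) h + h'
  | tmul R r =>
  induction c using TensorProduct.induction_on with
  | zero => simp [own_apply, next_apply, prev_apply]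
  | add a a' h h' =>
    simp only [own_add_right, next_add_left, prev_add_right, LinearMap.add_apply, add_mul,
      mul_add, star_add]
    linear_combination (norm := abel) h + h'
  | tmul S s =>
  induction y using TensorProduct.induction_on with
  | zero => simp
  | add a a' h h' =>
    simp only [map_add]
    linear_combination (norm := abel) h + h'
  | tmul W w =>
  have h := congrArg (W ⊗ₜ[ℝ] ·) (Oct.own_cyc p r s w)
  have h' := congrArg (· ⊗ₜ[ℝ] w) (Oct.own_cyc P R S W)
  simp only [TensorProduct.tmul_add, TensorProduct.add_tmul, TensorProduct.tmul_zero,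
    TensorProduct.zero_tmul] at h h'
  simp only [mul_tmul, TensorProduct.star_tmul, own_tmul, next_tmul, prev_tmul]
  rw [ip_cyc P R S, ip_cyc p r s, ip_cyc R S P, ip_cyc r s p]
  linear_combination (norm := module) ip S (star (P * R)) • h + ip s (star (p * r)) • h'

theorem own_jacobi (a b c : BiOct) : own a b c + own b c a + own c a b = 0 := by
  simp only [own_apply]
  induction a using TensorProduct.induction_on with
  | zero => simp
  | add a a' h h' =>
    simp only [add_mul, mul_add, star_add] at h h' ⊢
    linear_combination (norm := abel) h + h'
  | tmul P p =>
  induction b using TensorProduct.induction_on with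
  | zero => simp
  | add a a' h h' =>
    simp only [add_mul, mul_add, star_add] at h h' ⊢
    linear_combination (norm := abel) h + h'
  | tmul R r =>
  induction c using TensorProduct.induction_on with
  | zero => simp
  | add a a' h h' =>
    simp only [add_mul, mul_add, star_add] at h h' ⊢
    linear_combination (norm := abel) h + h'
  | tmul S s =>
  simp only [← own_apply, own_tmul, own_eq, ip_comm R P, ip_comm r p, ip_comm S P, ip_comm s p,
    ip_comm S R, ip_comm s r, TensorProduct.tmul_sub, TensorProduct.sub_tmul,
    TensorProduct.tmul_smul, ← TensorProduct.smul_tmul']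
  module

/-- The composition commutator of a diagonal generalized matrix with `X_c` is the operator of left
multiplication by `own a b c`, so that it is again an ordinary matrix. -/
theorem topEntry_comp (a b c : BiOct) :
    topEntry a b ∘ₗ LinearMap.mulLeft ℝ c - LinearMap.mulLeft ℝ c ∘ₗ botEntry a b =
      LinearMap.mulLeft ℝ (own a b c) := by
  refine LinearMap.ext fun x => ?_
  have h := congrArg star (tri_prev a b c x)
  have h' : star (prev a b (star (c * x))) = topEntry a b (c * x) := by
    simp only [prev, LinearMap.comp_apply, conjL_apply, star_star]
  rw [h', star_add, star_star, star_star] at h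
  simp only [LinearMap.sub_apply, LinearMap.comp_apply, LinearMap.mulLeft_apply, h, next,
    add_sub_cancel_right]

end BiOct

/-! ## Generalized matrices and `𝔢₈` -/

/-- Generalized `3 × 3` matrices.  The second component lists the parameters of the off-diagonal
part `X_p + Y_q + Z_r`.  The first component is the (generalized) diagonal part: its values at
`0, 1, 2` are the operators through which it acts, by commutators, on the parameters of `X`, `Y`,
`Z`; this is independent of the type (I, II or III) in which the diagonal part is written. -/
abbrev GMat : Type := (Fin 3 → Module.End ℝ BiOct) × (Fin 3 → BiOct)

namespace GMat

/-- The diagonal part of the composition commutator `[X_a, X_b]` (`t = 0`), `[Y_a, Y_b]` (`t = 1`) or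
`[Z_a, Z_b]` (`t = 2`). -/
def nested (t : Fin 3) (a b : BiOct) : Fin 3 → Module.End ℝ BiOct := fun i =>
  if i = t then own a b else if i = t + 1 then next a b else prev a b

/-- The commutator: diagonal parts act as described, `[X_p, Y_q] = Z_{-conj (pq)}` and cyclically,
and commutators of off-diagonal matrices of the same type are computed by composition. -/
def comm (x y : GMat) : GMat :=
  (fun i => x.1 i ∘ₗ y.1 i - y.1 i ∘ₗ x.1 i + ∑ t, nested t (x.2 t) (y.2 t) i,
   fun i => x.1 i (y.2 i) - y.1 i (x.2 i)
      - star (x.2 (i + 1) * y.2 (i + 2)) + star (y.2 (i + 1) * x.2 (i + 2)))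

/-- The diagonal generalized matrices, spanned by commutators of off-diagonal ones of equal type;
this is `𝔰𝔬(4,4) ⊕ 𝔰𝔬(8)`. -/
def diagonal : Submodule ℝ (Fin 3 → Module.End ℝ BiOct) :=
  Submodule.span ℝ {T | ∃ t a b, T = nested t a b}

theorem nested_self (t : Fin 3) (a b : BiOct) : nested t a b t = own a b := by simp [nested]
theorem nested_add_one (t : Fin 3) (a b : BiOct) : nested t a b (t + 1) = next a b := by
  fin_cases t <;> simp [nested]
theorem nested_add_two (t : Fin 3) (a b : BiOct) : nested t a b (t + 2) = prev a b := by
  fin_cases t <;> simp [nested]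

theorem add1 (i : Fin 3) : i + 1 + 1 = i + 2 := by fin_cases i <;> rfl
theorem add2 (i : Fin 3) : i + 1 + 2 = i := by fin_cases i <;> rfl
theorem add3 (i : Fin 3) : i + 2 + 1 = i := by fin_cases i <;> rfl
theorem add4 (i : Fin 3) : i + 2 + 2 = i + 1 := by fin_cases i <;> rfl

theorem sum_nested (u v : Fin 3 → BiOct) (i : Fin 3) : ∑ t, nested t (u t) (v t) i =
    own (u i) (v i) + prev (u (i + 1)) (v (i + 1)) + next (u (i + 2)) (v (i + 2)) := by
  rw [Fin.sum_univ_three]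
  fin_cases i <;> simp [nested] <;> abel

/-- Compatibility of the three operators of a diagonal generalized matrix (triality). -/
def IsTri (S : Fin 3 → Module.End ℝ BiOct) : Prop :=
  ∀ i x y, S i (star (x * y)) = star (S (i + 1) x * y) + star (x * S (i + 2) y)

theorem isTri_nested (t : Fin 3) (a b : BiOct) : IsTri (nested t a b) := by
  intro i x y
  have : i = t ∨ i = t + 1 ∨ i = t + 2 := by revert i t; decide
  rcases this with rfl | rfl | rfl
  · simp only [nested_self, nested_add_one, nested_add_two, BiOct.tri_own]
  · simp only [nested_self, nested_add_one, nested_add_two, BiOct.tri_next, add1, add2]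
  · simp only [nested_self, nested_add_one, nested_add_two, BiOct.tri_prev, add3, add4]

theorem isTri_diagonal {S : Fin 3 → Module.End ℝ BiOct} (hS : S ∈ diagonal) : IsTri S := by
  induction hS using Submodule.span_induction with
  | mem S h => obtain ⟨t, a, b, rfl⟩ := h; exact isTri_nested t a b
  | zero => intro i x y; simp
  | add S T _ _ h h' =>
    intro i x y
    simp only [Pi.add_apply, LinearMap.add_apply, h i, h' i, add_mul, mul_add, star_add]; abel
  | smul r S _ h =>
    intro i x y
    simp only [Pi.smul_apply, LinearMap.smul_apply, h i, smul_mul_assoc, mul_smul_comm, star_smul,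
      star_trivial, smul_add]

theorem eqv_next {S : Fin 3 → Module.End ℝ BiOct} (hS : IsTri S) (t : Fin 3) (a b c : BiOct) :
    S (t + 1) (next a b c) =
      next a b (S (t + 1) c) + next (S t a) b c + next a (S t b) c := by
  have key : ∀ a b c : BiOct, star b * (a * c) = star (star (a * c) * b) := by simp
  simp only [next_apply, key, map_sub]
  simp only [hS (t + 1), add1, add2, hS (t + 2), add3, add4, add_mul, star_add]
  abel

theorem eqv_prev {S : Fin 3 → Module.End ℝ BiOct} (hS : IsTri S) (t : Fin 3) (a b c : BiOct) :
    S (t + 2) (prev a b c) =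
      prev a b (S (t + 2) c) + prev (S t a) b c + prev a (S t b) c := by
  have key : ∀ a b c : BiOct, (c * a) * star b = star (b * star (c * a)) := by simp
  simp only [prev_apply, key, map_sub]
  simp only [hS (t + 1), add1, add2, hS (t + 2), add3, add4, mul_add, star_add]
  abel

theorem eqv_own {S : Fin 3 → Module.End ℝ BiOct} (hS : IsTri S) (t : Fin 3) (a b c : BiOct) :
    S t (own a b c) = own a b (S t c) + own (S t a) b c + own a (S t b) c := by
  obtain ⟨z, rfl⟩ : ∃ z, c = star (z * 1) := ⟨star c, by simp⟩
  have h1 := eqv_next hS t a b z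
  have h2 := eqv_prev hS t a b 1
  simp only [hS t, BiOct.tri_own, map_add, h1, h2, add_mul, mul_add, star_add]
  abel

theorem comm_nested {S : Fin 3 → Module.End ℝ BiOct} (hS : IsTri S) (t : Fin 3) (a b : BiOct) :
    (fun i => S i ∘ₗ nested t a b i - nested t a b i ∘ₗ S i) =
      nested t (S t a) b + nested t a (S t b) := by
  funext i
  refine LinearMap.ext fun c => ?_
  have : i = t ∨ i = t + 1 ∨ i = t + 2 := by revert i t; decide
  rcases this with rfl | rfl | rfl
  · simp [nested_self, eqv_own hS]; abel
  · simp [nested_add_one, eqv_next hS]; abel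
  · simp [nested_add_two, eqv_prev hS]; abel

theorem comm_mem {S T : Fin 3 → Module.End ℝ BiOct} (hS : S ∈ diagonal) (hT : T ∈ diagonal) :
    (fun i => S i ∘ₗ T i - T i ∘ₗ S i) ∈ diagonal := by
  induction hT using Submodule.span_induction with
  | mem T h =>
    obtain ⟨t, a, b, rfl⟩ := h
    rw [comm_nested (isTri_diagonal hS)]
    exact add_mem (Submodule.subset_span ⟨_, _, _, rfl⟩) (Submodule.subset_span ⟨_, _, _, rfl⟩)
  | zero => convert diagonal.zero_mem using 1; funext i; simp
  | add U V _ _ h h' =>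
    convert add_mem h h' using 1
    funext i; simp [LinearMap.comp_add, LinearMap.add_comp]; abel
  | smul r U _ h =>
    convert diagonal.smul_mem r h using 1
    funext i; simp [LinearMap.comp_smul, LinearMap.smul_comp, smul_sub]

end GMat

/-- `𝔢₈₍₋₂₄₎ = 𝔰𝔲(3, 𝕆' ⊗ 𝕆)`, as a space of generalized matrices. -/
def e8 : Submodule ℝ GMat := GMat.diagonal.prod ⊤

namespace e8
open GMat

theorem comm_mem {x y : GMat} (hx : x ∈ e8) (hy : y ∈ e8) : comm x y ∈ e8 := by
  refine ⟨?_, trivial⟩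
  have h1 := GMat.comm_mem hx.1 hy.1
  have h2 : (∑ t, nested t (x.2 t) (y.2 t)) ∈ diagonal :=
    sum_mem fun t _ => Submodule.subset_span ⟨_, _, _, rfl⟩
  have h3 : (comm x y).1 = (fun i => x.1 i ∘ₗ y.1 i - y.1 i ∘ₗ x.1 i) +
      ∑ t, nested t (x.2 t) (y.2 t) := by
    funext i; simp [GMat.comm]
  change (comm x y).1 ∈ diagonal
  rw [h3]
  exact add_mem h1 h2

instance : Bracket e8 e8 := ⟨fun x y => ⟨comm x y, comm_mem x.2 y.2⟩⟩

theorem lie_fst (x y : e8) (i : Fin 3) (c : BiOct) : (⁅x, y⁆ : e8).1.1 i c =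
    x.1.1 i (y.1.1 i c) - y.1.1 i (x.1.1 i c) + (own (x.1.2 i) (y.1.2 i) c +
      prev (x.1.2 (i + 1)) (y.1.2 (i + 1)) c + next (x.1.2 (i + 2)) (y.1.2 (i + 2)) c) := by
  change (x.1.1 i ∘ₗ y.1.1 i - y.1.1 i ∘ₗ x.1.1 i +
    ∑ t, nested t (x.1.2 t) (y.1.2 t) i) c = _
  rw [sum_nested]; simp

theorem lie_snd (x y : e8) (i : Fin 3) : (⁅x, y⁆ : e8).1.2 i =
    x.1.1 i (y.1.2 i) - y.1.1 i (x.1.2 i)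
      - star (x.1.2 (i + 1) * y.1.2 (i + 2)) + star (y.1.2 (i + 1) * x.1.2 (i + 2)) := rfl

theorem ext {x y : e8} (h1 : ∀ i c, x.1.1 i c = y.1.1 i c) (h2 : ∀ i, x.1.2 i = y.1.2 i) :
    x = y :=
  Subtype.ext (Prod.ext (funext fun i => LinearMap.ext (h1 i)) (funext h2))

@[simp] theorem add_fst (x y : e8) (i : Fin 3) : (x + y).1.1 i = x.1.1 i + y.1.1 i := rfl
@[simp] theorem add_snd (x y : e8) (i : Fin 3) : (x + y).1.2 i = x.1.2 i + y.1.2 i := rfl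
@[simp] theorem smul_fst (r : ℝ) (x : e8) (i : Fin 3) : (r • x).1.1 i = r • x.1.1 i := rfl
@[simp] theorem smul_snd (r : ℝ) (x : e8) (i : Fin 3) : (r • x).1.2 i = r • x.1.2 i := rfl

theorem jacobi_snd (x y z : e8) (i : Fin 3) :
    (⁅x, ⁅y, z⁆⁆ : e8).1.2 i = (⁅⁅x, y⁆, z⁆ + ⁅y, ⁅x, z⁆⁆ : e8).1.2 i := by
  have hx := isTri_diagonal x.2.1
  have hy := isTri_diagonal y.2.1
  have hz := isTri_diagonal z.2.1
  have key1 : ∀ a b c : BiOct, star b * (a * c) = star (star (a * c) * b) := by simp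
  have key2 : ∀ a b c : BiOct, (c * a) * star b = star (b * star (c * a)) := by simp
  have hj := BiOct.own_jacobi (x.1.2 i) (y.1.2 i) (z.1.2 i)
  have hs := own_swap (x.1.2 i) (z.1.2 i)
  have hj' : own (z.1.2 i) (x.1.2 i) (y.1.2 i) = - own (x.1.2 i) (z.1.2 i) (y.1.2 i) := by
    rw [hs]; simp
  rw [hj'] at hj
  simp only [add_snd, lie_snd, lie_fst, add1, add2, add3, add4, map_add, map_sub, hx i, hy i,
    hz i, mul_add, mul_sub, add_mul, sub_mul, star_add, star_sub, next_apply, prev_apply, key1,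
    key2]
  linear_combination (norm := abel) -hj

theorem jacobi_fst (x y z : e8) (i : Fin 3) (c : BiOct) :
    (⁅x, ⁅y, z⁆⁆ : e8).1.1 i c = (⁅⁅x, y⁆, z⁆ + ⁅y, ⁅x, z⁆⁆ : e8).1.1 i c := by
  have hx := isTri_diagonal x.2.1
  have hy := isTri_diagonal y.2.1
  have hz := isTri_diagonal z.2.1
  have hp : ∀ {S : Fin 3 → Module.End ℝ BiOct}, IsTri S → ∀ a b c : BiOct,
      S i (prev a b c) = prev a b (S i c) + prev (S (i + 1) a) b c + prev a (S (i + 1) b) c := by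
    intro S hS a b c
    have := eqv_prev hS (i + 1) a b c
    rwa [add2] at this
  have hn : ∀ {S : Fin 3 → Module.End ℝ BiOct}, IsTri S → ∀ a b c : BiOct,
      S i (next a b c) = next a b (S i c) + next (S (i + 2) a) b c + next a (S (i + 2) b) c := by
    intro S hS a b c
    have := eqv_next hS (i + 2) a b c
    rwa [add3] at this
  have swap : ∀ (x y z : e8), own (z.1.2 i) (star (x.1.2 (i + 1) * y.1.2 (i + 2))) c =
      - own (star (x.1.2 (i + 1) * y.1.2 (i + 2))) (z.1.2 i) c := by
    intro x y z; rw [own_swap]; simp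
  have swap1 : ∀ (x y z : e8), prev (z.1.2 (i + 1)) (star (x.1.2 (i + 2) * y.1.2 i)) c =
      - prev (star (x.1.2 (i + 2) * y.1.2 i)) (z.1.2 (i + 1)) c := by
    intro x y z; rw [prev_swap]; simp
  have swap2 : ∀ (x y z : e8), next (z.1.2 (i + 2)) (star (x.1.2 i * y.1.2 (i + 1))) c =
      - next (star (x.1.2 i * y.1.2 (i + 1))) (z.1.2 (i + 2)) c := by
    intro x y z; rw [next_swap]; simp
  have hc : ∀ x y z : e8, _ := fun x y z =>
    BiOct.own_cyc (x.1.2 i) (y.1.2 (i + 1)) (z.1.2 (i + 2)) c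
  have h1 := hc x y z
  have h2 := hc x z y
  have h3 := hc y x z
  have h4 := hc y z x
  have h5 := hc z x y
  have h6 := hc z y x
  have s1 := LinearMap.congr_fun (own_swap (z.1.1 i (x.1.2 i)) (y.1.2 i)) c
  have s2 := LinearMap.congr_fun (prev_swap (z.1.1 (i + 1) (x.1.2 (i + 1))) (y.1.2 (i + 1))) c
  have s3 := LinearMap.congr_fun (next_swap (z.1.1 (i + 2) (x.1.2 (i + 2))) (y.1.2 (i + 2))) c
  simp only [LinearMap.neg_apply] at s1 s2 s3
  simp only [swap, swap1, swap2] at h1 h2 h3 h4 h5 h6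
  simp only [add_fst, LinearMap.add_apply, lie_snd, lie_fst, add1, add2, add3, add4, map_add,
    map_sub, eqv_own hx, eqv_own hy, eqv_own hz, hp hx, hp hy, hp hz, hn hx, hn hy, hn hz,
    own_add_left, own_add_right, own_sub_left, own_sub_right, next_add_left, next_add_right,
    next_sub_left, next_sub_right, prev_add_left, prev_add_right, prev_sub_left, prev_sub_right,
    LinearMap.sub_apply, swap, swap1, swap2]
  linear_combination (norm := abel) -h1 + h2 + h3 - h4 - h5 + h6 + s1 + s2 + s3

instance : LieRing e8 where
  add_lie x y z := by
    refine ext (fun i c => ?_) (fun i => ?_)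
    · simp only [add_fst, lie_fst, LinearMap.add_apply, add_snd, own_add_left, prev_add_left,
        next_add_left, map_add]; abel
    · simp only [add_snd, lie_snd, add_fst, LinearMap.add_apply, map_add, add_mul, mul_add,
        star_add]; abel
  lie_add x y z := by
    refine ext (fun i c => ?_) (fun i => ?_)
    · simp only [add_fst, lie_fst, LinearMap.add_apply, add_snd, own_add_right, prev_add_right,
        next_add_right, map_add]; abel
    · simp only [add_snd, lie_snd, add_fst, LinearMap.add_apply, map_add, add_mul, mul_add,
        star_add]; abel
  lie_self x := by
    refine ext (fun i c => ?_) (fun i => ?_)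
    · simp [lie_fst, own_self, next_self, prev_self]
    · simp [lie_snd]
  leibniz_lie x y z := ext (jacobi_fst x y z) (jacobi_snd x y z)

instance : LieAlgebra ℝ e8 where
  lie_smul r x y := by
    refine ext (fun i c => ?_) (fun i => ?_)
    · simp only [smul_fst, lie_fst, LinearMap.smul_apply, smul_snd, own_smul_right,
        prev_smul_right, next_smul_right, map_smul]; module
    · simp only [smul_snd, lie_snd, smul_fst, LinearMap.smul_apply, map_smul, smul_mul_assoc,
        mul_smul_comm, star_smul, star_trivial]; module

/-- The off-diagonal matrix of type `t` with parameter `p`. -/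
def off (t : Fin 3) (p : BiOct) : e8 := ⟨(0, Pi.single t p), diagonal.zero_mem, trivial⟩

/-- `p` at `(1,2)`, `-p̄` at `(2,1)`. -/
def X (p : BiOct) : e8 := off 0 p
/-- `p` at `(2,3)`, `-p̄` at `(3,2)`. -/
def Y (p : BiOct) : e8 := off 1 p
/-- `p` at `(3,1)`, `-p̄` at `(1,3)`. -/
def Z (p : BiOct) : e8 := off 2 p

/-- `D_q = diag (q, -q, 0)`. -/
def D (q : BiOct) : e8 := (1 / 2 : ℝ) • ⁅X 1, X q⁆
/-- `E_q = diag (0, q, -q)`. -/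
def E (q : BiOct) : e8 := (1 / 2 : ℝ) • ⁅Y 1, Y q⁆
/-- `F_q = diag (-q, 0, q)`. -/
def F (q : BiOct) : e8 := (1 / 2 : ℝ) • ⁅Z 1, Z q⁆

/-- `D_{p,q} = diag (p ∘ q, p ∘ q, 0)` for orthogonal imaginary `p`, `q`. -/
def DD (p q : BiOct) : e8 := (1 / 2 : ℝ) • ⁅X p, X q⁆
/-- `E_{p,q} = diag (0, p ∘ q, p ∘ q)` for orthogonal imaginary `p`, `q`. -/
def EE (p q : BiOct) : e8 := (1 / 2 : ℝ) • ⁅Y p, Y q⁆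
/-- `F_{p,q} = diag (p ∘ q, 0, p ∘ q)` for orthogonal imaginary `p`, `q`. -/
def FF (p q : BiOct) : e8 := (1 / 2 : ℝ) • ⁅Z p, Z q⁆

/-- `S_q = E_q - F_q = diag (q, q, -2q)`. -/
def S (q : BiOct) : e8 := E q - F q

/-- `(p ∘ q) 𝓘`, for orthogonal imaginary `p`, `q`. -/
def nestedScalar (p q : BiOct) : e8 := (1 / 2 : ℝ) • (DD p q + EE p q + FF p q)

theorem off_add (t : Fin 3) (p q : BiOct) : off t (p + q) = off t p + off t q :=
  Subtype.ext (Prod.ext (by simp [off]) (by simp [off, Pi.single_add]))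

theorem off_smul (t : Fin 3) (r : ℝ) (p : BiOct) : off t (r • p) = r • off t p :=
  Subtype.ext (Prod.ext (by simp [off]) (by simp [off, Pi.single_smul]))

end e8

/-! ## The basis units -/

namespace Oct
variable {γ : ℝ}

def i : Oct γ := co 0 1 0 0 0 0 0 0
def j : Oct γ := co 0 0 1 0 0 0 0 0
def k : Oct γ := co 0 0 0 1 0 0 0 0
def l : Oct γ := co 0 0 0 0 1 0 0 0
def il : Oct γ := co 0 0 0 0 0 1 0 0
def jl : Oct γ := co 0 0 0 0 0 0 1 0
def kl : Oct γ := co 0 0 0 0 0 0 0 1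

/-- The seven imaginary basis units. -/
def unit : Fin 7 → Oct γ := ![i, j, k, kl, jl, il, l]

/-- The eight basis units. -/
def basisUnit : Fin 8 → Oct γ := ![1, i, j, k, kl, jl, il, l]

/-- For each imaginary unit `p`, the three pairs of units `a(p)`, `b(p)`, `c(p)` generating the
quaternionic subalgebras that contain `p`. -/
def pairA : Fin 7 → Oct (-1) × Oct (-1) :=
  ![(j, k), (k, i), (i, j), (jl, i), (il, k), (kl, j), (il, i)]
def pairB : Fin 7 → Oct (-1) × Oct (-1) :=
  ![(kl, jl), (il, kl), (jl, il), (j, il), (i, kl), (k, jl), (jl, j)]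
def pairC : Fin 7 → Oct (-1) × Oct (-1) :=
  ![(l, il), (l, jl), (l, kl), (k, l), (j, l), (i, l), (kl, k)]

end Oct

namespace e8
open Oct

/-- `D_{p,q}` for octonions `p`, `q`. -/
def DO (p : Oct (-1) × Oct (-1)) : e8 := DD (1 ⊗ₜ p.1) (1 ⊗ₜ p.2)

/-- `-A_p = D_{a(p)} - D_{b(p)}`, for the octonionic units `p`. -/
def A (n : Fin 7) : e8 := -(DO (pairA n) - DO (pairB n))

/-- `-G_p = D_{a(p)} + D_{b(p)} - 2 D_{c(p)}`, for the octonionic units `p`. -/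
def G (n : Fin 7) : e8 := -(DO (pairA n) + DO (pairB n) - (2 : ℝ) • DO (pairC n))

/-- `G_Q = -2 (QL ∘ L) 𝓘`, for split octonions `Q` orthogonal to `1` and `L`. -/
def GS (Q : Oct 1) : e8 := (-2 : ℝ) • nestedScalar ((Q * l) ⊗ₜ 1) (l ⊗ₜ 1)

/-! ## `𝔢₆` and the spaces `H_Q` -/

/-- The 78 generators of `𝔢₆`. -/
def e6Generators : Set e8 :=
  Set.range A ∪ Set.range G ∪ Set.range (fun n => S (1 ⊗ₜ unit n)) ∪
  Set.range (fun n => D (1 ⊗ₜ unit n)) ∪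
  Set.range (fun n => X (1 ⊗ₜ basisUnit n)) ∪ Set.range (fun n => Y (1 ⊗ₜ basisUnit n)) ∪
  Set.range (fun n => Z (1 ⊗ₜ basisUnit n)) ∪
  Set.range (fun n => X (l ⊗ₜ basisUnit n)) ∪ Set.range (fun n => Y (l ⊗ₜ basisUnit n)) ∪
  Set.range (fun n => Z (l ⊗ₜ basisUnit n)) ∪ {D (l ⊗ₜ 1), S (l ⊗ₜ 1)}

/-- `𝔢₆₍₋₂₆₎ = 𝔰𝔲(3, ℂ' ⊗ 𝕆)` inside `𝔢₈₍₋₂₄₎`. -/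
def e6 : LieSubalgebra ℝ e8 := LieSubalgebra.lieSpan ℝ e8 e6Generators

/-- `H_Q = ⟨X_{pQ}, Y_{pQ}, Z_{pQ}, D_Q, S_Q, G_Q⟩`. -/
def H (Q : Oct 1) : Submodule ℝ e8 :=
  Submodule.span ℝ (Set.range (fun n => X (Q ⊗ₜ basisUnit n)) ∪
    Set.range (fun n => Y (Q ⊗ₜ basisUnit n)) ∪ Set.range (fun n => Z (Q ⊗ₜ basisUnit n)) ∪
    {D (Q ⊗ₜ 1), S (Q ⊗ₜ 1), GS Q})

/-- The six null labels: `2Q ∈ {I ± IL, J ± JL, K ± KL}`. -/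
def labels : Set (Oct 1) :=
  {Q | (2 : ℝ) • Q ∈ ({i + il, i - il, j + jl, j - jl, k + kl, k - kl} : Set (Oct 1))}

/-- The element of `𝔢₈` given by an ordinary anti-Hermitian trace-free matrix `M` over `𝕆' ⊗ 𝕆`; its
diagonal part is `diag (M₁₁, -M₁₁ - M₃₃, M₃₃) = D_{M₁₁} - E_{M₃₃}`. -/
def ofMatrix (M : Matrix (Fin 3) (Fin 3) BiOct) : e8 :=
  X (M 0 1) + Y (M 1 2) + Z (M 2 0) + D (M 0 0) - E (M 2 2)

/-- The matrix `Q𝓜` over `𝕆' ⊗ 𝕆`, for a split octonion `Q` and an octonionic matrix `𝓜`. -/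
def mulLabel (Q : Oct 1) (M : Matrix (Fin 3) (Fin 3) (Oct (-1))) :
    Matrix (Fin 3) (Fin 3) BiOct := M.map (fun m => Q ⊗ₜ m)

end e8

/-! ## The Albert algebra and the action of `𝔢₆` on it -/

open Matrix in
/-- The Albert algebra `H₃(𝕆)`. -/
def Albert : Submodule ℝ (Matrix (Fin 3) (Fin 3) (Oct (-1))) where
  carrier := {P | Pᴴ = P}
  add_mem' {P R} hP hR := by
    rw [Set.mem_ofPred_eq, Matrix.conjTranspose_add, hP, hR]
  zero_mem' := Matrix.conjTranspose_zero
  smul_mem' r P hP := by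
    rw [Set.mem_ofPred_eq, Matrix.conjTranspose_smul, hP, star_trivial]

namespace Albert

/-- The (real) trace of an element of the Albert algebra. -/
def tr (P : Albert) : ℝ := (Matrix.trace P.1).1.re

/-- The action `P ↦ M P + P M†`. -/
def act (M : Matrix (Fin 3) (Fin 3) (Oct (-1))) : Module.End ℝ Albert where
  toFun P := ⟨M * P.1 + P.1 * Mᴴ, by
    change (M * P.1 + P.1 * Mᴴ)ᴴ = _
    have hP : P.1ᴴ = P.1 := P.2
    rw [Matrix.conjTranspose_add, Matrix.conjTranspose_mul, Matrix.conjTranspose_mul, hP,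
      Matrix.conjTranspose_conjTranspose, add_comm]⟩
  map_add' P R := Subtype.ext (by
    change M * (P.1 + R.1) + (P.1 + R.1) * Mᴴ = (M * P.1 + P.1 * Mᴴ) + (M * R.1 + R.1 * Mᴴ)
    rw [Matrix.mul_add, Matrix.add_mul]; abel)
  map_smul' r P := Subtype.ext (by
    change M * (r • P.1) + (r • P.1) * Mᴴ = r • (M * P.1 + P.1 * Mᴴ)
    rw [Matrix.mul_smul, Matrix.smul_mul, smul_add])

/-- `𝔢₆₍₋₂₆₎ = 𝔰𝔩(3, 𝕆)`, acting on the Albert algebra: the Lie algebra generated by the actions of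
the trace-free anti-Hermitian (rotations) and the trace-free Hermitian (boosts) octonionic
matrices. -/
def sl3O : LieSubalgebra ℝ (Module.End ℝ Albert) :=
  LieSubalgebra.lieSpan ℝ (Module.End ℝ Albert)
    {f | ∃ M : Matrix (Fin 3) (Fin 3) (Oct (-1)), M.trace = 0 ∧ (Mᴴ = -M ∨ Mᴴ = M) ∧ f = act M}

end Albert

namespace e8
open Albert

/-- The element `Q𝓟` of `𝔢₈`: if `𝓟 = 𝓟₀ + (tr 𝓟 / 3) 𝓘` with `𝓟₀` trace-free, then `Q𝓟₀` is an
ordinary anti-Hermitian matrix, and `Q𝓘` stands for `-½ G_Q`. -/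
def labelled (Q : Oct 1) (P : Albert) : e8 :=
  ofMatrix (mulLabel Q (P.1 - (tr P / 3) • 1)) + (tr P / 3) • ((-1 / 2 : ℝ) • GS Q)

/-- The rotation of `𝔢₈` given by an anti-Hermitian trace-free octonionic matrix. -/
def rotation (M : Matrix (Fin 3) (Fin 3) (Oct (-1))) : e8 := ofMatrix (mulLabel 1 M)

/-- The boost `ℬL` of `𝔢₈` given by a Hermitian trace-free octonionic matrix `ℬ`. -/
def boost (M : Matrix (Fin 3) (Fin 3) (Oct (-1))) : e8 := ofMatrix (mulLabel Oct.l M)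

end e8

end

noncomputable section
set_option linter.unusedSimpArgs false

/-! ### Octonionic coordinates, the norm form, and triality triples. -/

namespace Oct
variable {γ : ℝ}

/-! An element of `e8` consists of a diagonal part, given by three operators on 𝕆' ⊗ 𝕆, and of three
off-diagonal parameters. On pure tensors the bracket of two off-diagonal matrices of one type splits
into a triality operator on 𝕆, weighted by the norm form of 𝕆', and one on 𝕆', weighted by the norm
form of 𝕆 (`BiOct.nested_tmul`). A label Q is orthogonal to 1 and to L, so the brackets of X_{1⊗m}
or X_{L⊗m} with X_{Q⊗p}, and likewise for Y and Z, act on 𝕆' alone.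

The pivot is the operator `pairOp Q a b c`: the action of diag(a, b, c)Q on the entry between a and
b. It is linear in (a, b, c), and it needs no trace condition: the triple (1, 1, 1) gives the
operators of -½ G_Q, which is why Q𝓘 is read that way. With the trace decomposition absorbed like
this, `labelled_fst` describes the diagonal part of Q𝓟 by one formula in the diagonal entries of 𝓟.
Brackets with rotations and boosts then become identities between values of `pairOp`. For boosts the
decisive one is `pairOp_commutator`: the commutator with diag(a', b', c')L, of trace zero,
multiplies the entries by 2a', 2b', 2c' and replaces Q by LQ. The results are
`lie_rotation_labelled` and `lie_boost_labelled`.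

For 𝔢₆, the off-diagonal matrices over the subalgebra ℂ' ⊗ 𝕆, together with their brackets of equal
type, span a Lie algebra `su3`. The generators lie in it. Conversely it lies in the span of the 78
generators: the three quaternionic pairs of p are recovered from A_p, G_p, S_p, all pairs of
imaginary units occur among them, and triality reduces brackets of Y's or of Z's to brackets of X's
(`su3_le_span`). Hence the span is closed. Its dimension is at least 78 because of an explicit
independent family of 48 + 28 + 2 elements.

The 48 off-diagonal generators are rotations and boosts, and they generate 𝔢₆. Consider the elements
of `e8` that act on all H_Q with LQ = Q through one operator T in 𝔰𝔩(3, 𝕆), and on all H_Q with LQ =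
-Q through an operator T' that is minus the adjoint of T for the trace form. They form a subalgebra
(`actingSubalgebra`) that contains rotations and boosts: rotations are skew for the trace form,
while boosts are symmetric and change sign with LQ = -Q. So it contains 𝔢₆. Since 𝓟 ↦ Q𝓟 is
injective, T is determined by x, and Φ(x) = T is a homomorphism. It is onto because its image
contains the generators of 𝔰𝔩(3, 𝕆), and it is injective by `eq_zero_of_lie_labelled`. The operator
T' is the dual action transported by the trace form.

The two types are inequivalent because the boost with matrix diag(1, 1, -2) has eigenvalues 2, -1,
-4 on one and -2, 1, 4 on the other. -/

theorem one_eq_co : (1 : Oct γ) = co 1 0 0 0 0 0 0 0 := by apply co_ext <;> simp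
theorem zero_eq_co : (0 : Oct γ) = co 0 0 0 0 0 0 0 0 := by apply co_ext <;> simp
theorem co_neg (a0 a1 a2 a3 a4 a5 a6 a7 : ℝ) : -(co a0 a1 a2 a3 a4 a5 a6 a7 : Oct γ) =
    co (-a0) (-a1) (-a2) (-a3) (-a4) (-a5) (-a6) (-a7) := by
  apply co_ext <;> simp

/-- The polarised norm as a bilinear form. -/
def ipL : Oct γ →ₗ[ℝ] Oct γ →ₗ[ℝ] ℝ :=
  LinearMap.mk₂ ℝ ip (fun a b c => by simp [ip, add_mul])
    (fun r a b => by simp [ip]; ring) (fun a b c => by simp [ip, mul_add])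
    (fun r a b => by simp [ip]; ring)

@[simp] theorem ipL_apply (a b : Oct γ) : ipL a b = ip a b := rfl
theorem ip_add_right (a b c : Oct γ) : ip a (b + c) = ip a b + ip a c := map_add (ipL a) b c
theorem ip_smul_left (r : ℝ) (a b : Oct γ) : ip (r • a) b = r * ip a b :=
  LinearMap.map_smul₂ ipL r a b
theorem ip_smul_right (r : ℝ) (a b : Oct γ) : ip a (r • b) = r * ip a b :=
  map_smul (ipL a) r b
theorem ip_neg_left (a b : Oct γ) : ip (-a) b = -ip a b := by simpa using ip_smul_left (-1) a b
theorem ip_neg_right (a b : Oct γ) : ip a (-b) = -ip a b := map_neg (ipL a) b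
theorem ip_sub_right (a b c : Oct γ) : ip a (b - c) = ip a b - ip a c := map_sub (ipL a) b c
theorem ip_zero_left (a : Oct γ) : ip 0 a = 0 := LinearMap.map_zero₂ ipL a
theorem ip_zero_right (a : Oct γ) : ip a 0 = 0 := map_zero (ipL a)

/-- The coordinates in the basis `1, i, j, k, kℓ, jℓ, iℓ, ℓ`. -/
theorem sum_basisUnit (p : Oct (-1)) : ∑ n, ip (basisUnit n) p • (basisUnit n : Oct (-1)) = p := by
  obtain ⟨a0, a1, a2, a3, a4, a5, a6, a7, rfl⟩ := eq_co p
  simp [Fin.sum_univ_eight, basisUnit, one_eq_co, i, j, k, kl, jl, il, l, co_ip, co_smul, co_add]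

theorem ip_basisUnit (m n : Fin 8) : ip (basisUnit m : Oct (-1)) (basisUnit n) =
    if m = n then 1 else 0 := by
  fin_cases m <;> fin_cases n <;>
    simp [basisUnit, one_eq_co, i, j, k, kl, jl, il, l, co_ip]

theorem ip_self_eq_zero {p : Oct (-1)} : ip p p = 0 ↔ p = 0 := by
  refine ⟨fun h => ?_, fun h => by rw [h, ip_zero_left]⟩
  obtain ⟨a0, a1, a2, a3, a4, a5, a6, a7, rfl⟩ := eq_co p
  rw [co_ip] at h
  rw [zero_eq_co]
  apply co_congr <;> nlinarith [sq_nonneg a0, sq_nonneg a1, sq_nonneg a2, sq_nonneg a3,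
    sq_nonneg a4, sq_nonneg a5, sq_nonneg a6, sq_nonneg a7]

/-- The triality triple of the pair `a, b`, with own component in position `t`. -/
def tri (t : Fin 3) (a b : Oct γ) : Fin 3 → Module.End ℝ (Oct γ) := fun i =>
  if i = t then own a b else if i = t + 1 then next a b else prev a b

theorem tri_self (t : Fin 3) (a : Oct γ) : tri t a a = 0 := by
  funext i; simp [tri, own_self, next_self, prev_self]

/-- All components of a triality triple are skew for the norm form. This later separates the
rotation part of an element of 𝔢₆ from its boost part, which acts on the octonionic factor by real
scalars. -/
theorem ip_tri_self (t i : Fin 3) (a b c : Oct γ) : ip c (tri t a b i c) = 0 := by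
  have h1 : ip c (own a b c) = 0 := by
    rw [own_eq, ip_sub_right, ip_smul_right, ip_smul_right, ip_comm c b, ip_comm c a]; ring
  have h2 : ip c (next a b c) = 0 := by
    obtain ⟨a0, a1, a2, a3, a4, a5, a6, a7, rfl⟩ := eq_co a
    obtain ⟨b0, b1, b2, b3, b4, b5, b6, b7, rfl⟩ := eq_co b
    obtain ⟨c0, c1, c2, c3, c4, c5, c6, c7, rfl⟩ := eq_co c
    rw [next_apply]
    simp only [co_mul, co_star, co_sub, co_ip]; ring
  have h3 : ip c (prev a b c) = 0 := by
    obtain ⟨a0, a1, a2, a3, a4, a5, a6, a7, rfl⟩ := eq_co a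
    obtain ⟨b0, b1, b2, b3, b4, b5, b6, b7, rfl⟩ := eq_co b
    obtain ⟨c0, c1, c2, c3, c4, c5, c6, c7, rfl⟩ := eq_co c
    rw [prev_apply]
    simp only [co_mul, co_star, co_sub, co_ip]; ring
  unfold tri
  split_ifs <;> assumption

end Oct

/-! ### Diagonal and off-diagonal elements of 𝔢₈ on pure tensors. -/

namespace BiOct
open Oct

/-- The splitting of the diagonal part into 𝔰𝔬(4,4) and 𝔰𝔬(8). Each summand vanishes as soon as the
pair in the other factor is orthogonal, or the pair in its own factor is equal. -/
theorem nested_tmul (t i : Fin 3) (P R S : Oct 1) (p r s : Oct (-1)) :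
    GMat.nested t (P ⊗ₜ p) (R ⊗ₜ r) i (S ⊗ₜ s) =
      ip P R • (S ⊗ₜ tri t p r i s) + ip p r • (tri t P R i S ⊗ₜ s) := by
  unfold GMat.nested tri
  split_ifs
  exacts [own_tmul .., next_tmul .., prev_tmul ..]

/-- Contraction of the split octonionic factor with `R`. -/
def contract (R : Oct 1) : BiOct →ₗ[ℝ] Oct (-1) :=
  (TensorProduct.lid ℝ (Oct (-1))).toLinearMap ∘ₗ LinearMap.rTensor _ (ipL R)

@[simp] theorem contract_tmul (R S : Oct 1) (s : Oct (-1)) :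
    contract R (S ⊗ₜ s) = ip R S • s := by simp [contract]

theorem end_ext {f g : Module.End ℝ BiOct} (h : ∀ S s, f (S ⊗ₜ s) = g (S ⊗ₜ s)) : f = g :=
  TensorProduct.ext' h

end BiOct

namespace e8
open GMat Oct

@[simp] theorem neg_fst (x : e8) (i : Fin 3) : (-x).1.1 i = -x.1.1 i := rfl
@[simp] theorem neg_snd (x : e8) (i : Fin 3) : (-x).1.2 i = -x.1.2 i := rfl
@[simp] theorem sub_fst (x y : e8) (i : Fin 3) : (x - y).1.1 i = x.1.1 i - y.1.1 i := rfl
@[simp] theorem sub_snd (x y : e8) (i : Fin 3) : (x - y).1.2 i = x.1.2 i - y.1.2 i := rfl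
@[simp] theorem zero_fst (i : Fin 3) : (0 : e8).1.1 i = 0 := rfl
@[simp] theorem zero_snd (i : Fin 3) : (0 : e8).1.2 i = 0 := rfl
@[simp] theorem off_fst (t i : Fin 3) (p : BiOct) : (off t p).1.1 i = 0 := rfl
theorem off_snd (t i : Fin 3) (p : BiOct) : (off t p).1.2 i = if i = t then p else 0 := by
  change (Pi.single t p : Fin 3 → BiOct) i = _
  rw [Pi.single_apply]

theorem ext_tmul {x y : e8} (h1 : ∀ i S s, x.1.1 i (S ⊗ₜ s) = y.1.1 i (S ⊗ₜ s))
    (h2 : ∀ i, x.1.2 i = y.1.2 i) : x = y :=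
  ext (fun i c => by rw [BiOct.end_ext (h1 i)]) h2

/-- The map `p ↦ off t p` as a linear map. -/
def offL (t : Fin 3) : BiOct →ₗ[ℝ] e8 where
  toFun := off t
  map_add' := off_add t
  map_smul' := off_smul t

@[simp] theorem offL_apply (t : Fin 3) (p : BiOct) : offL t p = off t p := rfl

theorem lie_off_off_fst (t i : Fin 3) (a b : BiOct) :
    (⁅off t a, off t b⁆ : e8).1.1 i = nested t a b i := by
  refine LinearMap.ext fun c => ?_
  rw [lie_fst]
  have : i = t ∨ i = t + 1 ∨ i = t + 2 := by revert i t; decide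
  rcases this with rfl | rfl | rfl
  · rw [nested_self]; fin_cases i <;> simp [off_snd, prev_apply, next_apply]
  · rw [nested_add_one]; fin_cases t <;> simp [off_snd, prev_apply, own_apply]
  · rw [nested_add_two]; fin_cases t <;> simp [off_snd, next_apply, own_apply]

theorem lie_off_off_snd (t i : Fin 3) (a b : BiOct) : (⁅off t a, off t b⁆ : e8).1.2 i = 0 := by
  rw [lie_snd]
  fin_cases t <;> fin_cases i <;> simp [off_snd]

theorem lie_off_succ (t : Fin 3) (a b : BiOct) :
    (⁅off t a, off (t + 1) b⁆ : e8) = off (t + 2) (-star (a * b)) := by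
  refine ext (fun i c => ?_) (fun i => ?_)
  · rw [lie_fst]
    fin_cases t <;> fin_cases i <;> simp [off_snd, next_apply, own_apply, prev_apply]
  · rw [lie_snd]
    fin_cases t <;> fin_cases i <;> simp [off_snd]

theorem lie_diag_off {x : e8} (hx : ∀ i, x.1.2 i = 0) (t : Fin 3) (c : BiOct) :
    ⁅x, off t c⁆ = off t (x.1.1 t c) := by
  refine ext (fun i c => ?_) (fun i => ?_)
  · rw [lie_fst]
    simp [hx, next_apply, own_apply, prev_apply]
  · rw [lie_snd]
    simp only [hx, off_snd]
    split_ifs with h <;> simp [h]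

theorem D_fst (q : BiOct) (i : Fin 3) : (D q).1.1 i = (1 / 2 : ℝ) • nested 0 1 q i := by
  rw [D, smul_fst, X, X, lie_off_off_fst]
theorem E_fst (q : BiOct) (i : Fin 3) : (E q).1.1 i = (1 / 2 : ℝ) • nested 1 1 q i := by
  rw [E, smul_fst, Y, Y, lie_off_off_fst]
theorem F_fst (q : BiOct) (i : Fin 3) : (F q).1.1 i = (1 / 2 : ℝ) • nested 2 1 q i := by
  rw [F, smul_fst, Z, Z, lie_off_off_fst]
theorem DD_fst (p q : BiOct) (i : Fin 3) : (DD p q).1.1 i = (1 / 2 : ℝ) • nested 0 p q i := by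
  rw [DD, smul_fst, X, X, lie_off_off_fst]
theorem EE_fst (p q : BiOct) (i : Fin 3) : (EE p q).1.1 i = (1 / 2 : ℝ) • nested 1 p q i := by
  rw [EE, smul_fst, Y, Y, lie_off_off_fst]
theorem FF_fst (p q : BiOct) (i : Fin 3) : (FF p q).1.1 i = (1 / 2 : ℝ) • nested 2 p q i := by
  rw [FF, smul_fst, Z, Z, lie_off_off_fst]
@[simp] theorem D_snd (q : BiOct) (i : Fin 3) : (D q).1.2 i = 0 := by
  rw [D, smul_snd, X, X, lie_off_off_snd, smul_zero]
@[simp] theorem E_snd (q : BiOct) (i : Fin 3) : (E q).1.2 i = 0 := by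
  rw [E, smul_snd, Y, Y, lie_off_off_snd, smul_zero]
@[simp] theorem F_snd (q : BiOct) (i : Fin 3) : (F q).1.2 i = 0 := by
  rw [F, smul_snd, Z, Z, lie_off_off_snd, smul_zero]
@[simp] theorem DD_snd (p q : BiOct) (i : Fin 3) : (DD p q).1.2 i = 0 := by
  rw [DD, smul_snd, X, X, lie_off_off_snd, smul_zero]
@[simp] theorem EE_snd (p q : BiOct) (i : Fin 3) : (EE p q).1.2 i = 0 := by
  rw [EE, smul_snd, Y, Y, lie_off_off_snd, smul_zero]
@[simp] theorem FF_snd (p q : BiOct) (i : Fin 3) : (FF p q).1.2 i = 0 := by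
  rw [FF, smul_snd, Z, Z, lie_off_off_snd, smul_zero]
@[simp] theorem GS_snd (Q : Oct 1) (i : Fin 3) : (GS Q).1.2 i = 0 := by
  simp [GS, nestedScalar]

/-- This is `BiOct.own_cyc` for the three cyclic orders of a, b, c, one for each operator of the
diagonal part. It allows brackets of Y's or of Z's to be traded for brackets of X's. -/
theorem DD_add_EE_add_FF (a b c : BiOct) :
    DD a (star (b * c)) + EE b (star (c * a)) + FF c (star (a * b)) = 0 := by
  refine ext (fun i y => ?_) (fun i => by simp)
  have h1 := BiOct.own_cyc a b c y
  have h2 := BiOct.own_cyc b c a y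
  have h3 := BiOct.own_cyc c a b y
  fin_cases i <;> simp [DD_fst, EE_fst, FF_fst, nested, -star_mul]
  · linear_combination (norm := module) (1 / 2 : ℝ) • h1
  · linear_combination (norm := module) (1 / 2 : ℝ) • h2
  · linear_combination (norm := module) (1 / 2 : ℝ) • h3

/-- The matrices diag(q, -q, 0), diag(0, q, -q) and diag(-q, 0, q) cancel, so D and S together
determine E and F. -/
theorem D_add_E_add_F (q : BiOct) : D q + E q + F q = 0 := by
  refine ext (fun i y => ?_) (fun i => by simp)
  fin_cases i <;> simp [D_fst, E_fst, F_fst, nested, own_apply, next_apply, prev_apply] <;> module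

theorem D_tmul (R S : Oct 1) (r s : Oct (-1)) (i : Fin 3) : (D (R ⊗ₜ r)).1.1 i (S ⊗ₜ s) =
    (1 / 2 : ℝ) • (ip 1 R • (S ⊗ₜ tri 0 1 r i s) + ip 1 r • (tri 0 1 R i S ⊗ₜ s)) := by
  rw [D_fst, Algebra.TensorProduct.one_def, LinearMap.smul_apply, BiOct.nested_tmul]
theorem E_tmul (R S : Oct 1) (r s : Oct (-1)) (i : Fin 3) : (E (R ⊗ₜ r)).1.1 i (S ⊗ₜ s) =
    (1 / 2 : ℝ) • (ip 1 R • (S ⊗ₜ tri 1 1 r i s) + ip 1 r • (tri 1 1 R i S ⊗ₜ s)) := by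
  rw [E_fst, Algebra.TensorProduct.one_def, LinearMap.smul_apply, BiOct.nested_tmul]

end e8

/-! ### The label space and the operators of diag(a, b, c)Q. -/

namespace Oct

/-- The span of `I, J, K, KL, JL, IL`. -/
def labelSpan : Submodule ℝ (Oct 1) := LinearMap.ker (ipL 1) ⊓ LinearMap.ker (ipL l)

theorem labelSpan_eq_co {Q : Oct 1} (hQ : Q ∈ labelSpan) :
    ∃ q1 q2 q3 q5 q6 q7, Q = co 0 q1 q2 q3 0 q5 q6 q7 := by
  obtain ⟨a0, a1, a2, a3, a4, a5, a6, a7, rfl⟩ := eq_co Q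
  have h1 : ip 1 (co a0 a1 a2 a3 a4 a5 a6 a7 : Oct 1) = 0 := hQ.1
  have h2 : ip l (co a0 a1 a2 a3 a4 a5 a6 a7 : Oct 1) = 0 := hQ.2
  rw [one_eq_co, co_ip] at h1
  rw [l, co_ip] at h2
  obtain rfl : a0 = 0 := by linarith
  obtain rfl : a4 = 0 := by linarith
  exact ⟨_, _, _, _, _, _, rfl⟩

theorem co_mem_labelSpan (q1 q2 q3 q5 q6 q7 : ℝ) : co 0 q1 q2 q3 0 q5 q6 q7 ∈ labelSpan := by
  refine ⟨?_, ?_⟩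
  · change ip _ _ = 0; rw [one_eq_co, co_ip]; ring
  · change ip _ _ = 0; rw [l, co_ip]; ring

theorem l_mul_co (q1 q2 q3 q5 q6 q7 : ℝ) : (l * co 0 q1 q2 q3 0 q5 q6 q7 : Oct 1) =
    co 0 (-q5) (-q6) (-q7) 0 (-q1) (-q2) (-q3) := by
  rw [l, co_mul]; apply co_congr <;> ring

theorem l_mul_mem {Q : Oct 1} (hQ : Q ∈ labelSpan) : l * Q ∈ labelSpan := by
  obtain ⟨q1, q2, q3, q5, q6, q7, rfl⟩ := labelSpan_eq_co hQ
  rw [l_mul_co]; exact co_mem_labelSpan ..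

theorem l_mul_l_mul {Q : Oct 1} (hQ : Q ∈ labelSpan) : l * (l * Q) = Q := by
  obtain ⟨q1, q2, q3, q5, q6, q7, rfl⟩ := labelSpan_eq_co hQ
  simp only [l_mul_co, neg_neg]

theorem mul_l_eq {Q : Oct 1} (hQ : Q ∈ labelSpan) : Q * l = -(l * Q) := by
  obtain ⟨q1, q2, q3, q5, q6, q7, rfl⟩ := labelSpan_eq_co hQ
  rw [l_mul_co, l, co_mul, co_neg]
  apply co_congr <;> ring

theorem star_eq_neg {Q : Oct 1} (hQ : Q ∈ labelSpan) : star Q = -Q := by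
  obtain ⟨q1, q2, q3, q5, q6, q7, rfl⟩ := labelSpan_eq_co hQ
  rw [co_star, co_neg, neg_zero]

/-- The projection to the span of `I, J, K, KL, JL, IL`. -/
def labelPart (S : Oct 1) : Oct 1 := S - ip 1 S • 1 + ip l S • l

/-- An operator of a diagonal matrix `diag (a, b, c) Q` on the split octonionic factor of the entry
at the position of `a` and `b`. -/
def pairOp (Q : Oct 1) (a b c : ℝ) (S : Oct 1) : Oct 1 :=
  (a - b) • (ip 1 S • Q - ip Q S • 1) + (a + b) • (ip l S • (l * Q) - ip (l * Q) S • l) -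
    c • labelPart (Q * labelPart S)

/-- In this form every identity between values of `pairOp` becomes a polynomial identity in eight
coordinates. -/
theorem pairOp_co (q1 q2 q3 q5 q6 q7 a b c s0 s1 s2 s3 s4 s5 s6 s7 : ℝ) :
    pairOp (co 0 q1 q2 q3 0 q5 q6 q7) a b c (co s0 s1 s2 s3 s4 s5 s6 s7) =
      co (-(a - b) * (q1 * s1 + q2 * s2 + q3 * s3 - q5 * s5 - q6 * s6 - q7 * s7))
        ((a - b) * s0 * q1 + (a + b) * s4 * q5 + c * (s2 * q3 - s3 * q2 + s6 * q7 - s7 * q6))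
        ((a - b) * s0 * q2 + (a + b) * s4 * q6 + c * (s3 * q1 - s1 * q3 + s7 * q5 - s5 * q7))
        ((a - b) * s0 * q3 + (a + b) * s4 * q7 + c * (s1 * q2 - s2 * q1 + s5 * q6 - s6 * q5))
        ((a + b) * (q5 * s1 + q6 * s2 + q7 * s3 - q1 * s5 - q2 * s6 - q3 * s7))
        ((a - b) * s0 * q5 + (a + b) * s4 * q1 + c * (s3 * q6 - s2 * q7 + s7 * q2 - s6 * q3))
        ((a - b) * s0 * q6 + (a + b) * s4 * q2 + c * (s1 * q7 - s3 * q5 + s5 * q3 - s7 * q1))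
        ((a - b) * s0 * q7 + (a + b) * s4 * q3 + c * (s2 * q5 - s1 * q6 + s6 * q1 - s5 * q2)) := by
  simp only [pairOp, labelPart, l_mul_co]
  simp only [one_eq_co, l, co_mul, co_ip, co_add, co_sub, co_smul]
  apply co_congr <;> ring

/-- This lemma and the next two say that [X_1, X_Q] is 2 diag(Q, -Q, 0): the triples (2, -2, 0),
(-2, 0, 2), (0, 2, -2) are that diagonal read cyclically from each of the three positions. -/
theorem own_one {Q : Oct 1} (hQ : Q ∈ labelSpan) (S : Oct 1) :
    own 1 Q S = pairOp Q 2 (-2) 0 S := by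
  obtain ⟨q1, q2, q3, q5, q6, q7, rfl⟩ := labelSpan_eq_co hQ
  obtain ⟨s0, s1, s2, s3, s4, s5, s6, s7, rfl⟩ := eq_co S
  simp only [pairOp_co, own_eq, one_eq_co, l, co_mul, co_star, co_ip, co_add, co_sub, co_smul]
  apply co_congr <;> ring

theorem next_one {Q : Oct 1} (hQ : Q ∈ labelSpan) (S : Oct 1) :
    next 1 Q S = pairOp Q (-2) 0 2 S := by
  obtain ⟨q1, q2, q3, q5, q6, q7, rfl⟩ := labelSpan_eq_co hQ
  obtain ⟨s0, s1, s2, s3, s4, s5, s6, s7, rfl⟩ := eq_co S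
  simp only [pairOp_co, next_apply, one_eq_co, l, co_mul, co_star, co_ip, co_add, co_sub, co_smul]
  apply co_congr <;> ring

theorem prev_one {Q : Oct 1} (hQ : Q ∈ labelSpan) (S : Oct 1) :
    prev 1 Q S = pairOp Q 0 2 (-2) S := by
  obtain ⟨q1, q2, q3, q5, q6, q7, rfl⟩ := labelSpan_eq_co hQ
  obtain ⟨s0, s1, s2, s3, s4, s5, s6, s7, rfl⟩ := eq_co S
  simp only [pairOp_co, prev_apply, one_eq_co, l, co_mul, co_star, co_ip, co_add, co_sub, co_smul]
  apply co_congr <;> ring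

/-- Here and in the next two lemmas [X_L, X_Q] appears as 2 diag(LQ, LQ, 0). Its trace does not
vanish, which is how G_Q enters the brackets of boosts with H_Q. -/
theorem own_l {Q : Oct 1} (hQ : Q ∈ labelSpan) (S : Oct 1) :
    own l Q S = pairOp (l * Q) 2 2 0 S := by
  obtain ⟨q1, q2, q3, q5, q6, q7, rfl⟩ := labelSpan_eq_co hQ
  obtain ⟨s0, s1, s2, s3, s4, s5, s6, s7, rfl⟩ := eq_co S
  rw [l_mul_co, pairOp_co]
  simp only [own_eq, one_eq_co, l, co_mul, co_star, co_ip, co_add, co_sub, co_smul]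
  apply co_congr <;> ring

theorem next_l {Q : Oct 1} (hQ : Q ∈ labelSpan) (S : Oct 1) :
    next l Q S = pairOp (l * Q) 2 0 2 S := by
  obtain ⟨q1, q2, q3, q5, q6, q7, rfl⟩ := labelSpan_eq_co hQ
  obtain ⟨s0, s1, s2, s3, s4, s5, s6, s7, rfl⟩ := eq_co S
  rw [l_mul_co, pairOp_co]
  simp only [next_apply, one_eq_co, l, co_mul, co_star, co_ip, co_add, co_sub, co_smul]
  apply co_congr <;> ring

theorem prev_l {Q : Oct 1} (hQ : Q ∈ labelSpan) (S : Oct 1) :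
    prev l Q S = pairOp (l * Q) 0 2 2 S := by
  obtain ⟨q1, q2, q3, q5, q6, q7, rfl⟩ := labelSpan_eq_co hQ
  obtain ⟨s0, s1, s2, s3, s4, s5, s6, s7, rfl⟩ := eq_co S
  rw [l_mul_co, pairOp_co]
  simp only [prev_apply, one_eq_co, l, co_mul, co_star, co_ip, co_add, co_sub, co_smul]
  apply co_congr <;> ring

/-- The map S ↦ a' LS - b' SL is the action of the boost diag(a', b', -a' - b')L on the entry
between a' and b'. The new diagonal is that of ℬ𝓟 + 𝓟ℬ† for diagonal ℬ and 𝓟. -/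
theorem pairOp_commutator {Q : Oct 1} (hQ : Q ∈ labelSpan) (a b c a' b' : ℝ) (S : Oct 1) :
    (a' • (l * pairOp Q a b c S) - b' • (pairOp Q a b c S * l)) -
      pairOp Q a b c (a' • (l * S) - b' • (S * l)) =
    pairOp (l * Q) (2 * (a' * a)) (2 * (b' * b)) (2 * ((-a' - b') * c)) S := by
  obtain ⟨q1, q2, q3, q5, q6, q7, rfl⟩ := labelSpan_eq_co hQ
  obtain ⟨s0, s1, s2, s3, s4, s5, s6, s7, rfl⟩ := eq_co S
  rw [l_mul_co]
  simp only [pairOp_co, l, co_mul, co_smul, co_sub]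
  apply co_congr <;> ring

/-- Evaluation at 1 isolates a - b, and evaluation at L below isolates a + b. The two values give
the action on the off-diagonal entries of rotations and boosts, and they recover a and b from the
operator. -/
theorem pairOp_one {Q : Oct 1} (hQ : Q ∈ labelSpan) (a b c : ℝ) :
    pairOp Q a b c 1 = (a - b) • Q := by
  obtain ⟨q1, q2, q3, q5, q6, q7, rfl⟩ := labelSpan_eq_co hQ
  rw [one_eq_co, pairOp_co, co_smul]
  apply co_congr <;> ring

theorem pairOp_l {Q : Oct 1} (hQ : Q ∈ labelSpan) (a b c : ℝ) :
    pairOp Q a b c l = -((a + b) • (l * Q)) := by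
  obtain ⟨q1, q2, q3, q5, q6, q7, rfl⟩ := labelSpan_eq_co hQ
  rw [l_mul_co, l, pairOp_co, co_smul, co_neg]
  apply co_congr <;> ring

end Oct

theorem Fin.sum_univ_three_cyclic {M : Type*} [AddCommMonoid M] (f : Fin 3 → M) (i : Fin 3) :
    ∑ j, f j = f i + f (i + 1) + f (i + 2) := by
  fin_cases i <;> simp [Fin.sum_univ_three]
  · abel
  · abel

namespace Oct

theorem sum_tri {γ : ℝ} (a b : Oct γ) (i : Fin 3) :
    ∑ t, tri t a b i = own a b + next a b + prev a b := by
  rw [Fin.sum_univ_three]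
  fin_cases i <;> simp [tri] <;> abel

theorem eq_smul_one {x : Oct (-1)} (h : star x = x) : x = x.1.re • 1 := by
  obtain ⟨a0, a1, a2, a3, a4, a5, a6, a7, rfl⟩ := eq_co x
  rw [co_star] at h
  have h1 := congrArg (fun x : Oct (-1) => x.1.imI) h
  have h2 := congrArg (fun x : Oct (-1) => x.1.imJ) h
  have h3 := congrArg (fun x : Oct (-1) => x.1.imK) h
  have h4 := congrArg (fun x : Oct (-1) => x.2.re) h
  have h5 := congrArg (fun x : Oct (-1) => x.2.imI) h
  have h6 := congrArg (fun x : Oct (-1) => x.2.imJ) h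
  have h7 := congrArg (fun x : Oct (-1) => x.2.imK) h
  simp only [co_fst, co_snd, mkq_re, mkq_imI, mkq_imJ, mkq_imK] at h1 h2 h3 h4 h5 h6 h7
  rw [one_eq_co, co_smul]
  apply co_congr <;> simp <;> linarith

theorem ip_eq_re (x y : Oct (-1)) : ip x y = (x * star y).1.re := rfl
theorem ip_eq_re' (x y : Oct (-1)) : ip x y = (star x * y).1.re := by
  rw [← ip_star, ip_eq_re, star_star]

theorem ip_one_one : ip (1 : Oct (-1)) 1 = 1 := by rw [one_eq_co, co_ip]; ring
theorem ip_one_one' : ip (1 : Oct 1) 1 = 1 := by rw [one_eq_co, co_ip]; ring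
theorem ip_one_l : ip (1 : Oct 1) l = 0 := by rw [one_eq_co, l, co_ip]; ring
theorem ip_l_l : ip (l : Oct 1) l = -1 := by rw [l, co_ip]; ring
theorem l_mul_l : (l * l : Oct 1) = 1 := by rw [one_eq_co, l, co_mul]; apply co_congr <;> ring
theorem star_l : star (l : Oct 1) = -l := by rw [l, co_star, co_neg]; apply co_congr <;> ring

end Oct

/-! ### Entries of elements of the Albert algebra, and the operators of Q𝓟. -/

namespace Albert
open Oct

theorem star_apply (P : Albert) (i j : Fin 3) : star (P.1 i j) = P.1 j i :=
  congrFun (congrFun P.2 j) i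

/-- The diagonal entries. -/
def diagEntry (P : Albert) (i : Fin 3) : ℝ := (P.1 i i).1.re

theorem apply_self (P : Albert) (i : Fin 3) : P.1 i i = diagEntry P i • 1 :=
  eq_smul_one (star_apply P i i)

theorem tr_eq (P : Albert) (i : Fin 3) :
    tr P = diagEntry P i + diagEntry P (i + 1) + diagEntry P (i + 2) := by
  rw [tr, Matrix.trace, Fin.sum_univ_three_cyclic _ i]; rfl

theorem ext_entries {P R : Albert} (h1 : ∀ i, diagEntry P i = diagEntry R i)
    (h2 : ∀ i, P.1 i (i + 1) = R.1 i (i + 1)) : P = R := by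
  refine Subtype.ext (Matrix.ext fun i j => ?_)
  have : j = i ∨ j = i + 1 ∨ i = j + 1 := by revert i j; decide
  rcases this with rfl | rfl | rfl
  · rw [apply_self, apply_self, h1]
  · exact h2 i
  · rw [← star_apply, ← star_apply R, h2]

theorem act_apply (M : Matrix (Fin 3) (Fin 3) (Oct (-1))) (P : Albert) (i j : Fin 3) :
    (act M P).1 i j = ∑ k, (M i k * P.1 k j + P.1 i k * star (M j k)) := by
  change (M * P.1 + P.1 * Mᴴ) i j = _
  rw [Matrix.add_apply, Matrix.mul_apply, Matrix.mul_apply, ← Finset.sum_add_distrib]; rfl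

end Albert

namespace e8
open GMat Oct Albert

/-- As Q is orthogonal to 1, only the split octonionic factor is acted upon. The triple is the
diagonal of diag(1, -1, 0) read cyclically from position i. -/
theorem pairOp_D (Q : Oct 1) (hQ : Q ∈ labelSpan) (S : Oct 1) (s : Oct (-1)) (r : ℝ) (i : Fin 3) :
    (D (Q ⊗ₜ (r • 1))).1.1 i (S ⊗ₜ s) =
      r • (pairOp Q (![1, -1, 0] i) (![1, -1, 0] (i + 1)) (![1, -1, 0] (i + 2)) S ⊗ₜ[ℝ] s) := by
  have h0 : ip 1 Q = 0 := hQ.1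
  rw [D_tmul, h0, zero_smul, zero_add, ip_smul_right, ip_one_one, mul_one, smul_comm]
  congr 1
  rw [TensorProduct.smul_tmul']
  congr 1
  fin_cases i
  · simp [tri, own_one hQ, pairOp]; module
  · simp [tri, next_one hQ, pairOp]; module
  · simp [tri, prev_one hQ, pairOp]

theorem pairOp_E (Q : Oct 1) (hQ : Q ∈ labelSpan) (S : Oct 1) (s : Oct (-1)) (r : ℝ) (i : Fin 3) :
    (E (Q ⊗ₜ (r • 1))).1.1 i (S ⊗ₜ s) =
      r • (pairOp Q (![0, 1, -1] i) (![0, 1, -1] (i + 1)) (![0, 1, -1] (i + 2)) S ⊗ₜ[ℝ] s) := by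
  have h0 : ip 1 Q = 0 := hQ.1
  rw [E_tmul, h0, zero_smul, zero_add, ip_smul_right, ip_one_one, mul_one, smul_comm]
  congr 1
  rw [TensorProduct.smul_tmul']
  congr 1
  fin_cases i
  · simp [tri, prev_one hQ, pairOp]
  · simp [tri, own_one hQ, pairOp]; module
  · simp [tri, next_one hQ, pairOp]; module

/-- The three brackets in G_Q contribute (2, 2, 0), (2, 0, 2) and (0, 2, 2), with sum (4, 4, 4), and
the normalisation multiplies by -½. So -½ G_Q behaves as diag(1, 1, 1)Q. -/
theorem GS_fst {Q : Oct 1} (hQ : Q ∈ labelSpan) (S : Oct 1) (s : Oct (-1)) (i : Fin 3) :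
    (GS Q).1.1 i (S ⊗ₜ s) = (-2 : ℝ) • (pairOp Q 1 1 1 S ⊗ₜ[ℝ] s) := by
  have key : (GS Q).1.1 i = (-1 / 2 : ℝ) • ∑ t, nested t ((Q * l) ⊗ₜ 1) (l ⊗ₜ 1) i := by
    simp only [GS, nestedScalar, smul_fst, add_fst, DD_fst, EE_fst, FF_fst, Fin.sum_univ_three]
    module
  have hn (t : Fin 3) : nested t ((Q * l) ⊗ₜ 1) (l ⊗ₜ 1) i (S ⊗ₜ s) =
      tri t (Q * l) l i S ⊗ₜ[ℝ] s := by
    rw [BiOct.nested_tmul, tri_self, ip_one_one]; simp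
  have hs : own (Q * l) l S + next (Q * l) l S + prev (Q * l) l S = pairOp Q 4 4 4 S := by
    -- Since QL = -LQ, the pair (QL, L) may be replaced by (L, LQ). The lemmas for L are applied to
    -- the label LQ, and L(LQ) = Q restores Q.
    have h1 := own_l (l_mul_mem hQ) S
    have h2 := next_l (l_mul_mem hQ) S
    have h3 := prev_l (l_mul_mem hQ) S
    rw [l_mul_l_mul hQ] at h1 h2 h3
    rw [mul_l_eq hQ, own_swap, next_swap, prev_swap]
    simp only [← neg_one_smul ℝ (l * Q), own_smul_right, next_smul_right, prev_smul_right,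
      LinearMap.neg_apply, LinearMap.smul_apply, h1, h2, h3]
    unfold pairOp; module
  rw [key, LinearMap.smul_apply, LinearMap.sum_apply]
  simp only [hn]
  rw [← TensorProduct.sum_tmul, ← LinearMap.sum_apply, sum_tri, LinearMap.add_apply,
    LinearMap.add_apply, hs, TensorProduct.smul_tmul', TensorProduct.smul_tmul']
  congr 1
  unfold pairOp; module

theorem ofMatrix_snd (M : Matrix (Fin 3) (Fin 3) BiOct) (i : Fin 3) :
    (ofMatrix M).1.2 i = M i (i + 1) := by
  fin_cases i <;> simp [ofMatrix, X, Y, Z, off_snd]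

theorem ofMatrix_fst (M : Matrix (Fin 3) (Fin 3) BiOct) (i : Fin 3) :
    (ofMatrix M).1.1 i = (D (M 0 0)).1.1 i - (E (M 2 2)).1.1 i := by
  simp [ofMatrix, X, Y, Z]

theorem labelled_snd (Q : Oct 1) (P : Albert) (i : Fin 3) :
    (labelled Q P).1.2 i = Q ⊗ₜ P.1 i (i + 1) := by
  have : (1 : Matrix (Fin 3) (Fin 3) (Oct (-1))) i (i + 1) = 0 := by fin_cases i <;> simp
  simp [labelled, ofMatrix_snd, mulLabel, this]

/-- The trace-free part enters through D and E, the trace through G_Q; as `pairOp` is linear in the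
diagonal, the two recombine and the trace disappears from the formula. -/
theorem labelled_fst {Q : Oct 1} (hQ : Q ∈ labelSpan) (P : Albert) (S : Oct 1) (s : Oct (-1))
    (i : Fin 3) : (labelled Q P).1.1 i (S ⊗ₜ s) =
      pairOp Q (diagEntry P i) (diagEntry P (i + 1)) (diagEntry P (i + 2)) S ⊗ₜ[ℝ] s := by
  have h0 (j : Fin 3) : mulLabel Q (P.1 - (tr P / 3) • 1) j j =
      Q ⊗ₜ ((diagEntry P j - tr P / 3) • 1) := by
    simp only [mulLabel, Matrix.map_apply, Matrix.sub_apply, Matrix.smul_apply, Matrix.one_apply_eq,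
      apply_self, sub_smul]
  simp only [labelled, add_fst, smul_fst, LinearMap.add_apply, LinearMap.smul_apply, ofMatrix_fst,
    LinearMap.sub_apply, h0, pairOp_D Q hQ, pairOp_E Q hQ, GS_fst hQ]
  simp only [TensorProduct.smul_tmul', ← TensorProduct.sub_tmul, ← TensorProduct.add_tmul]
  congr 1
  rw [tr_eq P 0]
  fin_cases i <;> simp [pairOp] <;> module

end e8

/-! ### Brackets of rotations and boosts with Q𝓟. -/

namespace e8
open GMat Oct Albert

theorem rotation_snd (M : Matrix (Fin 3) (Fin 3) (Oct (-1))) (i : Fin 3) :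
    (rotation M).1.2 i = 1 ⊗ₜ M i (i + 1) := ofMatrix_snd _ i

theorem boost_snd (M : Matrix (Fin 3) (Fin 3) (Oct (-1))) (i : Fin 3) :
    (boost M).1.2 i = l ⊗ₜ M i (i + 1) := ofMatrix_snd _ i

/-- The split octonionic pair is (1, 1), whose triality operators vanish, so only the octonionic
factor moves. The trace condition supplies the middle entry, which `ofMatrix` does not use. -/
theorem rotation_fst {M : Matrix (Fin 3) (Fin 3) (Oct (-1))} (hM : Mᴴ = -M) (h0 : M.trace = 0)
    (S : Oct 1) (s : Oct (-1)) (i : Fin 3) : (rotation M).1.1 i (S ⊗ₜ s) =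
      S ⊗ₜ (M i i * s - s * M (i + 1) (i + 1)) := by
  have hs (j : Fin 3) : star (M j j) = -M j j := congrFun (congrFun hM j) j
  have h1 : M 1 1 = -M 0 0 - M 2 2 := by
    rw [Matrix.trace, Fin.sum_univ_three] at h0
    simp only [Matrix.diag_apply] at h0
    linear_combination (norm := abel) h0
  have t0 (R : Oct 1) (j i : Fin 3) : tri j 1 1 i R = 0 := by rw [tri_self]; rfl
  rw [rotation, ofMatrix_fst, LinearMap.sub_apply, mulLabel, Matrix.map_apply, Matrix.map_apply,
    D_tmul, E_tmul, t0, t0, ip_one_one']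
  fin_cases i
  · simp [tri, own_apply, prev_apply, hs, h1, ← TensorProduct.tmul_smul, ← TensorProduct.tmul_sub]
    congr 1
    simp only [mul_sub, sub_mul, mul_neg, neg_mul]; module
  · simp [tri, own_apply, next_apply, hs, h1, ← TensorProduct.tmul_smul, ← TensorProduct.tmul_sub]
    congr 1
    simp only [mul_sub, sub_mul, mul_neg, neg_mul]; module
  · simp [tri, next_apply, prev_apply, hs, ← TensorProduct.tmul_smul, ← TensorProduct.tmul_sub]
    congr 1
    module

/-- Opposite to `rotation_fst`: 1 and L are orthogonal and the diagonal entries of M are real, so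
only the split octonionic factor moves. -/
theorem boost_fst {M : Matrix (Fin 3) (Fin 3) (Oct (-1))} (hM : Mᴴ = M) (h0 : M.trace = 0)
    (S : Oct 1) (s : Oct (-1)) (i : Fin 3) : (boost M).1.1 i (S ⊗ₜ s) =
      ((M i i).1.re • (l * S) - (M (i + 1) (i + 1)).1.re • (S * l)) ⊗ₜ s := by
  have hs (j : Fin 3) : M j j = (M j j).1.re • 1 := eq_smul_one (congrFun (congrFun hM j) j)
  have h1 : (M 1 1).1.re = -(M 0 0).1.re - (M 2 2).1.re := by
    have := congrArg (fun x : Oct (-1) => x.1.re) h0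
    rw [Matrix.trace, Fin.sum_univ_three] at this
    simp only [Matrix.diag_apply, Oct.add_fst, Quaternion.re_add, Oct.zero_fst,
      Quaternion.re_zero] at this
    linarith
  rw [boost, ofMatrix_fst, LinearMap.sub_apply, mulLabel, Matrix.map_apply, Matrix.map_apply,
    D_tmul, E_tmul, ip_one_l, hs 0, hs 2, ip_smul_right, ip_smul_right, ip_one_one]
  simp only [zero_smul, zero_add, mul_one, TensorProduct.smul_tmul', ← TensorProduct.sub_tmul]
  congr 1
  fin_cases i
  · simp [tri, own_apply, prev_apply, star_l, h1]; module
  · simp [tri, own_apply, next_apply, star_l, h1]; module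
  · simp [tri, next_apply, prev_apply, star_l]; module

/-- Used with R = 1 and R = L. Orthogonality removes the octonionic operator, and the octonionic
parameters enter only through their inner product, which also occurs in the diagonal entries of M𝓟 +
𝓟M†. -/
theorem own_label {R Q : Oct 1} (h : ip R Q = 0) (m p s : Oct (-1)) (S : Oct 1) :
    own (R ⊗ₜ[ℝ] m) (Q ⊗ₜ p) (S ⊗ₜ s) = (ip m p • own R Q S) ⊗ₜ s := by
  rw [BiOct.own_tmul, h, zero_smul, zero_add, TensorProduct.smul_tmul']
theorem next_label {R Q : Oct 1} (h : ip R Q = 0) (m p s : Oct (-1)) (S : Oct 1) :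
    next (R ⊗ₜ[ℝ] m) (Q ⊗ₜ p) (S ⊗ₜ s) = (ip m p • next R Q S) ⊗ₜ s := by
  rw [BiOct.next_tmul, h, zero_smul, zero_add, TensorProduct.smul_tmul']
theorem prev_label {R Q : Oct 1} (h : ip R Q = 0) (m p s : Oct (-1)) (S : Oct 1) :
    prev (R ⊗ₜ[ℝ] m) (Q ⊗ₜ p) (S ⊗ₜ s) = (ip m p • prev R Q S) ⊗ₜ s := by
  rw [BiOct.prev_tmul, h, zero_smul, zero_add, TensorProduct.smul_tmul']

/-- The diagonal entry of M is imaginary and cancels against its conjugate, since the diagonal entry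
of P is real. -/
theorem diagEntry_act_rotation {M : Matrix (Fin 3) (Fin 3) (Oct (-1))} (hM : Mᴴ = -M)
    (P : Albert) (i : Fin 3) : diagEntry (act M P) i =
      2 * ip (M i (i + 1)) (P.1 i (i + 1)) - 2 * ip (M (i + 2) i) (P.1 (i + 2) i) := by
  have hs (j k : Fin 3) : star (M j k) = -M k j := congrFun (congrFun hM k) j
  have h1 : M i (i + 2) = -star (M (i + 2) i) := by rw [hs, neg_neg]
  rw [diagEntry, act_apply, Fin.sum_univ_three_cyclic _ i, hs i i, h1, star_neg, star_star,
    apply_self, ← star_apply P i (i + 1), ← star_apply P (i + 2) i]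
  have h2 : (P.1 i (i + 1) * star (M i (i + 1))).1.re = ip (M i (i + 1)) (P.1 i (i + 1)) := by
    rw [ip_comm]; rfl
  have h3 : (star (P.1 (i + 2) i) * M (i + 2) i).1.re = ip (M (i + 2) i) (P.1 (i + 2) i) := by
    rw [ip_comm, ip_eq_re']
  have h4 := ip_eq_re (M i (i + 1)) (P.1 i (i + 1))
  have h5 := ip_eq_re' (M (i + 2) i) (P.1 (i + 2) i)
  simp only [Oct.add_fst, Quaternion.re_add, smul_mul_assoc, mul_smul_comm, mul_one, one_mul,
    neg_mul, mul_neg, Oct.neg_fst, Quaternion.re_neg, smul_neg, h2, h3, ← h4, ← h5]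
  ring

theorem diagEntry_act_boost {M : Matrix (Fin 3) (Fin 3) (Oct (-1))} (hM : Mᴴ = M)
    (P : Albert) (i : Fin 3) : diagEntry (act M P) i = 2 * ((M i i).1.re * diagEntry P i) +
      2 * ip (M i (i + 1)) (P.1 i (i + 1)) + 2 * ip (M (i + 2) i) (P.1 (i + 2) i) := by
  have hs (j k : Fin 3) : star (M j k) = M k j := congrFun (congrFun hM k) j
  have h1 : M i (i + 2) = star (M (i + 2) i) := (hs _ _).symm
  rw [diagEntry, act_apply, Fin.sum_univ_three_cyclic _ i, hs i i, h1, star_star,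
    apply_self, ← star_apply P i (i + 1), ← star_apply P (i + 2) i]
  have h2 : (P.1 i (i + 1) * star (M i (i + 1))).1.re = ip (M i (i + 1)) (P.1 i (i + 1)) := by
    rw [ip_comm]; rfl
  have h3 : (star (P.1 (i + 2) i) * M (i + 2) i).1.re = ip (M (i + 2) i) (P.1 (i + 2) i) := by
    rw [ip_comm, ip_eq_re']
  have h4 := ip_eq_re (M i (i + 1)) (P.1 i (i + 1))
  have h5 := ip_eq_re' (M (i + 2) i) (P.1 (i + 2) i)
  simp only [Oct.add_fst, Quaternion.re_add, smul_mul_assoc, mul_smul_comm, mul_one, one_mul,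
    Oct.smul_fst, Quaternion.re_smul, smul_eq_mul, h2, h3, ← h4, ← h5]
  ring

/-- The diagonal parts act on different tensor factors and commute. The diagonal of the bracket
therefore comes only from pairs of off-diagonal entries of equal type, as it does in
`diagEntry_act_rotation`. -/
theorem lie_rotation_labelled {Q : Oct 1} (hQ : Q ∈ labelSpan)
    {M : Matrix (Fin 3) (Fin 3) (Oct (-1))} (hM : Mᴴ = -M) (h0 : M.trace = 0) (P : Albert) :
    ⁅rotation M, labelled Q P⁆ = labelled Q (act M P) := by
  have hs (j k : Fin 3) : star (M j k) = -M k j := congrFun (congrFun hM k) j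
  refine ext_tmul (fun i S s => ?_) (fun i => ?_)
  · simp only [lie_fst, rotation_snd, labelled_snd, rotation_fst hM h0, labelled_fst hQ, add1, add2,
      add3, add4, sub_self, zero_add, own_label hQ.1, next_label hQ.1, prev_label hQ.1, own_one hQ,
      next_one hQ, prev_one hQ, diagEntry_act_rotation hM]
    simp only [← TensorProduct.add_tmul]
    congr 1
    unfold pairOp; module
  · simp only [lie_snd, rotation_snd, labelled_snd, rotation_fst hM h0, labelled_fst hQ, add1, add2,
      add3, add4, BiOct.mul_tmul, pairOp_one hQ, one_mul, mul_one, TensorProduct.star_tmul,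
      star_eq_neg hQ, act_apply, Fin.sum_univ_three_cyclic _ i, apply_self]
    simp only [← TensorProduct.smul_tmul', ← TensorProduct.tmul_smul, TensorProduct.neg_tmul,
      ← TensorProduct.tmul_neg, ← TensorProduct.tmul_sub, ← TensorProduct.tmul_add]
    congr 1
    simp only [star_mul, hs, star_apply, smul_mul_assoc, mul_smul_comm, mul_one, one_mul, mul_neg,
      neg_mul]
    module

/-- Both diagonal parts now act on the split octonionic factor, and `pairOp_commutator` supplies the
products of diagonal entries that are absent for rotations. -/
theorem lie_boost_labelled {Q : Oct 1} (hQ : Q ∈ labelSpan)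
    {M : Matrix (Fin 3) (Fin 3) (Oct (-1))} (hM : Mᴴ = M) (h0 : M.trace = 0) (P : Albert) :
    ⁅boost M, labelled Q P⁆ = labelled (l * Q) (act M P) := by
  have hs (j k : Fin 3) : star (M j k) = M k j := congrFun (congrFun hM k) j
  have hd (j : Fin 3) : M j j = (M j j).1.re • 1 := eq_smul_one (hs j j)
  have hQ' := l_mul_mem hQ
  refine ext_tmul (fun i S s => ?_) (fun i => ?_)
  -- Trace zero identifies the third coefficient produced by `pairOp_commutator` with the remaining
  -- diagonal entry of M.
  · have ht : -(M i i).1.re - (M (i + 1) (i + 1)).1.re = (M (i + 2) (i + 2)).1.re := by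
      have := congrArg (fun x : Oct (-1) => x.1.re) h0
      rw [Matrix.trace, Fin.sum_univ_three_cyclic _ i] at this
      simp only [Matrix.diag_apply, Oct.add_fst, Quaternion.re_add, Oct.zero_fst,
        Quaternion.re_zero] at this
      linarith
    have hc := pairOp_commutator hQ (diagEntry P i) (diagEntry P (i + 1)) (diagEntry P (i + 2))
      (M i i).1.re (M (i + 1) (i + 1)).1.re S
    rw [ht] at hc
    simp only [lie_fst, boost_snd, labelled_snd, boost_fst hM h0, labelled_fst hQ,
      labelled_fst hQ', add1, add2, add3, add4, own_label hQ.2, next_label hQ.2, prev_label hQ.2,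
      own_l hQ, next_l hQ, prev_l hQ, diagEntry_act_boost hM]
    simp only [← TensorProduct.add_tmul, ← TensorProduct.sub_tmul]
    congr 1
    rw [hc]
    unfold pairOp; module
  · have hl : star (l * Q) = -(l * Q) := star_eq_neg hQ'
    simp only [lie_snd, boost_snd, labelled_snd, boost_fst hM h0, labelled_fst hQ, add1, add2,
      add3, add4, BiOct.mul_tmul, pairOp_l hQ, TensorProduct.star_tmul, star_neg, hl, neg_neg,
      mul_l_eq hQ,
      act_apply, Fin.sum_univ_three_cyclic _ i, apply_self]
    have hr (r : ℝ) : (r • (1 : Oct (-1))).1.re = r := by simp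
    rw [hd i, hd (i + 1)]
    simp only [← TensorProduct.smul_tmul', ← TensorProduct.tmul_smul, TensorProduct.neg_tmul,
      smul_neg, neg_neg, sub_neg_eq_add, ← TensorProduct.tmul_neg, ← TensorProduct.tmul_sub,
      ← TensorProduct.tmul_add, ← TensorProduct.add_tmul, ← add_smul]
    congr 1
    simp only [star_mul, hs, star_apply, smul_mul_assoc, mul_smul_comm, mul_one, one_mul, mul_neg,
      neg_mul, hr, star_smul, star_trivial, star_one]
    module

end e8

/-! ### The subalgebra ℂ' ⊗ 𝕆 and the Lie algebra 𝔰𝔲(3, ℂ' ⊗ 𝕆). -/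

namespace BiOct
open Oct

/-- The subalgebra `ℂ' ⊗ 𝕆`, where `ℂ'` is spanned by `1` and `L`. -/
def splitComplex : Submodule ℝ BiOct :=
  LinearMap.range (TensorProduct.mk ℝ (Oct 1) (Oct (-1)) 1) ⊔
    LinearMap.range (TensorProduct.mk ℝ (Oct 1) (Oct (-1)) l)

theorem mem_splitComplex {x : BiOct} :
    x ∈ splitComplex ↔ ∃ p q : Oct (-1), x = 1 ⊗ₜ p + l ⊗ₜ q := by
  rw [splitComplex, Submodule.mem_sup]
  constructor
  · rintro ⟨_, ⟨p, rfl⟩, _, ⟨q, rfl⟩, rfl⟩; exact ⟨p, q, rfl⟩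
  · rintro ⟨p, q, rfl⟩; exact ⟨_, ⟨p, rfl⟩, _, ⟨q, rfl⟩, rfl⟩

theorem one_tmul_mem (p : Oct (-1)) : 1 ⊗ₜ p ∈ splitComplex :=
  Submodule.mem_sup_left ⟨p, rfl⟩
theorem l_tmul_mem (p : Oct (-1)) : l ⊗ₜ p ∈ splitComplex :=
  Submodule.mem_sup_right ⟨p, rfl⟩

theorem mul_mem {x y : BiOct} (hx : x ∈ splitComplex) (hy : y ∈ splitComplex) :
    x * y ∈ splitComplex := by
  obtain ⟨p, q, rfl⟩ := mem_splitComplex.1 hx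
  obtain ⟨r, s, rfl⟩ := mem_splitComplex.1 hy
  simp only [add_mul, mul_add, mul_tmul, one_mul, mul_one, l_mul_l]
  exact add_mem (add_mem (one_tmul_mem _) (l_tmul_mem _)) (add_mem (l_tmul_mem _) (one_tmul_mem _))

theorem star_mem {x : BiOct} (hx : x ∈ splitComplex) : star x ∈ splitComplex := by
  obtain ⟨p, q, rfl⟩ := mem_splitComplex.1 hx
  rw [star_add, TensorProduct.star_tmul, TensorProduct.star_tmul, star_one, star_l,
    TensorProduct.neg_tmul]
  exact add_mem (one_tmul_mem _) (neg_mem (l_tmul_mem _))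

theorem nested_mem {a b c : BiOct} (ha : a ∈ splitComplex) (hb : b ∈ splitComplex)
    (hc : c ∈ splitComplex) (t i : Fin 3) : GMat.nested t a b i c ∈ splitComplex := by
  have hm {x y : BiOct} := @mul_mem x y
  have hs {x : BiOct} := @star_mem x
  unfold GMat.nested
  split_ifs
  · rw [own_apply]
    exact sub_mem (add_mem (sub_mem (hm hb (hm (hs ha) hc)) (hm ha (hm (hs hb) hc)))
      (hm hc (hm (hs ha) hb))) (hm hc (hm (hs hb) ha))
  · rw [next_apply]
    exact sub_mem (hm (hs hb) (hm ha hc)) (hm (hs ha) (hm hb hc))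
  · rw [prev_apply]
    exact sub_mem (hm (hm hc ha) (hs hb)) (hm (hm hc hb) (hs ha))

end BiOct

namespace e8
open GMat Oct

/-- The commutators of off-diagonal matrices of equal type over `ℂ' ⊗ 𝕆`. -/
def diagonalGenerators : Set e8 :=
  {x | ∃ t, ∃ a ∈ BiOct.splitComplex, ∃ b ∈ BiOct.splitComplex, x = ⁅off t a, off t b⁆}

/-- The off-diagonal matrices over `ℂ' ⊗ 𝕆`. -/
def offGenerators : Set e8 := {x | ∃ t, ∃ a ∈ BiOct.splitComplex, x = off t a}

theorem lie_diagonal_off_mem {x y : e8} (hx : x ∈ diagonalGenerators) (hy : y ∈ offGenerators) :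
    ⁅x, y⁆ ∈ offGenerators := by
  obtain ⟨t, a, ha, b, hb, rfl⟩ := hx
  obtain ⟨u, c, hc, rfl⟩ := hy
  rw [lie_diag_off (lie_off_off_snd t · a b), lie_off_off_fst]
  exact ⟨u, _, BiOct.nested_mem ha hb hc t u, rfl⟩

theorem lie_off_off_mem {x y : e8} (hx : x ∈ offGenerators) (hy : y ∈ offGenerators) :
    ⁅x, y⁆ ∈ Submodule.span ℝ (offGenerators ∪ diagonalGenerators) := by
  obtain ⟨t, a, ha, rfl⟩ := hx
  obtain ⟨u, b, hb, rfl⟩ := hy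
  have hm {c d : BiOct} (hc : c ∈ BiOct.splitComplex) (hd : d ∈ BiOct.splitComplex) :
      -star (c * d) ∈ BiOct.splitComplex := neg_mem (BiOct.star_mem (BiOct.mul_mem hc hd))
  have : u = t ∨ u = t + 1 ∨ t = u + 1 := by revert t u; decide
  rcases this with rfl | rfl | rfl
  · exact Submodule.subset_span (Or.inr ⟨_, a, ha, b, hb, rfl⟩)
  · rw [lie_off_succ]
    exact Submodule.subset_span (Or.inl ⟨_, _, hm ha hb, rfl⟩)
  · rw [← lie_skew, lie_off_succ]
    exact neg_mem (Submodule.subset_span (Or.inl ⟨_, _, hm hb ha, rfl⟩))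

/-- The Lie algebra `𝔰𝔲(3, ℂ' ⊗ 𝕆)`. -/
def su3 : LieSubalgebra ℝ e8 where
  toSubmodule := Submodule.span ℝ (offGenerators ∪ diagonalGenerators)
  lie_mem' {x y} hx hy := by
    change x ∈ Submodule.span ℝ _ at hx
    change y ∈ Submodule.span ℝ _ at hy
    change ⁅x, y⁆ ∈ Submodule.span ℝ _
    have hdo {x y : e8} (hx : x ∈ diagonalGenerators) (hy : y ∈ offGenerators) :
        ⁅x, y⁆ ∈ Submodule.span ℝ (offGenerators ∪ diagonalGenerators) :=
      Submodule.subset_span (Or.inl (lie_diagonal_off_mem hx hy))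
    induction hx, hy using Submodule.span_induction₂ with
    | mem_mem x y hx hy =>
      rcases hx with hx | hx <;> rcases hy with hy | hy
      · exact lie_off_off_mem hx hy
      · rw [← lie_skew]; exact neg_mem (hdo hy hx)
      · exact hdo hx hy
      · obtain ⟨u, c, hc, d, hd, rfl⟩ := hy
        -- For two diagonal generators, the Leibniz rule lets the first act on the two off-diagonal
        -- factors of the second, which leaves brackets of off-diagonal matrices.
        rw [leibniz_lie]
        exact add_mem (lie_off_off_mem (lie_diagonal_off_mem hx ⟨u, c, hc, rfl⟩) ⟨u, d, hd, rfl⟩)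
          (lie_off_off_mem ⟨u, c, hc, rfl⟩ (lie_diagonal_off_mem hx ⟨u, d, hd, rfl⟩))
    | zero_left y _ => rw [zero_lie]; exact zero_mem _
    | zero_right x _ => rw [lie_zero]; exact zero_mem _
    | add_left x y z _ _ _ h h' => rw [add_lie]; exact add_mem h h'
    | add_right x y z _ _ _ h h' => rw [lie_add]; exact add_mem h h'
    | smul_left r x y _ _ h => rw [smul_lie]; exact Submodule.smul_mem _ r h
    | smul_right r x y _ _ h => rw [lie_smul]; exact Submodule.smul_mem _ r h

theorem off_mem_su3 (t : Fin 3) {a : BiOct} (ha : a ∈ BiOct.splitComplex) : off t a ∈ su3 :=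
  Submodule.subset_span (Or.inl ⟨t, a, ha, rfl⟩)

/-- The sign is the norm of L, which is -1; the split octonionic operators vanish because the pairs
(L, L) and (1, 1) consist of equal elements. -/
theorem lie_off_l_off_l (t : Fin 3) (p q : Oct (-1)) :
    (⁅off t (l ⊗ₜ p), off t (l ⊗ₜ q)⁆ : e8) = -⁅off t (1 ⊗ₜ p), off t (1 ⊗ₜ q)⁆ := by
  refine ext_tmul (fun i S s => ?_) (fun i => ?_)
  · rw [neg_fst, LinearMap.neg_apply, lie_off_off_fst, lie_off_off_fst, BiOct.nested_tmul,
      BiOct.nested_tmul, tri_self, tri_self, ip_one_one', ip_l_l]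
    simp
  · rw [neg_snd, lie_off_off_snd, lie_off_off_snd, neg_zero]

/-- As 1 and L are orthogonal, only the split octonionic operator survives and p, q matter only
through their inner product. So each type contributes a single diagonal boost. -/
theorem lie_off_one_off_l (t : Fin 3) (p q : Oct (-1)) :
    (⁅off t (1 ⊗ₜ p), off t (l ⊗ₜ q)⁆ : e8) = ip p q • ⁅off t (1 ⊗ₜ 1), off t (l ⊗ₜ 1)⁆ := by
  refine ext_tmul (fun i S s => ?_) (fun i => ?_)
  · rw [smul_fst, LinearMap.smul_apply, lie_off_off_fst, lie_off_off_fst, BiOct.nested_tmul,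
      BiOct.nested_tmul, ip_one_l, ip_one_one]
    simp
  · rw [smul_snd, lie_off_off_snd, lie_off_off_snd, smul_zero]

theorem su3_le {W : Submodule ℝ e8} (h1 : ∀ t p, off t (1 ⊗ₜ p) ∈ W)
    (h2 : ∀ t p, off t (l ⊗ₜ p) ∈ W) (h3 : ∀ t p q, ⁅off t (1 ⊗ₜ p), off t (1 ⊗ₜ q)⁆ ∈ W)
    (h4 : ∀ t, ⁅off t (1 ⊗ₜ 1), off t (l ⊗ₜ 1)⁆ ∈ W) : su3.toSubmodule ≤ W := by
  refine Submodule.span_le.2 ?_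
  rintro _ (⟨t, a, ha, rfl⟩ | ⟨t, a, ha, b, hb, rfl⟩)
  · obtain ⟨p, q, rfl⟩ := BiOct.mem_splitComplex.1 ha
    rw [off_add]
    exact add_mem (h1 t p) (h2 t q)
  · obtain ⟨p, q, rfl⟩ := BiOct.mem_splitComplex.1 ha
    obtain ⟨r, s, rfl⟩ := BiOct.mem_splitComplex.1 hb
    rw [off_add, off_add, add_lie, lie_add, lie_add, lie_off_l_off_l, lie_off_one_off_l t p s,
      ← lie_skew (off t (l ⊗ₜ q)) (off t (1 ⊗ₜ r)), lie_off_one_off_l t r q]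
    exact add_mem (add_mem (h3 _ _ _) (W.smul_mem _ (h4 t)))
      (add_mem (neg_mem (W.smul_mem _ (h4 t))) (neg_mem (h3 _ _ _)))

theorem DO_tmul (p : Oct (-1) × Oct (-1)) (i : Fin 3) (S : Oct 1) (s : Oct (-1)) :
    (DO p).1.1 i (S ⊗ₜ s) = S ⊗ₜ ((1 / 2 : ℝ) • tri 0 p.1 p.2 i s) := by
  rw [DO, DD_fst, LinearMap.smul_apply, BiOct.nested_tmul, ip_one_one', tri_self]
  simp

/-- A_p and G_p are two combinations of the three quaternionic pairs of p. This triality relation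
makes S_p the third, so that all three pairs can be recovered. -/
theorem DO_add_DO_add_DO (n : Fin 7) :
    DO (pairA n) + DO (pairB n) + DO (pairC n) = S (1 ⊗ₜ unit n) := by
  refine ext_tmul (fun t R s => ?_) (fun i => by simp [DO, S])
  simp only [S, add_fst, sub_fst, LinearMap.add_apply, LinearMap.sub_apply, DO_tmul, E_fst, F_fst,
    LinearMap.smul_apply, Algebra.TensorProduct.one_def, BiOct.nested_tmul, ip_one_one', tri_self,
    Pi.zero_apply, LinearMap.zero_apply, TensorProduct.zero_tmul, smul_zero, add_zero, one_smul]
  simp only [← TensorProduct.tmul_smul, ← TensorProduct.tmul_add, ← TensorProduct.tmul_sub]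
  congr 1
  obtain ⟨s0, s1, s2, s3, s4, s5, s6, s7, rfl⟩ := eq_co s
  fin_cases n <;> fin_cases t <;>
    simp [pairA, pairB, pairC, unit, tri, own_eq, next_apply, prev_apply, one_eq_co,
      i, j, k, kl, jl, il, l, co_mul, co_star, co_add, co_sub, co_smul, co_ip, -star_mul] <;>
    apply co_congr <;> ring

end e8

/-! ### The span of the 78 generators is 𝔰𝔲(3, ℂ' ⊗ 𝕆). -/

theorem linearIndependent_of_dual_family {K V ι : Type*} [Field K] [AddCommGroup V] [Module K V]
    {b : ι → V} (φ : ι → V →ₗ[K] K) (h1 : ∀ i, φ i (b i) ≠ 0)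
    (h2 : ∀ i j, i ≠ j → φ i (b j) = 0) : LinearIndependent K b := by
  classical
  rw [linearIndependent_iff']
  intro s g hg i hi
  have := congrArg (φ i) hg
  rw [map_sum, map_zero, Finset.sum_eq_single i] at this
  · simpa [h1] using this
  · intro j _ hj; rw [map_smul, h2 i j hj.symm, smul_zero]
  · exact fun h => (h hi).elim

namespace e8
open GMat Oct

theorem off_one_tmul_mem_of_units {t : Fin 3} {R : Oct 1} {W : Submodule ℝ e8}
    (h : ∀ n, off t (R ⊗ₜ basisUnit n) ∈ W) (p : Oct (-1)) : off t (R ⊗ₜ p) ∈ W := by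
  rw [← sum_basisUnit p, TensorProduct.tmul_sum, ← offL_apply, map_sum]
  refine sum_mem fun n _ => ?_
  rw [TensorProduct.tmul_smul, map_smul]
  exact W.smul_mem _ (h n)

theorem lie_off_off_self (t : Fin 3) (a : BiOct) : (⁅off t a, off t a⁆ : e8) = 0 := lie_self _

/-- The bracket of off-diagonal octonionic matrices of type `t`, as a bilinear map. -/
def lieOffL (t : Fin 3) : Oct (-1) →ₗ[ℝ] Oct (-1) →ₗ[ℝ] e8 :=
  (LieModule.toEnd ℝ e8 e8).toLinearMap.compl₁₂ (offL t ∘ₗ TensorProduct.mk ℝ _ _ 1)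
    (offL t ∘ₗ TensorProduct.mk ℝ _ _ 1)

theorem lieOffL_apply (t : Fin 3) (p q : Oct (-1)) :
    lieOffL t p q = ⁅off t (1 ⊗ₜ p), off t (1 ⊗ₜ q)⁆ := rfl

theorem DO_eq (p q : Oct (-1)) : DO (p, q) = (1 / 2 : ℝ) • lieOffL 0 p q := rfl

theorem lieOffL_swap (t : Fin 3) (p q : Oct (-1)) : lieOffL t p q = -lieOffL t q p := by
  rw [lieOffL_apply, lieOffL_apply, lie_skew]

theorem lieOffL_zero_add (a b c : Oct (-1)) : lieOffL 0 a (star (b * c)) +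
    lieOffL 1 b (star (c * a)) + lieOffL 2 c (star (a * b)) = 0 := by
  have h := congrArg ((2 : ℝ) • ·) (DD_add_EE_add_FF (1 ⊗ₜ a) (1 ⊗ₜ b) (1 ⊗ₜ c))
  simp only [BiOct.mul_tmul, TensorProduct.star_tmul, one_mul, star_one, DD, EE, FF, smul_add,
    smul_smul, smul_zero] at h
  norm_num at h
  simpa only [lieOffL_apply, star_mul, X, Y, Z] using h

/-- The positions of the units of the pairs `a(p)`, `b(p)`, `c(p)` in the basis of units. -/
def pairIndex : Fin 3 → Fin 7 → Fin 8 × Fin 8 :=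
  ![![(2, 3), (3, 1), (1, 2), (5, 1), (6, 3), (4, 2), (6, 1)],
    ![(4, 5), (6, 4), (5, 6), (2, 6), (1, 4), (3, 5), (5, 2)],
    ![(7, 6), (7, 5), (7, 4), (3, 7), (2, 7), (1, 7), (4, 3)]]

theorem pair_eq (n : Fin 7) :
    pairA n = (basisUnit (pairIndex 0 n).1, basisUnit (pairIndex 0 n).2) ∧
    pairB n = (basisUnit (pairIndex 1 n).1, basisUnit (pairIndex 1 n).2) ∧
    pairC n = (basisUnit (pairIndex 2 n).1, basisUnit (pairIndex 2 n).2) := by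
  fin_cases n <;> exact ⟨rfl, rfl, rfl⟩

/-- Two distinct imaginary units generate one quaternionic subalgebra, so each of the 21 unordered
pairs occurs among the 3 · 7 entries of the table. -/
theorem exists_pairIndex (m n : Fin 8) : m = 0 ∨ n = 0 ∨ m = n ∨
    ∃ t k, pairIndex t k = (m, n) ∨ pairIndex t k = (n, m) := by
  revert m n; decide

theorem mem_span_e6Generators_or (x : e8) (h : x ∈ Set.range A ∨ x ∈ Set.range G ∨
    x ∈ Set.range (fun n => S (1 ⊗ₜ unit n)) ∨ x ∈ Set.range (fun n => D (1 ⊗ₜ unit n)) ∨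
    x ∈ Set.range (fun n => X (1 ⊗ₜ basisUnit n)) ∨
    x ∈ Set.range (fun n => Y (1 ⊗ₜ basisUnit n)) ∨
    x ∈ Set.range (fun n => Z (1 ⊗ₜ basisUnit n)) ∨
    x ∈ Set.range (fun n => X (l ⊗ₜ basisUnit n)) ∨
    x ∈ Set.range (fun n => Y (l ⊗ₜ basisUnit n)) ∨
    x ∈ Set.range (fun n => Z (l ⊗ₜ basisUnit n)) ∨ x = D (l ⊗ₜ 1) ∨ x = S (l ⊗ₜ 1)) :
    x ∈ Submodule.span ℝ e6Generators :=
  Submodule.subset_span (by simpa only [e6Generators, Set.mem_union, or_assoc, Set.mem_insert_iff,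
    Set.mem_singleton_iff] using h)

theorem off_one_tmul_mem_span (t : Fin 3) (p : Oct (-1)) :
    off t (1 ⊗ₜ p) ∈ Submodule.span ℝ e6Generators := by
  refine off_one_tmul_mem_of_units (fun n => mem_span_e6Generators_or _ ?_) p
  fin_cases t
  · exact .inr <| .inr <| .inr <| .inr <| .inl ⟨n, rfl⟩
  · exact .inr <| .inr <| .inr <| .inr <| .inr <| .inl ⟨n, rfl⟩
  · exact .inr <| .inr <| .inr <| .inr <| .inr <| .inr <| .inl ⟨n, rfl⟩

theorem off_l_tmul_mem_span (t : Fin 3) (p : Oct (-1)) :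
    off t (l ⊗ₜ p) ∈ Submodule.span ℝ e6Generators := by
  refine off_one_tmul_mem_of_units (fun n => mem_span_e6Generators_or _ ?_) p
  fin_cases t
  · exact .inr <| .inr <| .inr <| .inr <| .inr <| .inr <| .inr <| .inl ⟨n, rfl⟩
  · exact .inr <| .inr <| .inr <| .inr <| .inr <| .inr <| .inr <| .inr <| .inl ⟨n, rfl⟩
  · exact .inr <| .inr <| .inr <| .inr <| .inr <| .inr <| .inr <| .inr <| .inr <| .inl ⟨n, rfl⟩

theorem lieOffL_pairIndex_mem_span (n : Fin 7) (t : Fin 3) :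
    lieOffL 0 (basisUnit (pairIndex t n).1) (basisUnit (pairIndex t n).2) ∈
      Submodule.span ℝ e6Generators := by
  have hA := mem_span_e6Generators_or (A n) (.inl ⟨n, rfl⟩)
  have hG := mem_span_e6Generators_or (G n) (.inr <| .inl ⟨n, rfl⟩)
  have hS := mem_span_e6Generators_or (S (1 ⊗ₜ unit n)) (.inr <| .inr <| .inl ⟨n, rfl⟩)
  rw [← DO_add_DO_add_DO] at hS
  rw [A] at hA
  rw [G] at hG
  obtain ⟨e1, e2, e3⟩ := pair_eq n
  rw [e1, e2, DO_eq, DO_eq] at hA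
  rw [e1, e2, e3, DO_eq, DO_eq, DO_eq] at hG hS
  -- S_p + G_p = 3 D_{c(p)}, and D is half a bracket, hence the factor 2/3. Next, S_p - D_{c(p)} =
  -- D_{a(p)} + D_{b(p)}, while A_p = D_{b(p)} - D_{a(p)} separates the last two.
  have hC := Submodule.smul_mem _ (2 / 3 : ℝ) (add_mem hS hG)
  have hB := sub_mem hS (Submodule.smul_mem _ (1 / 2 : ℝ) hC)
  fin_cases t
  · change lieOffL 0 (basisUnit (pairIndex 0 n).1) (basisUnit (pairIndex 0 n).2) ∈ _
    convert sub_mem hB hA using 1; module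
  · change lieOffL 0 (basisUnit (pairIndex 1 n).1) (basisUnit (pairIndex 1 n).2) ∈ _
    convert add_mem hB hA using 1; module
  · change lieOffL 0 (basisUnit (pairIndex 2 n).1) (basisUnit (pairIndex 2 n).2) ∈ _
    convert hC using 1; module

theorem lieOffL_zero_mem_span (p q : Oct (-1)) :
    lieOffL 0 p q ∈ Submodule.span ℝ e6Generators := by
  have hD (n : Fin 8) : lieOffL 0 1 (basisUnit n) ∈ Submodule.span ℝ e6Generators := by
    refine Fin.cases ?_ (fun n => ?_) n
    · rw [lieOffL_apply]
      change ⁅off 0 (1 ⊗ₜ 1), off 0 (1 ⊗ₜ 1)⁆ ∈ _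
      rw [lie_off_off_self]; exact zero_mem _
    · have h := mem_span_e6Generators_or (D (1 ⊗ₜ unit n)) (.inr <| .inr <| .inr <| .inl ⟨n, rfl⟩)
      have h2 := Submodule.smul_mem _ (2 : ℝ) h
      rwa [D, smul_smul, mul_one_div_cancel two_ne_zero, one_smul] at h2
  rw [← sum_basisUnit p, ← sum_basisUnit q]
  simp only [map_sum, LinearMap.sum_apply, map_smul, LinearMap.smul_apply]
  refine sum_mem fun n _ => Submodule.smul_mem _ _ (sum_mem fun m _ => Submodule.smul_mem _ _ ?_)
  rcases exists_pairIndex m n with rfl | rfl | rfl | ⟨t, k, h | h⟩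
  · exact hD n
  · rw [lieOffL_swap]; exact neg_mem (hD m)
  · rw [lieOffL_apply, lie_off_off_self]; exact zero_mem _
  · have := lieOffL_pairIndex_mem_span k t
    rwa [h] at this
  · have := lieOffL_pairIndex_mem_span k t
    rw [h] at this
    rw [lieOffL_swap]; exact neg_mem this

theorem mem_span_of_D_S {q : BiOct} (hD : D q ∈ Submodule.span ℝ e6Generators)
    (hS : S q ∈ Submodule.span ℝ e6Generators) : E q ∈ Submodule.span ℝ e6Generators ∧
      F q ∈ Submodule.span ℝ e6Generators := by
  have h := D_add_E_add_F q
  have hE : E q = (1 / 2 : ℝ) • (S q - D q) := by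
    rw [S]; linear_combination (norm := module) (1 / 2 : ℝ) • h
  have hF : F q = -(D q + E q) := eq_neg_of_add_eq_zero_right h
  have hE' : E q ∈ Submodule.span ℝ e6Generators := by
    rw [hE]; exact Submodule.smul_mem _ _ (sub_mem hS hD)
  exact ⟨hE', by rw [hF]; exact neg_mem (add_mem hD hE')⟩

theorem lieOffL_one_mem_span (t : Fin 3) (p : Oct (-1)) :
    lieOffL t 1 p ∈ Submodule.span ℝ e6Generators := by
  rw [← sum_basisUnit p, map_sum]
  refine sum_mem fun n _ => ?_
  rw [map_smul]
  refine Submodule.smul_mem _ _ ?_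
  refine Fin.cases ?_ (fun n => ?_) n
  · rw [lieOffL_apply]
    change ⁅off t (1 ⊗ₜ 1), off t (1 ⊗ₜ 1)⁆ ∈ _
    rw [lie_off_off_self]; exact zero_mem _
  · have hD := mem_span_e6Generators_or (D (1 ⊗ₜ unit n)) (.inr <| .inr <| .inr <| .inl ⟨n, rfl⟩)
    have hS := mem_span_e6Generators_or (S (1 ⊗ₜ unit n)) (.inr <| .inr <| .inl ⟨n, rfl⟩)
    obtain ⟨hE, hF⟩ := mem_span_of_D_S hD hS
    have key {x : e8} (h : (1 / 2 : ℝ) • x ∈ Submodule.span ℝ e6Generators) :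
        x ∈ Submodule.span ℝ e6Generators := by
      have h2 := Submodule.smul_mem _ (2 : ℝ) h
      rwa [smul_smul, mul_one_div_cancel two_ne_zero, one_smul] at h2
    fin_cases t
    exacts [key hD, key hE, key hF]

/-- With one of its arguments equal to 1, `lieOffL_zero_add` expresses a bracket of type 1 or 2
through one of type 0 and one with the unit, and both of these are already in the span. -/
theorem lieOffL_mem_span (t : Fin 3) (p q : Oct (-1)) :
    lieOffL t p q ∈ Submodule.span ℝ e6Generators := by
  have h0 := lieOffL_zero_mem_span
  have h1 := lieOffL_one_mem_span
  fin_cases t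
  · exact h0 p q
  · have h := lieOffL_zero_add (star q) p 1
    rw [mul_one, one_mul, star_star] at h
    change lieOffL 1 p q ∈ _
    rw [eq_neg_of_add_eq_zero_right ((add_right_comm _ _ _).symm.trans h)]
    exact neg_mem (add_mem (h0 _ _) (h1 _ _))
  · have h := lieOffL_zero_add (star q) 1 p
    rw [mul_one, one_mul, star_star] at h
    change lieOffL 2 p q ∈ _
    rw [eq_neg_of_add_eq_zero_right h]
    exact neg_mem (add_mem (h0 _ _) (h1 _ _))

theorem su3_le_span : su3.toSubmodule ≤ Submodule.span ℝ e6Generators := by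
  refine su3_le off_one_tmul_mem_span off_l_tmul_mem_span lieOffL_mem_span fun t => ?_
  have hD := mem_span_e6Generators_or (D (l ⊗ₜ 1)) (by simp)
  have hS := mem_span_e6Generators_or (S (l ⊗ₜ 1)) (by simp)
  obtain ⟨hE, hF⟩ := mem_span_of_D_S hD hS
  have key {x : e8} (h : (1 / 2 : ℝ) • x ∈ Submodule.span ℝ e6Generators) :
      x ∈ Submodule.span ℝ e6Generators := by
    have h2 := Submodule.smul_mem _ (2 : ℝ) h
    rwa [smul_smul, mul_one_div_cancel two_ne_zero, one_smul] at h2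
  fin_cases t
  exacts [key hD, key hE, key hF]

/-- Each diagonal generator is a combination of brackets of off-diagonal ones, so the off-diagonal
ones generate 𝔢₆. Later inclusions of 𝔢₆ in a subalgebra need be checked only on these. -/
theorem e6Generators_subset {K : LieSubalgebra ℝ e8} (h1 : ∀ t p, off t (1 ⊗ₜ p) ∈ K)
    (h2 : ∀ t p, off t (l ⊗ₜ p) ∈ K) : e6Generators ⊆ K := by
  have hl (t : Fin 3) (a b : BiOct) (ha : off t a ∈ K) (hb : off t b ∈ K) :
      (1 / 2 : ℝ) • ⁅off t a, off t b⁆ ∈ K := K.smul_mem _ (K.lie_mem ha hb)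
  have hDO (p : Oct (-1) × Oct (-1)) : DO p ∈ K := hl _ _ _ (h1 _ _) (h1 _ _)
  have hD {q : BiOct} (hq : ∀ t, off t q ∈ K) : D q ∈ K := hl _ _ _ (h1 _ 1) (hq _)
  have hS {q : BiOct} (hq : ∀ t, off t q ∈ K) : S q ∈ K :=
    sub_mem (hl _ _ _ (h1 _ 1) (hq _)) (hl _ _ _ (h1 _ 1) (hq _))
  rintro x ((((((((((⟨n, rfl⟩ | ⟨n, rfl⟩) | ⟨n, rfl⟩) | ⟨n, rfl⟩) | ⟨n, rfl⟩) | ⟨n, rfl⟩) |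
    ⟨n, rfl⟩) | ⟨n, rfl⟩) | ⟨n, rfl⟩) | ⟨n, rfl⟩) | rfl | rfl)
  · exact neg_mem (sub_mem (hDO _) (hDO _))
  · exact neg_mem (sub_mem (add_mem (hDO _) (hDO _)) (K.smul_mem _ (hDO _)))
  · exact hS fun t => h1 _ _
  · exact hD fun t => h1 _ _
  · exact h1 _ _
  · exact h1 _ _
  · exact h1 _ _
  · exact h2 _ _
  · exact h2 _ _
  · exact h2 _ _
  · exact hD fun t => h2 _ _
  · exact hS fun t => h2 _ _

theorem e6_le {K : LieSubalgebra ℝ e8} (h1 : ∀ t p, off t (1 ⊗ₜ p) ∈ K)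
    (h2 : ∀ t p, off t (l ⊗ₜ p) ∈ K) : e6 ≤ K :=
  LieSubalgebra.lieSpan_le.2 (e6Generators_subset h1 h2)

theorem e6_le_su3 : e6 ≤ su3 :=
  e6_le (fun t p => off_mem_su3 t (BiOct.one_tmul_mem p))
    (fun t p => off_mem_su3 t (BiOct.l_tmul_mem p))

theorem e6_eq_span : e6.toSubmodule = Submodule.span ℝ e6Generators :=
  le_antisymm (le_trans e6_le_su3 su3_le_span) LieSubalgebra.submodule_span_le_lieSpan

theorem e6_eq_su3 : e6 = su3 := le_antisymm e6_le_su3 (by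
  change su3.toSubmodule ≤ e6.toSubmodule
  rw [e6_eq_span]; exact su3_le_span)

end e8

/-! ### The dimension of 𝔢₆. -/

namespace e8
open GMat Oct

theorem S_fst (q : BiOct) (i : Fin 3) : (S q).1.1 i = (E q).1.1 i - (F q).1.1 i := rfl
@[simp] theorem S_snd (q : BiOct) (i : Fin 3) : (S q).1.2 i = 0 := by simp [S]

/-- The generators of `𝔢₆`, as a family. -/
def e6Family : (Fin 4 × Fin 7) ⊕ (Fin 6 × Fin 8) ⊕ Fin 2 → e8 :=
  Sum.elim (fun x => ![A x.2, G x.2, S (1 ⊗ₜ unit x.2), D (1 ⊗ₜ unit x.2)] x.1)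
    (Sum.elim (fun x => ![X (1 ⊗ₜ basisUnit x.2), Y (1 ⊗ₜ basisUnit x.2), Z (1 ⊗ₜ basisUnit x.2),
      X (l ⊗ₜ basisUnit x.2), Y (l ⊗ₜ basisUnit x.2), Z (l ⊗ₜ basisUnit x.2)] x.1)
      ![D (l ⊗ₜ 1), S (l ⊗ₜ 1)])

theorem e6Generators_subset_range : e6Generators ⊆ Set.range e6Family := by
  rintro x ((((((((((⟨n, rfl⟩ | ⟨n, rfl⟩) | ⟨n, rfl⟩) | ⟨n, rfl⟩) | ⟨n, rfl⟩) | ⟨n, rfl⟩) |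
    ⟨n, rfl⟩) | ⟨n, rfl⟩) | ⟨n, rfl⟩) | ⟨n, rfl⟩) | rfl | rfl)
  · exact ⟨.inl (0, n), rfl⟩
  · exact ⟨.inl (1, n), rfl⟩
  · exact ⟨.inl (2, n), rfl⟩
  · exact ⟨.inl (3, n), rfl⟩
  · exact ⟨.inr (.inl (0, n)), rfl⟩
  · exact ⟨.inr (.inl (1, n)), rfl⟩
  · exact ⟨.inr (.inl (2, n)), rfl⟩
  · exact ⟨.inr (.inl (3, n)), rfl⟩
  · exact ⟨.inr (.inl (4, n)), rfl⟩
  · exact ⟨.inr (.inl (5, n)), rfl⟩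
  · exact ⟨.inr (.inr 0), rfl⟩
  · exact ⟨.inr (.inr 1), rfl⟩

instance : Module.Finite ℝ e6 := by
  have h1 := (Set.finite_range e6Family).subset e6Generators_subset_range
  have h2 : Module.Finite ℝ (Submodule.span ℝ e6Generators) :=
    Module.Finite.span_of_finite ℝ h1
  rw [← e6_eq_span] at h2
  exact h2

theorem finrank_e6_le : Module.finrank ℝ e6 ≤ 78 := by
  have h : Module.finrank ℝ e6 = (e6Generators).finrank ℝ := by
    change Module.finrank ℝ e6.toSubmodule = _
    rw [e6_eq_span]; rfl
  rw [h]
  have hfin : Module.Finite ℝ (Submodule.span ℝ (Set.range e6Family)) :=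
    Module.Finite.span_of_finite ℝ (Set.finite_range _)
  refine (Submodule.finrank_mono (Submodule.span_mono e6Generators_subset_range)).trans ?_
  refine (finrank_range_le_card e6Family).trans ?_
  simp

/-- The operators of the diagonal part, as a linear map. -/
def fstL (i : Fin 3) (c : BiOct) : e8 →ₗ[ℝ] BiOct where
  toFun x := x.1.1 i c
  map_add' _ _ := rfl
  map_smul' _ _ := rfl

/-- The parameters of the off-diagonal part, as a linear map. -/
def sndL (i : Fin 3) : e8 →ₗ[ℝ] BiOct where
  toFun x := x.1.2 i
  map_add' _ _ := rfl
  map_smul' _ _ := rfl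

@[simp] theorem fstL_apply (i : Fin 3) (c : BiOct) (x : e8) : fstL i c x = x.1.1 i c := rfl
@[simp] theorem sndL_apply (i : Fin 3) (x : e8) : sndL i x = x.1.2 i := rfl

/-- The index set of a basis of `𝔢₆` adapted to the decomposition into off-diagonal, rotation and
boost parts. -/
abbrev BasisIndex : Type := (Fin 3 × Fin 2 × Fin 8) ⊕ {x : Fin 8 × Fin 8 // x.1 < x.2} ⊕ Fin 2

theorem card_basisIndex : Fintype.card BasisIndex = 78 := by decide

/-- A basis of `𝔢₆` adapted to the decomposition into off-diagonal, rotation and boost parts. -/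
def basisFamily : BasisIndex → e8 :=
  Sum.elim (fun x => off x.1 ((![1, l] x.2.1 : Oct 1) ⊗ₜ basisUnit x.2.2))
    (Sum.elim (fun x => lieOffL 0 (basisUnit x.1.1) (basisUnit x.1.2))
      ![D (l ⊗ₜ 1), S (l ⊗ₜ 1)])

/-- A family of linear forms dual to `basisFamily` up to nonzero scalars. -/
def dualFamily : BasisIndex → e8 →ₗ[ℝ] ℝ :=
  Sum.elim (fun x => ipL (basisUnit x.2.2) ∘ₗ BiOct.contract (![1, l] x.2.1) ∘ₗ sndL x.1)
    (Sum.elim (fun x => ipL (basisUnit x.1.2) ∘ₗ BiOct.contract 1 ∘ₗ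
        fstL 0 (1 ⊗ₜ basisUnit x.1.1))
      -- By `D_l_fst` and `S_l_fst`, at positions 0 and 1 the coefficients of L are 2, -1 for D_L
      -- and 0, 3 for S_L. The first form kills S_L. The second adds twice position 1 to position 0,
      -- which kills D_L.
      ![ipL 1 ∘ₗ BiOct.contract l ∘ₗ fstL 0 (1 ⊗ₜ 1),
        ipL 1 ∘ₗ BiOct.contract l ∘ₗ (fstL 0 (1 ⊗ₜ 1) + (2 : ℝ) • fstL 1 (1 ⊗ₜ 1))])

theorem lieOffL_fst (t i : Fin 3) (p q s : Oct (-1)) (R : Oct 1) :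
    (lieOffL t p q).1.1 i (R ⊗ₜ s) = R ⊗ₜ tri t p q i s := by
  rw [lieOffL_apply, lie_off_off_fst, BiOct.nested_tmul, ip_one_one', tri_self]
  simp

@[simp] theorem lieOffL_snd (t i : Fin 3) (p q : Oct (-1)) : (lieOffL t p q).1.2 i = 0 :=
  lie_off_off_snd ..

theorem nested_one_l (t i : Fin 3) (s : Oct (-1)) :
    nested t (1 ⊗ₜ 1) (l ⊗ₜ 1) i (1 ⊗ₜ s) = tri t 1 l i 1 ⊗ₜ[ℝ] s := by
  rw [BiOct.nested_tmul, ip_one_l, ip_one_one]; simp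

/-- The coefficients are the cyclic differences of (1, -1, 0), and below for S_L those of (1, 1,
-2). -/
theorem D_l_fst (i : Fin 3) (s : Oct (-1)) :
    (D (l ⊗ₜ 1)).1.1 i (1 ⊗ₜ s) = (![2, -1, -1] i : ℝ) • (l ⊗ₜ[ℝ] s) := by
  rw [D_fst, Algebra.TensorProduct.one_def, LinearMap.smul_apply, nested_one_l,
    TensorProduct.smul_tmul', TensorProduct.smul_tmul']
  congr 1
  fin_cases i <;> simp [tri, own_apply, next_apply, prev_apply, star_l] <;> module

theorem S_l_fst (i : Fin 3) (s : Oct (-1)) :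
    (S (l ⊗ₜ 1)).1.1 i (1 ⊗ₜ s) = (![0, 3, -3] i : ℝ) • (l ⊗ₜ[ℝ] s) := by
  rw [S_fst, E_fst, F_fst, Algebra.TensorProduct.one_def, LinearMap.sub_apply,
    LinearMap.smul_apply, LinearMap.smul_apply, nested_one_l, nested_one_l,
    TensorProduct.smul_tmul', TensorProduct.smul_tmul', ← TensorProduct.sub_tmul,
    TensorProduct.smul_tmul']
  congr 1
  fin_cases i <;> simp [tri, own_apply, next_apply, prev_apply, star_l] <;> module

theorem ip_own (p q r s : Fin 8) :
    ip (basisUnit s) (own (basisUnit p) (basisUnit q) (basisUnit r) : Oct (-1)) =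
      4 * ((if p = r then 1 else 0) * (if s = q then 1 else 0) -
        (if q = r then 1 else 0) * (if s = p then 1 else 0)) := by
  rw [own_eq, ip_sub_right, ip_smul_right, ip_smul_right]
  simp only [ip_basisUnit]; ring

theorem linearIndependent_basisFamily : LinearIndependent ℝ basisFamily := by
  have hl1 : ip (l : Oct 1) 1 = 0 := by rw [ip_comm, ip_one_l]
  refine linearIndependent_of_dual_family dualFamily ?_ ?_
  · rintro (⟨t, z, n⟩ | ⟨⟨p, q⟩, hpq⟩ | m)
    · fin_cases z <;> simp [dualFamily, basisFamily,
          ip_zero_right, ip_neg_right, ip_smul_right, ip_basisUnit, ip_one_one, ip_l_l, off_snd,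
          ip_one_one', ip_l_l]
    · have hpq : p < q := hpq
      simp [dualFamily, basisFamily,
          ip_zero_right, ip_neg_right, ip_smul_right, ip_basisUnit, ip_one_one, ip_l_l,
          lieOffL_fst, tri, ip_own, hpq.ne', ip_one_one']
    · fin_cases m <;> simp [dualFamily, basisFamily,
          ip_zero_right, ip_neg_right, ip_smul_right, ip_basisUnit, ip_one_one, ip_l_l, D_l_fst,
          S_l_fst]
  · rintro (⟨t, z, n⟩ | ⟨⟨p, q⟩, hpq⟩ | m) (⟨t', z', n'⟩ | ⟨⟨p', q'⟩, hpq'⟩ | m') hne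
    · by_cases ht : t = t'
      · subst ht
        by_cases hn : n = n'
        · subst hn
          fin_cases z <;> fin_cases z' <;> simp [dualFamily, basisFamily,
          ip_zero_right, ip_neg_right, ip_smul_right, ip_basisUnit, ip_one_one, ip_l_l, off_snd,
          ip_one_l, hl1] at hne ⊢
        · fin_cases z <;> fin_cases z' <;>
            simp [dualFamily, basisFamily,
          ip_zero_right, ip_neg_right, ip_smul_right, ip_basisUnit, ip_one_one, ip_l_l, off_snd,
          ip_one_l, hl1, ip_smul_right, ip_basisUnit, hn]
      · simp [dualFamily, basisFamily,
          ip_zero_right, ip_neg_right, ip_smul_right, ip_basisUnit, ip_one_one, ip_l_l, off_snd, ht]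
    · simp [dualFamily, basisFamily,
          ip_zero_right, ip_neg_right, ip_smul_right, ip_basisUnit, ip_one_one, ip_l_l]
    · fin_cases m' <;> simp [dualFamily, basisFamily,
          ip_zero_right, ip_neg_right, ip_smul_right, ip_basisUnit, ip_one_one, ip_l_l]
    · simp [dualFamily, basisFamily,
          ip_zero_right, ip_neg_right, ip_smul_right, ip_basisUnit, ip_one_one, ip_l_l]
    · have hpq : p < q := hpq
      have hpq' : p' < q' := hpq'
      simp only [dualFamily, basisFamily, Sum.elim_inr, Sum.elim_inl, LinearMap.comp_apply,
        fstL_apply, lieOffL_fst, BiOct.contract_tmul, ipL_apply, tri, if_true, ip_one_one',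
        one_smul, ip_own]
      -- By `ip_own`, a nonzero value requires (p', q') = (p, q), which is excluded, or (p', q') =
      -- (q, p), which contradicts the two strict orders.
      split_ifs <;> simp_all <;> omega
    · fin_cases m' <;> simp [dualFamily, basisFamily,
          ip_zero_right, ip_neg_right, ip_smul_right, ip_basisUnit, ip_one_one, ip_l_l, D_l_fst,
          S_l_fst, ip_one_l]
    · fin_cases m <;> simp [dualFamily, basisFamily,
          ip_zero_right, ip_neg_right, ip_smul_right, ip_basisUnit, ip_one_one, ip_l_l]
    · fin_cases m <;> simp [dualFamily, basisFamily,
          ip_zero_right, ip_neg_right, ip_smul_right, ip_basisUnit, ip_one_one, ip_l_l,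
          lieOffL_fst, hl1]
    · fin_cases m <;> fin_cases m' <;> simp [dualFamily, basisFamily,
          ip_zero_right, ip_neg_right, ip_smul_right, ip_basisUnit, ip_one_one, ip_l_l, D_l_fst,
          S_l_fst] at hne ⊢

theorem basisFamily_mem (x : BasisIndex) : basisFamily x ∈ e6 := by
  rw [e6_eq_su3]
  have h1 (t : Fin 3) (p : Oct (-1)) := off_mem_su3 t (BiOct.one_tmul_mem p)
  have h2 (t : Fin 3) (p : Oct (-1)) := off_mem_su3 t (BiOct.l_tmul_mem p)
  rcases x with ⟨t, z, n⟩ | ⟨p, q⟩ | m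
  · fin_cases z
    exacts [h1 _ _, h2 _ _]
  · exact su3.lie_mem (h1 _ _) (h1 _ _)
  · have hl (t : Fin 3) := su3.smul_mem (1 / 2 : ℝ) (su3.lie_mem (h1 t 1) (h2 t 1))
    fin_cases m
    exacts [hl 0, sub_mem (hl 1) (hl 2)]

theorem finrank_e6 : Module.finrank ℝ e6 = 78 := by
  refine le_antisymm finrank_e6_le ?_
  have h : LinearIndependent ℝ (fun x => (⟨basisFamily x, basisFamily_mem x⟩ : e6)) :=
    LinearIndependent.of_comp e6.toSubmodule.subtype linearIndependent_basisFamily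
  simpa only [card_basisIndex] using h.fintype_card_le_finrank

end e8

/-! ### The six null labels. -/

namespace Oct

theorem mem_labels {Q : Oct 1} : Q ∈ e8.labels ↔
    Q = co 0 (1/2) 0 0 0 (1/2) 0 0 ∨ Q = co 0 (1/2) 0 0 0 (-1/2) 0 0 ∨
    Q = co 0 0 (1/2) 0 0 0 (1/2) 0 ∨ Q = co 0 0 (1/2) 0 0 0 (-1/2) 0 ∨
    Q = co 0 0 0 (1/2) 0 0 0 (1/2) ∨ Q = co 0 0 0 (1/2) 0 0 0 (-1/2) := by
  have key (R : Oct 1) : (2 : ℝ) • Q = R ↔ Q = (1 / 2 : ℝ) • R := by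
    constructor
    · rintro rfl; rw [smul_smul]; norm_num
    · rintro rfl; rw [smul_smul]; norm_num
  simp only [e8.labels, Set.mem_ofPred_eq, Set.mem_insert_iff, Set.mem_singleton_iff, key, i, j, k,
    il, jl, kl, co_add, co_sub, co_smul]
  norm_num [neg_div]

theorem mem_labelSpan_of_mem_labels {Q : Oct 1} (hQ : Q ∈ e8.labels) : Q ∈ labelSpan := by
  rcases mem_labels.1 hQ with rfl | rfl | rfl | rfl | rfl | rfl <;> exact co_mem_labelSpan ..

theorem co_inj {γ : ℝ} {a0 a1 a2 a3 a4 a5 a6 a7 b0 b1 b2 b3 b4 b5 b6 b7 : ℝ} :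
    (co a0 a1 a2 a3 a4 a5 a6 a7 : Oct γ) = co b0 b1 b2 b3 b4 b5 b6 b7 ↔ a0 = b0 ∧ a1 = b1 ∧
      a2 = b2 ∧ a3 = b3 ∧ a4 = b4 ∧ a5 = b5 ∧ a6 = b6 ∧ a7 = b7 := by
  refine ⟨fun h => ?_, fun ⟨h0, h1, h2, h3, h4, h5, h6, h7⟩ => co_congr h0 h1 h2 h3 h4 h5 h6 h7⟩
  have h1 := Prod.ext_iff.1 h
  exact ⟨congrArg (·.re) h1.1, congrArg (·.imI) h1.1, congrArg (·.imJ) h1.1,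
    congrArg (·.imK) h1.1, congrArg (·.re) h1.2, congrArg (·.imI) h1.2, congrArg (·.imJ) h1.2,
    congrArg (·.imK) h1.2⟩

theorem l_mul_label {Q : Oct 1} (hQ : Q ∈ e8.labels) : l * Q = Q ∨ l * Q = -Q := by
  rcases mem_labels.1 hQ with rfl | rfl | rfl | rfl | rfl | rfl <;>
    simp only [l_mul_co, co_neg, co_inj] <;> norm_num

theorem label_ne_zero {Q : Oct 1} (hQ : Q ∈ e8.labels) : Q ≠ 0 := by
  rintro rfl
  rw [zero_eq_co, mem_labels] at hQ
  simp only [co_inj] at hQ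
  norm_num at hQ

theorem not_l_mul_label_both {Q : Oct 1} (hQ : Q ∈ e8.labels) : ¬ (l * Q = Q ∧ l * Q = -Q) := by
  rintro ⟨h1, h2⟩
  have : (2 : ℝ) • Q = 0 := by rw [two_smul]; nth_rw 1 [h1.symm.trans h2]; simp
  exact label_ne_zero hQ ((smul_eq_zero.1 this).resolve_left two_ne_zero)

theorem plus_labels_eq : {Q ∈ e8.labels | l * Q = Q} =
    {co 0 (1/2) 0 0 0 (-1/2) 0 0, co 0 0 (1/2) 0 0 0 (-1/2) 0, co 0 0 0 (1/2) 0 0 0 (-1/2)} := by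
  ext Q
  simp only [Set.mem_ofPred_eq, mem_labels, Set.mem_insert_iff, Set.mem_singleton_iff]
  constructor
  · rintro ⟨rfl | rfl | rfl | rfl | rfl | rfl, h⟩ <;> simp only [l_mul_co, co_inj] at h ⊢ <;>
      norm_num at h <;> norm_num
  · rintro (rfl | rfl | rfl) <;> simp only [l_mul_co, co_inj] <;> norm_num

theorem minus_labels_eq : {Q ∈ e8.labels | l * Q = -Q} =
    {co 0 (1/2) 0 0 0 (1/2) 0 0, co 0 0 (1/2) 0 0 0 (1/2) 0, co 0 0 0 (1/2) 0 0 0 (1/2)} := by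
  ext Q
  simp only [Set.mem_ofPred_eq, mem_labels, Set.mem_insert_iff, Set.mem_singleton_iff]
  constructor
  · rintro ⟨rfl | rfl | rfl | rfl | rfl | rfl, h⟩ <;>
      simp only [l_mul_co, co_neg, co_inj] at h ⊢ <;> norm_num at h <;> norm_num
  · rintro (rfl | rfl | rfl) <;> simp only [l_mul_co, co_neg, co_inj] <;> norm_num

theorem ncard_plus_labels : {Q ∈ e8.labels | l * Q = Q}.ncard = 3 := by
  rw [plus_labels_eq, Set.ncard_eq_three]
  refine ⟨_, _, _, ?_, ?_, ?_, rfl⟩ <;> rw [Ne, co_inj] <;> norm_num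

theorem ncard_minus_labels : {Q ∈ e8.labels | l * Q = -Q}.ncard = 3 := by
  rw [minus_labels_eq, Set.ncard_eq_three]
  refine ⟨_, _, _, ?_, ?_, ?_, rfl⟩ <;> rw [Ne, co_inj] <;> norm_num

theorem exists_ip_eq_one {Q : Oct 1} (hQ : Q ≠ 0) : ∃ R, ip R Q = 1 := by
  by_contra! h
  have h0 (R : Oct 1) : ip R Q = 0 := by
    by_contra hR
    exact h ((ip R Q)⁻¹ • R) (by rw [ip_smul_left, inv_mul_cancel₀ hR])
  obtain ⟨a0, a1, a2, a3, a4, a5, a6, a7, rfl⟩ := eq_co Q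
  refine hQ ?_
  -- Changing the sign of the last four coordinates turns the split form into the sum of eight
  -- squares.
  have h1 := h0 (co a0 a1 a2 a3 (-a4) (-a5) (-a6) (-a7))
  rw [co_ip] at h1
  rw [zero_eq_co]
  apply co_congr <;> nlinarith [sq_nonneg a0, sq_nonneg a1, sq_nonneg a2, sq_nonneg a3,
    sq_nonneg a4, sq_nonneg a5, sq_nonneg a6, sq_nonneg a7]

/-- The labels are null, so contraction with Q itself gives nothing; nondegeneracy of the split form
supplies another R to contract with. -/
theorem tmul_eq_zero_iff {Q : Oct 1} (hQ : Q ≠ 0) {p : Oct (-1)} :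
    Q ⊗ₜ[ℝ] p = 0 ↔ p = 0 := by
  refine ⟨fun h => ?_, fun h => by rw [h, TensorProduct.tmul_zero]⟩
  obtain ⟨R, hR⟩ := exists_ip_eq_one hQ
  simpa [hR] using congrArg (BiOct.contract R) h

theorem finrank_eq (γ : ℝ) : Module.finrank ℝ (Oct γ) = 8 := by
  change Module.finrank ℝ (ℍ[ℝ] × ℍ[ℝ]) = 8
  rw [Module.finrank_prod, Quaternion.finrank_eq_four]

instance (γ : ℝ) : Module.Finite ℝ (Oct γ) := inferInstanceAs (Module.Finite ℝ (ℍ[ℝ] × ℍ[ℝ]))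

end Oct

/-! ### Coordinates of the Albert algebra, and the bijection 𝓟 ↦ Q𝓟 onto H_Q. -/

namespace Albert
open Oct

/-- The Hermitian matrix with given diagonal and cyclic off-diagonal entries. -/
def ofEntries (a : Fin 3 → ℝ) (p : Fin 3 → Oct (-1)) : Albert :=
  ⟨Matrix.of fun m n => if n = m then a m • 1 else if n = m + 1 then p m else star (p n), by
    refine Matrix.ext fun m n => ?_
    change star (ite (m = n) _ (ite _ _ _)) = ite (n = m) _ (ite _ _ _)
    have : n = m ∨ n = m + 1 ∨ n = m + 2 := by revert m n; decide
    rcases this with rfl | rfl | rfl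
    · simp
    · have h1 : m ≠ m + 1 := by revert m; decide
      have h2 : m ≠ m + 1 + 1 := by revert m; decide
      simp [h1, h2]
    · have h1 : m ≠ m + 2 := by revert m; decide
      have h2 : m + 2 ≠ m + 1 := by revert m; decide
      have h3 : m + 2 + 1 = m := by revert m; decide
      simp [h1, h1.symm, h2, h3]⟩

@[simp] theorem diagEntry_ofEntries (a : Fin 3 → ℝ) (p : Fin 3 → Oct (-1)) (n : Fin 3) :
    diagEntry (ofEntries a p) n = a n := by simp [diagEntry, ofEntries]

@[simp] theorem ofEntries_apply (a : Fin 3 → ℝ) (p : Fin 3 → Oct (-1)) (n : Fin 3) :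
    (ofEntries a p).1 n (n + 1) = p n := by
  have h1 : n + 1 ≠ n := by revert n; decide
  simp [ofEntries]

@[simp] theorem diagEntry_add (P R : Albert) (n : Fin 3) :
    diagEntry (P + R) n = diagEntry P n + diagEntry R n := rfl
@[simp] theorem diagEntry_smul (r : ℝ) (P : Albert) (n : Fin 3) :
    diagEntry (r • P) n = r * diagEntry P n := rfl

/-- The coordinates of an element of the Albert algebra. -/
def entriesEquiv : Albert ≃ₗ[ℝ] (Fin 3 → ℝ) × (Fin 3 → Oct (-1)) where
  toFun P := (diagEntry P, fun n => P.1 n (n + 1))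
  map_add' _ _ := rfl
  map_smul' _ _ := rfl
  invFun x := ofEntries x.1 x.2
  left_inv P := ext_entries (by simp) (by simp)
  right_inv x := by ext <;> simp

theorem entriesEquiv_apply (P : Albert) :
    entriesEquiv P = (diagEntry P, fun n => P.1 n (n + 1)) := rfl

theorem finrank_eq : Module.finrank ℝ Albert = 27 := by
  rw [entriesEquiv.finrank_eq, Module.finrank_prod, Module.finrank_pi, Module.finrank_pi_fintype]
  simp [Oct.finrank_eq]

instance : Module.Finite ℝ Albert := Module.Finite.equiv entriesEquiv.symm

end Albert

namespace e8
open GMat Oct Albert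

/-- The map `P ↦ QP` as a linear map. -/
def labelledL {Q : Oct 1} (hQ : Q ∈ labelSpan) : Albert →ₗ[ℝ] e8 where
  toFun := labelled Q
  map_add' P R := by
    refine ext_tmul (fun n S s => ?_) (fun n => ?_)
    · rw [add_fst, LinearMap.add_apply, labelled_fst hQ, labelled_fst hQ, labelled_fst hQ,
        ← TensorProduct.add_tmul]
      congr 1
      simp only [diagEntry_add, pairOp]; module
    · rw [add_snd, labelled_snd, labelled_snd, labelled_snd, ← TensorProduct.tmul_add]; rfl
  map_smul' r P := by
    refine ext_tmul (fun n S s => ?_) (fun n => ?_)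
    · rw [smul_fst, LinearMap.smul_apply, labelled_fst hQ, labelled_fst hQ,
        TensorProduct.smul_tmul']
      congr 1
      simp only [diagEntry_smul, pairOp, RingHom.id_apply]; module
    · rw [smul_snd, labelled_snd, labelled_snd, ← TensorProduct.tmul_smul]; rfl

@[simp] theorem labelledL_apply {Q : Oct 1} (hQ : Q ∈ labelSpan) (P : Albert) :
    labelledL hQ P = labelled Q P := rfl

theorem isLinearMap_labelled {Q : Oct 1} (hQ : Q ∈ labelSpan) : IsLinearMap ℝ (labelled Q) :=
  (labelledL hQ).isLinear

theorem labelled_neg_label {Q : Oct 1} (hQ : Q ∈ labelSpan) (P : Albert) :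
    labelled (-Q) P = -labelled Q P := by
  refine ext_tmul (fun n S s => ?_) (fun n => ?_)
  · rw [neg_fst, LinearMap.neg_apply, labelled_fst hQ, labelled_fst (neg_mem hQ),
      ← TensorProduct.neg_tmul]
    congr 1
    simp only [pairOp, ip_neg_left, mul_neg, neg_mul, labelPart, ip_neg_right]; module
  · rw [neg_snd, labelled_snd, labelled_snd, TensorProduct.neg_tmul]

/-- The off-diagonal entries are visible in the parameters. For the diagonal ones, evaluating the
operators at 1 and at L shows that both the difference and the sum of neighbouring entries vanish;
LQ is nonzero because L(LQ) = Q. -/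
theorem labelled_injective {Q : Oct 1} (hQ : Q ∈ labelSpan) (h0 : Q ≠ 0) :
    Function.Injective (labelled Q) := by
  change Function.Injective (labelledL hQ)
  refine (injective_iff_map_eq_zero _).2 fun P hP => ?_
  have hlQ : l * Q ≠ 0 := fun h => h0 (by rw [← l_mul_l_mul hQ, h, mul_zero])
  have h1 (n : Fin 3) : P.1 n (n + 1) = 0 := by
    have := congrArg (fun x : e8 => x.1.2 n) hP
    rwa [labelledL_apply, labelled_snd, zero_snd, tmul_eq_zero_iff h0] at this
  have h2 (n : Fin 3) : diagEntry P n = 0 := by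
    have hd (S : Oct 1) : pairOp Q (diagEntry P n) (diagEntry P (n + 1)) (diagEntry P (n + 2)) S =
        0 := by
      have := congrArg (fun x : e8 => x.1.1 n (S ⊗ₜ 1)) hP
      rw [labelledL_apply, labelled_fst hQ, zero_fst, LinearMap.zero_apply] at this
      by_contra hne
      have h := (tmul_eq_zero_iff hne).1 this
      have h' := ip_one_one
      rw [h, ip_zero_left] at h'
      exact zero_ne_one h'
    have e1 := hd 1
    have e2 := hd l
    rw [pairOp_one hQ] at e1
    rw [pairOp_l hQ, neg_eq_zero] at e2
    have e1 := (smul_eq_zero.1 e1).resolve_right h0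
    have e2 := (smul_eq_zero.1 e2).resolve_right hlQ
    linarith
  exact ext_entries (fun n => h2 n) h1

theorem D_tmul_eq_labelled {Q : Oct 1} (hQ : Q ∈ labelSpan) (r : ℝ) :
    D (Q ⊗ₜ (r • 1)) = labelled Q (ofEntries (r • ![1, -1, 0]) 0) := by
  refine ext_tmul (fun n S s => ?_) (fun n => by simp [labelled_snd])
  rw [pairOp_D Q hQ, labelled_fst hQ, TensorProduct.smul_tmul']
  congr 1
  simp only [diagEntry_ofEntries, Pi.smul_apply, smul_eq_mul, pairOp]; module

theorem E_tmul_eq_labelled {Q : Oct 1} (hQ : Q ∈ labelSpan) (r : ℝ) :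
    E (Q ⊗ₜ (r • 1)) = labelled Q (ofEntries (r • ![0, 1, -1]) 0) := by
  refine ext_tmul (fun n S s => ?_) (fun n => by simp [labelled_snd])
  rw [pairOp_E Q hQ, labelled_fst hQ, TensorProduct.smul_tmul']
  congr 1
  simp only [diagEntry_ofEntries, Pi.smul_apply, smul_eq_mul, pairOp]; module

theorem GS_eq_labelled {Q : Oct 1} (hQ : Q ∈ labelSpan) :
    GS Q = labelled Q (ofEntries (fun _ => -2) 0) := by
  refine ext_tmul (fun n S s => ?_) (fun n => by simp [labelled_snd])
  rw [GS_fst hQ, labelled_fst hQ, TensorProduct.smul_tmul']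
  congr 1
  simp only [diagEntry_ofEntries, pairOp]; module

theorem off_tmul_eq_labelled {Q : Oct 1} (hQ : Q ∈ labelSpan) (t : Fin 3) (p : Oct (-1)) :
    off t (Q ⊗ₜ p) = labelled Q (ofEntries 0 (Pi.single t p)) := by
  refine ext_tmul (fun n S s => ?_) (fun n => ?_)
  · rw [labelled_fst hQ]; simp [pairOp]
  · rw [labelled_snd, off_snd, ofEntries_apply, Pi.single_apply]
    split_ifs <;> simp

/-- The generators of H_Q are themselves values of the map, since D_Q, E_Q and G_Q correspond to the
diagonals (1, -1, 0), (0, 1, -1) and (-2, -2, -2), and these span all real diagonals. -/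
theorem range_labelledL {Q : Oct 1} (hQ : Q ∈ labelSpan) :
    LinearMap.range (labelledL hQ) = H Q := by
  apply le_antisymm
  · have hu (t : Fin 3) (n : Fin 8) : off t (Q ⊗ₜ basisUnit n) ∈ H Q := by
      refine Submodule.subset_span (Or.inl ?_)
      fin_cases t
      exacts [.inl (.inl ⟨n, rfl⟩), .inl (.inr ⟨n, rfl⟩), .inr ⟨n, rfl⟩]
    have hoff (t : Fin 3) (p : Oct (-1)) : off t (Q ⊗ₜ p) ∈ H Q :=
      off_one_tmul_mem_of_units (hu t) p
    have hD : D (Q ⊗ₜ 1) ∈ H Q := Submodule.subset_span (by simp)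
    have hS : S (Q ⊗ₜ 1) ∈ H Q := Submodule.subset_span (by simp)
    have hG : GS Q ∈ H Q := Submodule.subset_span (by simp)
    have hE : E (Q ⊗ₜ 1) ∈ H Q := by
      have h : E (Q ⊗ₜ 1) = (1 / 2 : ℝ) • (S (Q ⊗ₜ 1) - D (Q ⊗ₜ 1)) := by
        rw [S]; linear_combination (norm := module) (1 / 2 : ℝ) • D_add_E_add_F (Q ⊗ₜ 1)
      rw [h]; exact Submodule.smul_mem _ _ (sub_mem hS hD)
    have hD' := D_tmul_eq_labelled hQ 1
    have hE' := E_tmul_eq_labelled hQ 1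
    have hG' := GS_eq_labelled hQ
    rw [one_smul, one_smul] at hD' hE'
    rintro _ ⟨P, rfl⟩
    -- The coefficients solve the linear system for those three diagonals. The one of (-2, -2, -2)
    -- is minus a sixth of the trace, and the trace-free remainder fixes the other two.
    have key : P = ((2 * diagEntry P 0 - diagEntry P 1 - diagEntry P 2) / 3) •
          ofEntries ![1, -1, 0] 0 +
        ((diagEntry P 0 + diagEntry P 1 - 2 * diagEntry P 2) / 3) • ofEntries ![0, 1, -1] 0 +
        (-(diagEntry P 0 + diagEntry P 1 + diagEntry P 2) / 6) • ofEntries (fun _ => -2) 0 +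
        ∑ t, ofEntries 0 (Pi.single t (P.1 t (t + 1))) := by
      apply entriesEquiv.injective
      simp only [map_add, map_smul, map_sum]
      ext n
      · rw [Fin.sum_univ_three]
        fin_cases n <;> simp [entriesEquiv_apply] <;> ring
      · rw [Fin.sum_univ_three]
        fin_cases n <;> simp [entriesEquiv_apply]
    rw [key]
    simp only [map_add, map_smul, map_sum, labelledL_apply, ← hD', ← hE', ← hG',
      ← off_tmul_eq_labelled hQ]
    exact add_mem (add_mem (add_mem (Submodule.smul_mem _ _ hD) (Submodule.smul_mem _ _ hE))
      (Submodule.smul_mem _ _ hG)) (sum_mem fun t _ => hoff t _)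
  · have hD' := D_tmul_eq_labelled hQ 1
    have hE' := E_tmul_eq_labelled hQ 1
    rw [one_smul, one_smul] at hD' hE'
    have hoff (t : Fin 3) (p : Oct (-1)) : off t (Q ⊗ₜ p) ∈ LinearMap.range (labelledL hQ) :=
      ⟨_, (off_tmul_eq_labelled hQ t p).symm⟩
    have hD : D (Q ⊗ₜ 1) ∈ LinearMap.range (labelledL hQ) := ⟨_, hD'.symm⟩
    have hE : E (Q ⊗ₜ 1) ∈ LinearMap.range (labelledL hQ) := ⟨_, hE'.symm⟩
    have hF : F (Q ⊗ₜ 1) ∈ LinearMap.range (labelledL hQ) := by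
      rw [eq_neg_of_add_eq_zero_right (D_add_E_add_F (Q ⊗ₜ 1))]
      exact neg_mem (add_mem hD hE)
    refine Submodule.span_le.2 ?_
    rintro x (((⟨n, rfl⟩ | ⟨n, rfl⟩) | ⟨n, rfl⟩) | rfl | rfl | rfl)
    exacts [hoff _ _, hoff _ _, hoff _ _, hD, sub_mem hE hF, ⟨_, (GS_eq_labelled hQ).symm⟩]

theorem finrank_H {Q : Oct 1} (hQ : Q ∈ labelSpan) (h0 : Q ≠ 0) :
    Module.finrank ℝ (H Q) = 27 := by
  rw [← range_labelledL hQ, LinearMap.finrank_range_of_inj (labelled_injective hQ h0),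
    Albert.finrank_eq]

end e8

/-! ### The trace form of the Albert algebra. -/

namespace Albert
open Oct

theorem re_mul_comm (a b : Oct (-1)) : (a * b).1.re = (b * a).1.re := by
  obtain ⟨a0, a1, a2, a3, a4, a5, a6, a7, rfl⟩ := eq_co a
  obtain ⟨b0, b1, b2, b3, b4, b5, b6, b7, rfl⟩ := eq_co b
  simp only [co_mul, co_fst, mkq_re]; ring

/-- The associator of octonions is imaginary. Therefore Re tr is associative and symmetric on
octonionic matrices, which is all that adjoints for the trace form require. -/
theorem re_mul_assoc (a b c : Oct (-1)) : (a * b * c).1.re = (a * (b * c)).1.re := by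
  obtain ⟨a0, a1, a2, a3, a4, a5, a6, a7, rfl⟩ := eq_co a
  obtain ⟨b0, b1, b2, b3, b4, b5, b6, b7, rfl⟩ := eq_co b
  obtain ⟨c0, c1, c2, c3, c4, c5, c6, c7, rfl⟩ := eq_co c
  simp only [co_mul, co_fst, mkq_re]; ring

/-- The real part as a linear map. -/
def reL : Oct (-1) →ₗ[ℝ] ℝ where
  toFun a := a.1.re
  map_add' _ _ := rfl
  map_smul' _ _ := rfl

/-- The real part of the trace. -/
def reTr (M : Matrix (Fin 3) (Fin 3) (Oct (-1))) : ℝ := reL M.trace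

theorem reTr_mul (M N : Matrix (Fin 3) (Fin 3) (Oct (-1))) :
    reTr (M * N) = ∑ i, ∑ j, reL (M i j * N j i) := by
  simp only [reTr, Matrix.trace, Matrix.diag_apply, Matrix.mul_apply, map_sum]

theorem reTr_add (M N : Matrix (Fin 3) (Fin 3) (Oct (-1))) : reTr (M + N) = reTr M + reTr N := by
  rw [reTr, Matrix.trace_add, map_add]; rfl

theorem reTr_smul (r : ℝ) (M : Matrix (Fin 3) (Fin 3) (Oct (-1))) :
    reTr (r • M) = r * reTr M := by
  rw [reTr, Matrix.trace_smul, map_smul]; rfl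

theorem reTr_mul_comm (M N : Matrix (Fin 3) (Fin 3) (Oct (-1))) :
    reTr (M * N) = reTr (N * M) := by
  rw [reTr_mul, reTr_mul, Finset.sum_comm]
  exact Finset.sum_congr rfl fun i _ => Finset.sum_congr rfl fun j _ => re_mul_comm _ _

theorem reTr_mul_assoc (M N R : Matrix (Fin 3) (Fin 3) (Oct (-1))) :
    reTr (M * N * R) = reTr (M * (N * R)) := by
  rw [reTr_mul, reTr_mul]
  simp only [Matrix.mul_apply, Finset.sum_mul, Finset.mul_sum, map_sum]
  refine Finset.sum_congr rfl fun i _ => ?_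
  rw [Finset.sum_comm]
  exact Finset.sum_congr rfl fun j _ => Finset.sum_congr rfl fun k _ => re_mul_assoc _ _ _

/-- The trace form `(P, R) ↦ Re tr (P R)` of the Albert algebra. -/
def traceForm : LinearMap.BilinForm ℝ Albert :=
  LinearMap.mk₂ ℝ (fun P R => reTr (P.1 * R.1))
    (fun P P' R => by rw [← reTr_add, ← Matrix.add_mul]; rfl)
    (fun r P R => by rw [smul_eq_mul, ← reTr_smul, ← Matrix.smul_mul]; rfl)
    (fun P R R' => by rw [← reTr_add, ← Matrix.mul_add]; rfl)
    (fun r P R => by rw [smul_eq_mul, ← reTr_smul, ← Matrix.mul_smul]; rfl)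

theorem traceForm_apply (P R : Albert) : traceForm P R = reTr (P.1 * R.1) := rfl

theorem traceForm_act (M : Matrix (Fin 3) (Fin 3) (Oct (-1))) (P R : Albert) :
    traceForm (act M P) R = traceForm P (act Mᴴ R) := by
  change reTr ((M * P.1 + P.1 * Mᴴ) * R.1) = reTr (P.1 * (Mᴴ * R.1 + R.1 * Mᴴᴴ))
  rw [Matrix.conjTranspose_conjTranspose, Matrix.add_mul, Matrix.mul_add, reTr_add, reTr_add,
    reTr_mul_assoc M, reTr_mul_comm M, reTr_mul_assoc, reTr_mul_assoc, add_comm]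

/-- On Hermitian matrices Re tr(P²) is the sum of the norms of all entries, and the octonionic norm
is positive definite. -/
theorem eq_zero_of_traceForm_self {P : Albert} (h : traceForm P P = 0) : P = 0 := by
  have hterm (i j : Fin 3) : reL (P.1 i j * P.1 j i) = ip (P.1 i j) (P.1 i j) := by
    rw [← star_apply P i j]; rfl
  have hnn (p : Oct (-1)) : 0 ≤ ip p p := by
    obtain ⟨a0, a1, a2, a3, a4, a5, a6, a7, rfl⟩ := eq_co p
    rw [co_ip]
    nlinarith [sq_nonneg a0, sq_nonneg a1, sq_nonneg a2, sq_nonneg a3, sq_nonneg a4, sq_nonneg a5,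
      sq_nonneg a6, sq_nonneg a7]
  rw [traceForm_apply, reTr_mul] at h
  simp only [hterm] at h
  refine Subtype.ext (Matrix.ext fun i j => ip_self_eq_zero.1 ?_)
  have h1 := (Finset.sum_eq_zero_iff_of_nonneg fun i _ => Finset.sum_nonneg fun j _ => hnn _).1 h i
    (Finset.mem_univ _)
  exact (Finset.sum_eq_zero_iff_of_nonneg fun j _ => hnn _).1 h1 j (Finset.mem_univ _)

theorem traceForm_nondegenerate : traceForm.Nondegenerate :=
  ⟨fun _ h => eq_zero_of_traceForm_self (h _), fun _ h => eq_zero_of_traceForm_self (h _)⟩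

theorem act_neg (M : Matrix (Fin 3) (Fin 3) (Oct (-1))) : act (-M) = -act M := by
  refine LinearMap.ext fun P => Subtype.ext ?_
  change -M * P.1 + P.1 * (-M)ᴴ = -(M * P.1 + P.1 * Mᴴ)
  rw [Matrix.conjTranspose_neg, Matrix.neg_mul, Matrix.mul_neg, neg_add]

end Albert

/-! ### The common action of 𝔢₆ on the spaces H_Q. -/

namespace e8
open GMat Oct Albert

/-- The operator `T'` is minus the adjoint of `T` for the trace form. -/
def IsDualOp (T T' : Module.End ℝ Albert) : Prop :=
  ∀ P R, traceForm (T' P) R = -traceForm P (T R)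

/-- The element `x` of `𝔢₈` acts through `T` on the spaces `H_Q` with `LQ = Q`, and through `T'` on
those with `LQ = -Q`. -/
def ActsBy (x : e8) (T T' : Module.End ℝ Albert) : Prop :=
  ∀ Q ∈ labels, (l * Q = Q → ∀ P, ⁅x, labelled Q P⁆ = labelled Q (T P)) ∧
    (l * Q = -Q → ∀ P, ⁅x, labelled Q P⁆ = labelled Q (T' P))

theorem labelled_add {Q : Oct 1} (hQ : Q ∈ labels) (P R : Albert) :
    labelled Q (P + R) = labelled Q P + labelled Q R :=
  map_add (labelledL (mem_labelSpan_of_mem_labels hQ)) P R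
theorem labelled_smul {Q : Oct 1} (hQ : Q ∈ labels) (r : ℝ) (P : Albert) :
    labelled Q (r • P) = r • labelled Q P :=
  map_smul (labelledL (mem_labelSpan_of_mem_labels hQ)) r P
theorem labelled_sub {Q : Oct 1} (hQ : Q ∈ labels) (P R : Albert) :
    labelled Q (P - R) = labelled Q P - labelled Q R :=
  map_sub (labelledL (mem_labelSpan_of_mem_labels hQ)) P R
theorem labelled_zero {Q : Oct 1} (hQ : Q ∈ labels) : labelled Q 0 = 0 :=
  map_zero (labelledL (mem_labelSpan_of_mem_labels hQ))
theorem labelled_neg {Q : Oct 1} (hQ : Q ∈ labels) (P : Albert) :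
    labelled Q (-P) = -labelled Q P :=
  map_neg (labelledL (mem_labelSpan_of_mem_labels hQ)) P

theorem ActsBy.add {x y : e8} {T T' U U' : Module.End ℝ Albert} (hx : ActsBy x T T')
    (hy : ActsBy y U U') : ActsBy (x + y) (T + U) (T' + U') := fun Q hQ =>
  ⟨fun h P => by
    rw [add_lie, (hx Q hQ).1 h, (hy Q hQ).1 h, LinearMap.add_apply, labelled_add hQ],
   fun h P => by
    rw [add_lie, (hx Q hQ).2 h, (hy Q hQ).2 h, LinearMap.add_apply, labelled_add hQ]⟩

theorem ActsBy.smul (r : ℝ) {x : e8} {T T' : Module.End ℝ Albert} (hx : ActsBy x T T') :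
    ActsBy (r • x) (r • T) (r • T') := fun Q hQ =>
  ⟨fun h P => by
    rw [smul_lie, (hx Q hQ).1 h, LinearMap.smul_apply, labelled_smul hQ],
   fun h P => by
    rw [smul_lie, (hx Q hQ).2 h, LinearMap.smul_apply, labelled_smul hQ]⟩

theorem ActsBy.lie {x y : e8} {T T' U U' : Module.End ℝ Albert} (hx : ActsBy x T T')
    (hy : ActsBy y U U') : ActsBy ⁅x, y⁆ ⁅T, U⁆ ⁅T', U'⁆ := fun Q hQ =>
  ⟨fun h P => by
    rw [lie_lie, (hy Q hQ).1 h, (hx Q hQ).1 h, (hx Q hQ).1 h, (hy Q hQ).1 h, ← labelled_sub hQ]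
    rfl,
   fun h P => by
    rw [lie_lie, (hy Q hQ).2 h, (hx Q hQ).2 h, (hx Q hQ).2 h, (hy Q hQ).2 h, ← labelled_sub hQ]
    rfl⟩

theorem IsDualOp.lie {T T' U U' : Module.End ℝ Albert} (hT : IsDualOp T T')
    (hU : IsDualOp U U') : IsDualOp ⁅T, U⁆ ⁅T', U'⁆ := fun P R => by
  change traceForm (T' (U' P) - U' (T' P)) R = -traceForm P (T (U R) - U (T R))
  rw [map_sub, LinearMap.sub_apply, map_sub, hT, hU, hU, hT]; ring

/-- The elements of `𝔢₈` that act on all spaces `H_Q` through an element of `𝔰𝔩(3, 𝕆)` or its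
dual. -/
def actingSubalgebra : LieSubalgebra ℝ e8 where
  carrier := {x | ∃ T ∈ sl3O, ∃ T', IsDualOp T T' ∧ ActsBy x T T'}
  zero_mem' := ⟨0, zero_mem _, 0, fun P R => by simp, fun Q hQ =>
    ⟨fun _ P => by rw [zero_lie, LinearMap.zero_apply, labelled_zero hQ],
     fun _ P => by rw [zero_lie, LinearMap.zero_apply, labelled_zero hQ]⟩⟩
  add_mem' := by
    rintro x y ⟨T, hT, T', hd, hx⟩ ⟨U, hU, U', hd', hy⟩
    refine ⟨T + U, add_mem hT hU, T' + U', fun P R => ?_, hx.add hy⟩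
    rw [LinearMap.add_apply, LinearMap.add_apply, map_add, LinearMap.add_apply, map_add, hd, hd']
    ring
  smul_mem' := by
    rintro r x ⟨T, hT, T', hd, hx⟩
    refine ⟨r • T, sl3O.smul_mem r hT, r • T', fun P R => ?_, hx.smul r⟩
    rw [LinearMap.smul_apply, LinearMap.smul_apply, map_smul, LinearMap.smul_apply, map_smul, hd,
      smul_neg]
  lie_mem' := by
    rintro x y ⟨T, hT, T', hd, hx⟩ ⟨U, hU, U', hd', hy⟩
    exact ⟨⁅T, U⁆, sl3O.lie_mem hT hU, ⁅T', U'⁆, hd.lie hd', hx.lie hy⟩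

theorem rotation_actsBy {M : Matrix (Fin 3) (Fin 3) (Oct (-1))} (hM : Mᴴ = -M) (h0 : M.trace = 0) :
    ActsBy (rotation M) (act M) (act M) := fun _ hQ =>
  ⟨fun _ => lie_rotation_labelled (mem_labelSpan_of_mem_labels hQ) hM h0,
   fun _ => lie_rotation_labelled (mem_labelSpan_of_mem_labels hQ) hM h0⟩

/-- The bracket carries the label LQ, and for LQ = -Q the sign moves from the label to the operator.
-/
theorem boost_actsBy {M : Matrix (Fin 3) (Fin 3) (Oct (-1))} (hM : Mᴴ = M) (h0 : M.trace = 0) :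
    ActsBy (boost M) (act M) (-act M) := fun Q hQ =>
  have hQ' := mem_labelSpan_of_mem_labels hQ
  ⟨fun h P => by rw [lie_boost_labelled hQ' hM h0, h],
   fun h P => by
    rw [lie_boost_labelled hQ' hM h0, h, labelled_neg_label hQ', ← labelled_neg hQ]; rfl⟩

theorem act_rotation_mem {M : Matrix (Fin 3) (Fin 3) (Oct (-1))} (hM : Mᴴ = -M)
    (h0 : M.trace = 0) : act M ∈ sl3O :=
  LieSubalgebra.subset_lieSpan ⟨M, h0, .inl hM, rfl⟩

theorem act_boost_mem {M : Matrix (Fin 3) (Fin 3) (Oct (-1))} (hM : Mᴴ = M)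
    (h0 : M.trace = 0) : act M ∈ sl3O :=
  LieSubalgebra.subset_lieSpan ⟨M, h0, .inr hM, rfl⟩

/-- The adjoint of `act M` is `act Mᴴ`. Rotations are skew, hence equal to their own dual operators;
boosts, treated next, are symmetric, and their dual operators are their negatives. -/
theorem rotation_mem_acting {M : Matrix (Fin 3) (Fin 3) (Oct (-1))} (hM : Mᴴ = -M)
    (h0 : M.trace = 0) : rotation M ∈ actingSubalgebra :=
  ⟨act M, act_rotation_mem hM h0, act M,
    fun P R => by rw [traceForm_act, hM, act_neg, LinearMap.neg_apply, map_neg],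
    rotation_actsBy hM h0⟩

theorem boost_mem_acting {M : Matrix (Fin 3) (Fin 3) (Oct (-1))} (hM : Mᴴ = M)
    (h0 : M.trace = 0) : boost M ∈ actingSubalgebra :=
  ⟨act M, act_boost_mem hM h0, -act M,
    fun P R => by
      rw [LinearMap.neg_apply, map_neg, LinearMap.neg_apply, traceForm_act, hM],
    boost_actsBy hM h0⟩

theorem off_one_eq_rotation (t : Fin 3) (p : Oct (-1)) :
    ∃ M : Matrix (Fin 3) (Fin 3) (Oct (-1)), Mᴴ = -M ∧ M.trace = 0 ∧
      off t (1 ⊗ₜ p) = rotation M := by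
  have h1 : t ≠ t + 1 := by revert t; decide
  have hM : (Matrix.single t (t + 1) p - Matrix.single (t + 1) t (star p))ᴴ =
      -(Matrix.single t (t + 1) p - Matrix.single (t + 1) t (star p)) := by
    rw [Matrix.conjTranspose_sub, Matrix.conjTranspose_single, Matrix.conjTranspose_single,
      star_star, neg_sub]
  have h0 : (Matrix.single t (t + 1) p - Matrix.single (t + 1) t (star p)).trace = 0 := by
    rw [Matrix.trace_sub, Matrix.trace_single_eq_of_ne _ _ _ h1,
      Matrix.trace_single_eq_of_ne _ _ _ h1.symm, sub_zero]
  refine ⟨_, hM, h0, ext_tmul (fun n S s => ?_) (fun n => ?_)⟩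
  · rw [rotation_fst hM h0]
    fin_cases t <;> fin_cases n <;> simp [Matrix.single_apply]
  · rw [rotation_snd, off_snd]
    fin_cases t <;> fin_cases n <;> simp [Matrix.single_apply]

theorem off_l_eq_boost (t : Fin 3) (p : Oct (-1)) :
    ∃ M : Matrix (Fin 3) (Fin 3) (Oct (-1)), Mᴴ = M ∧ M.trace = 0 ∧
      off t (l ⊗ₜ p) = boost M := by
  have h1 : t ≠ t + 1 := by revert t; decide
  have hM : (Matrix.single t (t + 1) p + Matrix.single (t + 1) t (star p))ᴴ =
      (Matrix.single t (t + 1) p + Matrix.single (t + 1) t (star p)) := by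
    rw [Matrix.conjTranspose_add, Matrix.conjTranspose_single, Matrix.conjTranspose_single,
      star_star, add_comm]
  have h0 : (Matrix.single t (t + 1) p + Matrix.single (t + 1) t (star p)).trace = 0 := by
    rw [Matrix.trace_add, Matrix.trace_single_eq_of_ne _ _ _ h1,
      Matrix.trace_single_eq_of_ne _ _ _ h1.symm, add_zero]
  refine ⟨_, hM, h0, ext_tmul (fun n S s => ?_) (fun n => ?_)⟩
  · rw [boost_fst hM h0]
    fin_cases t <;> fin_cases n <;> simp [Matrix.single_apply]
  · rw [boost_snd, off_snd]
    fin_cases t <;> fin_cases n <;> simp [Matrix.single_apply]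

/-- Not every element of 𝔢₆ is an ordinary matrix: A_p and G_p are genuinely nested. They are
reached only because the acting elements form a Lie subalgebra containing the off-diagonal
generators. -/
theorem e6_le_acting : e6 ≤ actingSubalgebra := by
  refine e6_le (fun t p => ?_) (fun t p => ?_)
  · obtain ⟨M, hM, h0, h⟩ := off_one_eq_rotation t p
    rw [h]; exact rotation_mem_acting hM h0
  · obtain ⟨M, hM, h0, h⟩ := off_l_eq_boost t p
    rw [h]; exact boost_mem_acting hM h0

theorem ofMatrix_mulLabel_mem {R : Oct 1} (hR : ∀ p, R ⊗ₜ p ∈ BiOct.splitComplex)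
    (M : Matrix (Fin 3) (Fin 3) (Oct (-1))) : ofMatrix (mulLabel R M) ∈ e6 := by
  rw [e6_eq_su3]
  have h1 (t : Fin 3) := off_mem_su3 t (BiOct.one_tmul_mem 1)
  have hl (t : Fin 3) (p : Oct (-1)) : (1 / 2 : ℝ) • ⁅off t (1 ⊗ₜ 1), off t (R ⊗ₜ p)⁆ ∈ su3 :=
    su3.smul_mem _ (su3.lie_mem (h1 t) (off_mem_su3 t (hR p)))
  exact sub_mem (add_mem (add_mem (add_mem (off_mem_su3 _ (hR _)) (off_mem_su3 _ (hR _)))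
    (off_mem_su3 _ (hR _))) (hl _ _)) (hl _ _)

theorem rotation_mem (M : Matrix (Fin 3) (Fin 3) (Oct (-1))) : rotation M ∈ e6 :=
  ofMatrix_mulLabel_mem BiOct.one_tmul_mem M

theorem boost_mem (M : Matrix (Fin 3) (Fin 3) (Oct (-1))) : boost M ∈ e6 :=
  ofMatrix_mulLabel_mem BiOct.l_tmul_mem M

/-- The null label `(I - IL) / 2`. -/
def plusLabel : Oct 1 := co 0 (1 / 2) 0 0 0 (-1 / 2) 0 0

theorem plusLabel_mem : plusLabel ∈ labels := mem_labels.2 (.inr (.inl rfl))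
theorem l_mul_plusLabel : l * plusLabel = plusLabel := by
  rw [plusLabel, l_mul_co]; apply co_congr <;> norm_num

/-- One label with LQ = Q already determines the operator, because 𝓟 ↦ Q𝓟 is injective. -/
theorem ActsBy.ext {x : e8} {T T' U U' : Module.End ℝ Albert} (h : ActsBy x T T')
    (h' : ActsBy x U U') : T = U := by
  refine LinearMap.ext fun P => labelled_injective
    (mem_labelSpan_of_mem_labels plusLabel_mem) (label_ne_zero plusLabel_mem) ?_
  rw [← (h _ plusLabel_mem).1 l_mul_plusLabel, (h' _ plusLabel_mem).1 l_mul_plusLabel]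

theorem exists_actsBy (x : e6) : ∃ T ∈ sl3O, ∃ T', IsDualOp T T' ∧ ActsBy (x : e8) T T' :=
  e6_le_acting x.2

end e8

/-! ### Equivalence of submodules through operators and eigenvectors. -/

namespace LieSubmodule
variable {R L M A : Type*} [CommRing R] [LieRing L] [AddCommGroup M] [Module R M]
  [LieRingModule L M] [AddCommGroup A] [Module R A]

/-- Two submodules that are parametrised by the same space, with the same operators, are
equivalent. -/
theorem nonempty_equiv_of_operators {N N' : LieSubmodule R L M} {f g : A →ₗ[R] M}
    (hf : Function.Injective f) (hg : Function.Injective g)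
    (hN : LinearMap.range f = N.toSubmodule) (hN' : LinearMap.range g = N'.toSubmodule)
    (h : ∀ x : L, ∃ T : A → A, ∀ a, ⁅x, f a⁆ = f (T a) ∧ ⁅x, g a⁆ = g (T a)) :
    Nonempty (N ≃ₗ⁅R,L⁆ N') := by
  have hex {N : LieSubmodule R L M} {f : A →ₗ[R] M} (hf : Function.Injective f)
      (hN : LinearMap.range f = N.toSubmodule) : ∃ φ : A ≃ₗ[R] N, ∀ a, (φ a : M) = f a :=
    ⟨(LinearEquiv.ofInjective f hf).trans (LinearEquiv.ofEq _ _ hN), fun _ => rfl⟩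
  obtain ⟨φ, hφ⟩ := hex hf hN
  obtain ⟨ψ, hψ⟩ := hex hg hN'
  let e : N ≃ₗ[R] N' := φ.symm.trans ψ
  have hlie (x : L) (m : N) : e ⁅x, m⁆ = ⁅x, e m⁆ := by
    obtain ⟨a, rfl⟩ := φ.surjective m
    obtain ⟨T, hT⟩ := h x
    have h1 : ⁅x, φ a⁆ = φ (T a) := Subtype.ext (by
      rw [hφ, LieSubmodule.coe_bracket, hφ]; exact (hT a).1)
    have h2 : ⁅x, ψ a⁆ = ψ (T a) := Subtype.ext (by
      rw [hψ, LieSubmodule.coe_bracket, hψ]; exact (hT a).2)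
    rw [h1]
    simp only [e, LinearEquiv.trans_apply, LinearEquiv.symm_apply_apply, h2]
  exact ⟨{ e with map_lie' := hlie _ _ }⟩

theorem exists_eigenvector_of_equiv {N N' : LieSubmodule R L M} (e : N ≃ₗ⁅R,L⁆ N') {x : L} {r : R}
    {m : M} (hm : m ∈ N) (h0 : m ≠ 0) (h : ⁅x, m⁆ = r • m) :
    ∃ m' ∈ N', m' ≠ 0 ∧ ⁅x, m'⁆ = r • m' := by
  let y : N := ⟨m, hm⟩
  have hy : ⁅x, y⁆ = r • y := Subtype.ext h
  refine ⟨e y, (e y).2, fun he => h0 ?_, ?_⟩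
  · have : y = 0 := e.injective (by rw [map_zero]; exact Subtype.ext he)
    exact congrArg Subtype.val this
  · have h1 : ⁅x, e y⁆ = r • e y := by
      rw [← map_smul, ← hy]; exact (e.toLieModuleHom.map_lie x y).symm
    exact congrArg Subtype.val h1

theorem nonempty_equiv_symm {N N' : LieSubmodule R L M} (h : Nonempty (N ≃ₗ⁅R,L⁆ N')) :
    Nonempty (N' ≃ₗ⁅R,L⁆ N) :=
  h.map LieModuleEquiv.symm

end LieSubmodule

/-! ### Faithfulness, the isomorphism with 𝔰𝔩(3, 𝕆), and (in)equivalence of the H_Q. -/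

namespace e8
open GMat Oct Albert

/-- A description of the elements of `𝔢₆`: their off-diagonal parameters are defined over the span
of `1` and `L`, and their diagonal part acts on each parameter through a skew operator on `𝕆` and
multiplications by `L` on `𝕆'`. -/
def IsRotationBoost (x : e8) : Prop :=
  ∃ (T : Fin 3 → Oct (-1) → Oct (-1)) (β : Fin 3 → ℝ) (u v : Fin 3 → Oct (-1)),
    (∀ i s, ip s (T i s) = 0) ∧ (∀ i, β i + β (i + 1) + β (i + 2) = 0) ∧
    (∀ i S s, x.1.1 i (S ⊗ₜ s) =
      S ⊗ₜ T i s + (β i • (l * S) - β (i + 1) • (S * l)) ⊗ₜ s) ∧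
    ∀ i, x.1.2 i = 1 ⊗ₜ u i + l ⊗ₜ v i

theorem isRotationBoost_off {t : Fin 3} {c : BiOct} (hc : c ∈ BiOct.splitComplex) :
    IsRotationBoost (off t c) := by
  obtain ⟨p, q, rfl⟩ := BiOct.mem_splitComplex.1 hc
  refine ⟨0, 0, Pi.single t p, Pi.single t q, fun i s => ip_zero_right s, fun i => by simp,
    fun i S s => by simp, fun i => ?_⟩
  rw [off_snd, Pi.single_apply, Pi.single_apply]
  split_ifs <;> simp

theorem isRotationBoost_lie_off_one (t : Fin 3) (p q : Oct (-1)) :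
    IsRotationBoost ⁅off t (1 ⊗ₜ p), off t (1 ⊗ₜ q)⁆ := by
  refine ⟨fun i s => tri t p q i s, 0, 0, 0, fun i s => ip_tri_self .., fun i => by simp,
    fun i S s => ?_, fun i => by rw [lie_off_off_snd]; simp⟩
  rw [lie_off_off_fst, BiOct.nested_tmul, ip_one_one', tri_self]
  simp

/-- The off-diagonal matrices of type t with parameters 1 and L have as bracket twice the diagonal
boost with 1 in place t and -1 in place t + 1; the coefficients are those of β at i and i + 1. -/
theorem tri_one_l (t i : Fin 3) (S : Oct 1) : tri t 1 l i S =
    (if i = t then 2 else if i = t + 1 then -2 else 0 : ℝ) • (l * S) -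
      (if i + 1 = t then 2 else if i + 1 = t + 1 then -2 else 0 : ℝ) • (S * l) := by
  fin_cases t <;> fin_cases i <;>
    simp [tri, own_apply, next_apply, prev_apply, star_l] <;> module

theorem isRotationBoost_lie_off_l (t : Fin 3) :
    IsRotationBoost ⁅off t (1 ⊗ₜ 1), off t (l ⊗ₜ 1)⁆ := by
  refine ⟨0, fun i => if i = t then 2 else if i = t + 1 then -2 else 0, 0, 0,
    fun i s => ip_zero_right s, fun i => ?_, fun i S s => ?_,
    fun i => by rw [lie_off_off_snd]; simp⟩
  · fin_cases t <;> fin_cases i <;> simp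
  · rw [lie_off_off_fst, BiOct.nested_tmul, ip_one_l, ip_one_one, tri_one_l]; simp

/-- The elements described by `IsRotationBoost` form a subspace. -/
def rotationBoosts : Submodule ℝ e8 where
  carrier := {x | IsRotationBoost x}
  zero_mem' := ⟨0, 0, 0, 0, fun i s => ip_zero_right s, fun i => by simp, fun i S s => by simp,
    fun i => by simp⟩
  add_mem' := by
    rintro x y ⟨T, β, u, v, h1, h2, h3, h4⟩ ⟨T', β', u', v', h1', h2', h3', h4'⟩
    refine ⟨T + T', β + β', u + u', v + v', fun i s => ?_, fun i => ?_, fun i S s => ?_,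
      fun i => ?_⟩
    · rw [Pi.add_apply, Pi.add_apply, ip_add_right, h1, h1', add_zero]
    · simp only [Pi.add_apply]; linear_combination h2 i + h2' i
    · rw [add_fst, LinearMap.add_apply, h3, h3']
      simp only [Pi.add_apply, TensorProduct.tmul_add, TensorProduct.sub_tmul,
        ← TensorProduct.smul_tmul']
      module
    · rw [add_snd, h4, h4']
      simp only [Pi.add_apply, TensorProduct.tmul_add]; abel
  smul_mem' := by
    rintro r x ⟨T, β, u, v, h1, h2, h3, h4⟩
    refine ⟨r • T, r • β, r • u, r • v, fun i s => ?_, fun i => ?_, fun i S s => ?_, fun i => ?_⟩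
    · rw [Pi.smul_apply, Pi.smul_apply, ip_smul_right, h1, mul_zero]
    · simp only [Pi.smul_apply, smul_eq_mul]; linear_combination r * h2 i
    · rw [smul_fst, LinearMap.smul_apply, h3]
      simp only [Pi.smul_apply, TensorProduct.tmul_smul, TensorProduct.sub_tmul,
        ← TensorProduct.smul_tmul', smul_eq_mul]
      module
    · rw [smul_snd, h4]
      simp only [Pi.smul_apply, TensorProduct.tmul_smul, smul_add]

theorem isRotationBoost_of_mem {x : e8} (hx : x ∈ e6) : IsRotationBoost x := by
  rw [e6_eq_su3] at hx
  exact su3_le (W := rotationBoosts) (fun t p => isRotationBoost_off (BiOct.one_tmul_mem p))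
    (fun t p => isRotationBoost_off (BiOct.l_tmul_mem p)) isRotationBoost_lie_off_one
    isRotationBoost_lie_off_l hx

/-- Bracketing with diagonal 𝓟 detects the off-diagonal parameters of x. Once these vanish,
off-diagonal 𝓟 see a skew operator plus a real scalar, which must vanish separately. -/
theorem eq_zero_of_lie_labelled {Q : Oct 1} (hQ : Q ∈ labels) (hlQ : l * Q = Q) {x : e8}
    (hx : x ∈ e6) (h : ∀ P, ⁅x, labelled Q P⁆ = 0) : x = 0 := by
  have hQ' := mem_labelSpan_of_mem_labels hQ
  have h0 := label_ne_zero hQ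
  obtain ⟨T, β, u, v, h1, h2, h3, h4⟩ := isRotationBoost_of_mem hx
  have hd (a : Fin 3 → ℝ) (n : Fin 3) : (a n - a (n + 1)) • u n - (a n + a (n + 1)) • v n = 0 := by
    have e := congrArg (fun y : e8 => y.1.2 n) (h (ofEntries a 0))
    simp only [lie_snd, labelled_snd, ofEntries_apply, Pi.zero_apply, TensorProduct.tmul_zero,
      map_zero, h4, mul_zero, zero_mul, star_zero, zero_snd, map_add, labelled_fst hQ',
      diagEntry_ofEntries, pairOp_one hQ', pairOp_l hQ', hlQ] at e
    rw [← tmul_eq_zero_iff h0, ← neg_eq_zero, ← e]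
    simp only [TensorProduct.tmul_sub, TensorProduct.tmul_smul, TensorProduct.neg_tmul,
      ← TensorProduct.smul_tmul']
    module
  have hv (n : Fin 3) : v n = 0 := by
    -- The identity matrix has equal diagonal entries and isolates v; afterwards a single diagonal
    -- unit isolates u.
    have e := hd (fun _ => 1) n
    rw [sub_self, zero_smul, zero_sub, neg_eq_zero] at e
    exact (smul_eq_zero.1 e).resolve_left (by norm_num)
  have hu (n : Fin 3) : u n = 0 := by
    have hn : n + 1 ≠ n := by revert n; decide
    have e := hd (Pi.single n 1) n
    rw [hv, Pi.single_eq_same, Pi.single_eq_of_ne hn] at e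
    simpa using e
  have hx0 (i : Fin 3) : x.1.2 i = 0 := by rw [h4, hu, hv]; simp
  have hT (t : Fin 3) (p : Oct (-1)) : T t p + (β t + β (t + 1)) • p = 0 := by
    have e := h (ofEntries 0 (Pi.single t p))
    rw [← off_tmul_eq_labelled hQ', lie_diag_off hx0] at e
    have e := congrArg (fun y : e8 => y.1.2 t) e
    simp only [off_snd, if_true, zero_snd, h3, mul_l_eq hQ', hlQ] at e
    rw [← tmul_eq_zero_iff h0, ← e]
    simp only [TensorProduct.tmul_add, TensorProduct.tmul_smul, TensorProduct.sub_tmul,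
      TensorProduct.neg_tmul, ← TensorProduct.smul_tmul']
    module
  have hβ2 (t : Fin 3) : β t + β (t + 1) = 0 := by
    -- Pairing with 1 removes the skew operator and leaves the scalar. With the condition that the β
    -- sum to zero, the vanishing of neighbouring sums makes every β zero.
    have e := congrArg (ip (1 : Oct (-1))) (hT t 1)
    rwa [ip_add_right, h1, ip_smul_right, ip_one_one, ip_zero_right, zero_add, mul_one] at e
  have hβ (t : Fin 3) : β t = 0 := by
    have e1 := h2 t
    have e2 := hβ2 (t + 1)
    rw [add1] at e2
    linarith
  have hT0 (t : Fin 3) (p : Oct (-1)) : T t p = 0 := by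
    have := hT t p
    rwa [hβ2, zero_smul, add_zero] at this
  exact ext_tmul (fun i S s => by rw [h3, hT0, hβ, hβ]; simp) hx0

/-- The operator on the Albert algebra through which an element of `𝔢₆` acts. -/
def operator (x : e6) : Module.End ℝ Albert := (exists_actsBy x).choose

theorem operator_mem (x : e6) : operator x ∈ sl3O := (exists_actsBy x).choose_spec.1

theorem exists_isDualOp_actsBy (x : e6) :
    ∃ T', IsDualOp (operator x) T' ∧ ActsBy (x : e8) (operator x) T' :=
  (exists_actsBy x).choose_spec.2

/-- The operator is obtained by choice. This uniqueness makes it additive, homogeneous and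
compatible with brackets, and identifies it on rotations and boosts. -/
theorem operator_eq {x : e6} {T T' : Module.End ℝ Albert} (h : ActsBy (x : e8) T T') :
    operator x = T := by
  obtain ⟨U', -, hU⟩ := exists_isDualOp_actsBy x
  exact hU.ext h

/-- The homomorphism from `𝔢₆` to `𝔰𝔩(3, 𝕆)`. -/
def toSl3O : e6 →ₗ⁅ℝ⁆ sl3O where
  toFun x := ⟨operator x, operator_mem x⟩
  map_add' x y := by
    obtain ⟨T', -, hT⟩ := exists_isDualOp_actsBy x
    obtain ⟨U', -, hU⟩ := exists_isDualOp_actsBy y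
    exact Subtype.ext (operator_eq (hT.add hU))
  map_smul' r x := by
    obtain ⟨T', -, hT⟩ := exists_isDualOp_actsBy x
    exact Subtype.ext (operator_eq (hT.smul r))
  map_lie' := by
    intro x y
    obtain ⟨T', -, hT⟩ := exists_isDualOp_actsBy x
    obtain ⟨U', -, hU⟩ := exists_isDualOp_actsBy y
    exact Subtype.ext (operator_eq (hT.lie hU))

theorem coe_toSl3O (x : e6) : (toSl3O x : Module.End ℝ Albert) = operator x := rfl

theorem toSl3O_injective : Function.Injective toSl3O := by
  refine (injective_iff_map_eq_zero toSl3O).2 fun x hx => Subtype.ext ?_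
  obtain ⟨T', -, hT⟩ := exists_isDualOp_actsBy x
  refine eq_zero_of_lie_labelled plusLabel_mem l_mul_plusLabel x.2 fun P => ?_
  rw [(hT _ plusLabel_mem).1 l_mul_plusLabel, ← coe_toSl3O, hx]
  exact labelled_zero plusLabel_mem

theorem toSl3O_surjective : Function.Surjective toSl3O := by
  have h : sl3O ≤ (sl3O.incl.comp toSl3O).range := by
    refine LieSubalgebra.lieSpan_le.2 ?_
    rintro _ ⟨M, h0, hM | hM, rfl⟩
    · exact ⟨⟨_, rotation_mem M⟩, operator_eq (rotation_actsBy hM h0)⟩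
    · exact ⟨⟨_, boost_mem M⟩, operator_eq (boost_actsBy hM h0)⟩
  rintro ⟨T, hT⟩
  obtain ⟨x, hx⟩ := h hT
  exact ⟨x, Subtype.ext hx⟩

/-- The isomorphism from `𝔢₆` to `𝔰𝔩(3, 𝕆)`. -/
def equivSl3O : e6 ≃ₗ⁅ℝ⁆ sl3O :=
  LieEquiv.ofBijective toSl3O ⟨toSl3O_injective, toSl3O_surjective⟩

/-- The representation of `𝔢₆` generated by `H_Q`. -/
def labelModule (Q : Oct 1) : LieSubmodule ℝ e6 e8 := LieSubmodule.lieSpan ℝ e6 (H Q : Set e8)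

theorem lie_mem_H {Q : Oct 1} (hQ : Q ∈ labels) (x : e6) {y : e8} (hy : y ∈ H Q) :
    ⁅(x : e8), y⁆ ∈ H Q := by
  rw [← range_labelledL (mem_labelSpan_of_mem_labels hQ)] at hy ⊢
  obtain ⟨P, rfl⟩ := hy
  obtain ⟨T', -, hT⟩ := exists_isDualOp_actsBy x
  rw [labelledL_apply]
  rcases l_mul_label hQ with h | h
  · exact ⟨_, ((hT Q hQ).1 h P).symm⟩
  · exact ⟨_, ((hT Q hQ).2 h P).symm⟩

/-- For a label, H_Q is already stable, so generating adds nothing. The generated submodule serves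
to define a representation for every Q without a side condition. -/
theorem labelModule_toSubmodule {Q : Oct 1} (hQ : Q ∈ labels) :
    (labelModule Q).toSubmodule = H Q :=
  LieSubmodule.coe_lieSpan_submodule_eq_iff.2
    ⟨{ H Q with lie_mem := fun {x _} hm => lie_mem_H hQ x hm }, rfl⟩

/-- The dual of the Albert algebra, embedded as `H_Q`. -/
def dualLabelledL {Q : Oct 1} (hQ : Q ∈ labelSpan) : Module.Dual ℝ Albert →ₗ[ℝ] e8 :=
  labelledL hQ ∘ₗ (LinearMap.BilinForm.toDual traceForm traceForm_nondegenerate).symm.toLinearMap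

theorem dualLabelledL_injective {Q : Oct 1} (hQ : Q ∈ labelSpan) (h0 : Q ≠ 0) :
    Function.Injective (dualLabelledL hQ) :=
  (labelled_injective hQ h0).comp (LinearEquiv.injective _)

theorem range_dualLabelledL {Q : Oct 1} (hQ : Q ∈ labelSpan) :
    LinearMap.range (dualLabelledL hQ) = H Q := by
  rw [dualLabelledL, LinearMap.range_comp_of_range_eq_top _ (LinearEquiv.range _),
    range_labelledL]

/-- Under the identification of functionals with elements of the Albert algebra by the trace form,
the dual action f ↦ -f ∘ T becomes minus the adjoint of T, and that is the operator by which x acts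
when LQ = -Q. -/
theorem lie_dualLabelledL {Q : Oct 1} (hQ : Q ∈ labels) (h : l * Q = -Q) (x : e6)
    (f : Module.Dual ℝ Albert) :
    ⁅(x : e8), dualLabelledL (mem_labelSpan_of_mem_labels hQ) f⁆ =
      dualLabelledL (mem_labelSpan_of_mem_labels hQ) (-(f ∘ₗ operator x)) := by
  obtain ⟨T', hd, hT⟩ := exists_isDualOp_actsBy x
  obtain ⟨P, rfl⟩ := (LinearMap.BilinForm.toDual traceForm traceForm_nondegenerate).surjective f
  have key : -(LinearMap.BilinForm.toDual traceForm traceForm_nondegenerate P ∘ₗ operator x) =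
      LinearMap.BilinForm.toDual traceForm traceForm_nondegenerate (T' P) :=
    LinearMap.ext fun R => (hd P R).symm
  rw [key]
  simp only [dualLabelledL, LinearMap.comp_apply, LinearEquiv.coe_coe,
    LinearEquiv.symm_apply_apply, labelledL_apply]
  exact (hT Q hQ).2 h P

/-- An equivalence preserves the eigenvalues of each element of 𝔢₆, and those of one diagonal boost
already tell the two signs apart. -/
theorem isEmpty_equiv_of_signs {Q R : Oct 1} (hQ : Q ∈ labels) (hR : R ∈ labels)
    {N N' : LieSubmodule ℝ e6 e8} (hN : N.toSubmodule = H Q) (hN' : N'.toSubmodule = H R)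
    (h : l * Q = Q) (h' : l * R = -R) : IsEmpty (N ≃ₗ⁅ℝ,e6⁆ N') := by
  refine ⟨fun e => ?_⟩
  have hQ' := mem_labelSpan_of_mem_labels hQ
  have hR' := mem_labelSpan_of_mem_labels hR
  -- The boost scales the (m, n) entry by a m + a n, so the eigenvalues 2, -1, -4 are not symmetric
  -- about zero: -4 occurs and 4 does not.
  let a : Fin 3 → ℝ := ![1, 1, -2]
  let M : Matrix (Fin 3) (Fin 3) (Oct (-1)) := Matrix.diagonal fun n => a n • 1
  have hM : Mᴴ = M := by
    rw [Matrix.diagonal_conjTranspose]; congr 1; funext n; simp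
  have h0 : M.trace = 0 := by
    rw [Matrix.trace_diagonal, Fin.sum_univ_three]; simp [a]; module
  have hentry (P : Albert) (m n : Fin 3) : (act M P).1 m n = (a m + a n) • P.1 m n := by
    have hMn (m n : Fin 3) : M m n = if m = n then a m • 1 else 0 := Matrix.diagonal_apply ..
    rw [act_apply]
    simp only [hMn, Finset.sum_add_distrib, ite_mul, apply_ite star, mul_ite, star_zero, zero_mul,
      mul_zero, Finset.sum_ite_eq, Finset.mem_univ, if_true, star_smul, star_one, star_trivial,
      smul_mul_assoc, mul_smul_comm, one_mul, mul_one, add_smul]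
  have hne (P : Albert) (hP : act M P = (4 : ℝ) • P) : P = 0 := by
    refine Subtype.ext (Matrix.ext fun m n => ?_)
    have e1 := hentry P m n
    rw [hP] at e1
    have e2 : ((a m + a n) - 4) • P.1 m n = 0 := by
      rw [sub_smul, ← e1]; exact sub_self _
    refine (smul_eq_zero.1 e2).resolve_left ?_
    fin_cases m <;> fin_cases n <;> simp [a] <;> norm_num
  have hlie {S : Oct 1} (hS : S ∈ labels) (P : Albert) :
      ⁅boost M, labelled S P⁆ = labelled (l * S) (act M P) :=
    lie_boost_labelled (mem_labelSpan_of_mem_labels hS) hM h0 P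
  let P₀ : Albert := ofEntries ![0, 0, 1] 0
  have hP₀ : act M P₀ = (-4 : ℝ) • P₀ := by
    refine ext_entries (fun n => ?_) (fun n => ?_)
    · rw [diagEntry, hentry, diagEntry_smul]
      change (a n + a n) * diagEntry P₀ n = _
      rw [diagEntry_ofEntries]
      fin_cases n <;> simp [a]; norm_num
    · change _ = (-4 : ℝ) • P₀.1 n (n + 1)
      rw [hentry, ofEntries_apply]; simp
  have hP₀ne : P₀ ≠ 0 := fun h => by
    have e := congrArg (diagEntry · 2) h
    simp [P₀, diagEntry] at e
    simp [ofEntries] at e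
  have hmem : labelled Q P₀ ∈ N := by
    change labelled Q P₀ ∈ N.toSubmodule
    rw [hN, ← range_labelledL hQ']; exact ⟨P₀, rfl⟩
  obtain ⟨_, hm, hm0, hm1⟩ := LieSubmodule.exists_eigenvector_of_equiv e
    (x := (⟨boost M, boost_mem M⟩ : e6)) (r := -4) hmem
    (fun h => hP₀ne (labelled_injective hQ' (label_ne_zero hQ) (h.trans (labelled_zero hQ).symm)))
    (by
      change ⁅boost M, labelled Q P₀⁆ = (-4 : ℝ) • labelled Q P₀
      rw [hlie hQ, h, hP₀, labelled_smul hQ])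
  rw [← LieSubmodule.mem_toSubmodule, hN', ← range_labelledL hR'] at hm
  obtain ⟨P, rfl⟩ := hm
  rw [labelledL_apply] at hm0 hm1
  change ⁅boost M, labelled R P⁆ = (-4 : ℝ) • labelled R P at hm1
  -- The sign in LR = -R turns the eigenvalue -4 of the bracket into the eigenvalue 4 of `act M`,
  -- which is impossible for a nonzero matrix.
  rw [hlie hR, h', labelled_neg_label hR', neg_smul, neg_inj, ← labelled_smul hR] at hm1
  refine hm0 ?_
  rw [hne P (labelled_injective hR' (label_ne_zero hR) hm1), labelled_zero hR]

theorem nonempty_equiv_iff {Q R : Oct 1} (hQ : Q ∈ labels) (hR : R ∈ labels)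
    {N N' : LieSubmodule ℝ e6 e8} (hN : N.toSubmodule = H Q) (hN' : N'.toSubmodule = H R) :
    Nonempty (N ≃ₗ⁅ℝ,e6⁆ N') ↔ (l * Q = Q ↔ l * R = R) := by
  have hQ' := mem_labelSpan_of_mem_labels hQ
  have hR' := mem_labelSpan_of_mem_labels hR
  have hsame := LieSubmodule.nonempty_equiv_of_operators (N := N) (N' := N')
    (labelled_injective hQ' (label_ne_zero hQ) : Function.Injective (labelledL hQ'))
    (labelled_injective hR' (label_ne_zero hR) : Function.Injective (labelledL hR'))
    ((range_labelledL hQ').trans hN.symm) ((range_labelledL hR').trans hN'.symm)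
  have hQ2 := not_l_mul_label_both hQ
  have hR2 := not_l_mul_label_both hR
  rcases l_mul_label hQ with h | h <;> rcases l_mul_label hR with h' | h'
  · refine iff_of_true (hsame fun x => ?_) (by tauto)
    obtain ⟨T', -, hT⟩ := exists_isDualOp_actsBy x
    exact ⟨_, fun P => ⟨(hT Q hQ).1 h P, (hT R hR).1 h' P⟩⟩
  · exact iff_of_false (fun ⟨e⟩ => (isEmpty_equiv_of_signs hQ hR hN hN' h h').false e) (by tauto)
  · exact iff_of_false (fun e => not_isEmpty_iff.2 (LieSubmodule.nonempty_equiv_symm e)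
      (isEmpty_equiv_of_signs hR hQ hN' hN h' h)) (by tauto)
  · refine iff_of_true (hsame fun x => ?_) (by tauto)
    obtain ⟨T', -, hT⟩ := exists_isDualOp_actsBy x
    exact ⟨_, fun P => ⟨(hT Q hQ).2 h P, (hT R hR).2 h' P⟩⟩

end e8

end

/-- Linear independence of the generators is expressed by the dimension: they form a family of 78
elements (`e8.e6Family`), and their span has dimension 78. -/
theorem mainTheorem1 :
    -- the 78 generators close under the commutator
    (e8.e6.toSubmodule = Submodule.span ℝ e8.e6Generators ∧ Module.finrank ℝ e8.e6 = 78) ∧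
    -- three labels have `LQ = Q`, the other three have `LQ = -Q`
    {Q ∈ e8.labels | Oct.l * Q = Q}.ncard = 3 ∧ {Q ∈ e8.labels | Oct.l * Q = -Q}.ncard = 3 ∧
    (∀ Q ∈ e8.labels, Oct.l * Q = Q ∨ Oct.l * Q = -Q) ∧
    -- identification of `𝔢₆` in `𝔢₈` with `𝔢₆` acting on the Albert algebra
    ∃ (Φ : e8.e6 ≃ₗ⁅ℝ⁆ Albert.sl3O) (N : Oct 1 → LieSubmodule ℝ e8.e6 e8),
      (∀ M : Matrix (Fin 3) (Fin 3) (Oct (-1)), Mᴴ = -M → M.trace = 0 →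
        ∃ hM : e8.rotation M ∈ e8.e6,
          (Φ ⟨e8.rotation M, hM⟩ : Module.End ℝ Albert) = Albert.act M) ∧
      (∀ M : Matrix (Fin 3) (Fin 3) (Oct (-1)), Mᴴ = M → M.trace = 0 →
        ∃ hM : e8.boost M ∈ e8.e6,
          (Φ ⟨e8.boost M, hM⟩ : Module.End ℝ Albert) = Albert.act M) ∧
      (∀ Q ∈ e8.labels,
        -- `H_Q` is a 27-dimensional representation of `𝔢₆` under the commutator
        (N Q).toSubmodule = e8.H Q ∧ Module.finrank ℝ (e8.H Q) = 27 ∧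
        -- its elements are the `Q𝓟` with `𝓟` in the Albert algebra
        IsLinearMap ℝ (e8.labelled Q) ∧ Function.Injective (e8.labelled Q) ∧
        Set.range (e8.labelled Q) = (e8.H Q : Set e8) ∧
        -- rotations and boosts act on `𝓟`, boosts up to the sign in `LQ = ±Q`
        (∀ M : Matrix (Fin 3) (Fin 3) (Oct (-1)), Mᴴ = -M → M.trace = 0 → ∀ P : Albert,
          ⁅e8.rotation M, e8.labelled Q P⁆ = e8.labelled Q (Albert.act M P)) ∧
        (∀ M : Matrix (Fin 3) (Fin 3) (Oct (-1)), Mᴴ = M → M.trace = 0 → ∀ P : Albert,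
          ⁅e8.boost M, e8.labelled Q P⁆ = e8.labelled (Oct.l * Q) (Albert.act M P)) ∧
        -- if `LQ = Q`, then `H_Q` is the representation of `𝔢₆` on the Albert algebra
        (Oct.l * Q = Q → ∀ (x : e8.e6) (P : Albert),
          ⁅(x : e8), e8.labelled Q P⁆ = e8.labelled Q ((Φ x : Module.End ℝ Albert) P)) ∧
        -- if `LQ = -Q`, then `H_Q` is the dual of that representation
        (Oct.l * Q = -Q → ∃ δ : Module.Dual ℝ Albert →ₗ[ℝ] e8,
          Function.Injective δ ∧ LinearMap.range δ = e8.H Q ∧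
          ∀ (x : e8.e6) (f : Module.Dual ℝ Albert),
            ⁅(x : e8), δ f⁆ = δ (-(f ∘ₗ (Φ x : Module.End ℝ Albert))))) ∧
      -- the two representations are inequivalent
      (∀ Q ∈ e8.labels, ∀ R ∈ e8.labels,
        Nonempty (N Q ≃ₗ⁅ℝ,e8.e6⁆ N R) ↔ (Oct.l * Q = Q ↔ Oct.l * R = R)) := by
  refine ⟨⟨e8.e6_eq_span, e8.finrank_e6⟩, Oct.ncard_plus_labels, Oct.ncard_minus_labels,
    fun Q hQ => Oct.l_mul_label hQ, e8.equivSl3O, e8.labelModule,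
    fun M hM h0 => ⟨e8.rotation_mem M, e8.operator_eq (e8.rotation_actsBy hM h0)⟩,
    fun M hM h0 => ⟨e8.boost_mem M, e8.operator_eq (e8.boost_actsBy hM h0)⟩,
    fun Q hQ => ?_, fun Q hQ R hR => e8.nonempty_equiv_iff hQ hR (e8.labelModule_toSubmodule hQ)
      (e8.labelModule_toSubmodule hR)⟩
  have hQ' := Oct.mem_labelSpan_of_mem_labels hQ
  have h0 := Oct.label_ne_zero hQ
  refine ⟨e8.labelModule_toSubmodule hQ, e8.finrank_H hQ' h0, e8.isLinearMap_labelled hQ',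
    e8.labelled_injective hQ' h0, ?_, fun M hM h0 P => e8.lie_rotation_labelled hQ' hM h0 P,
    fun M hM h0 P => e8.lie_boost_labelled hQ' hM h0 P, fun h x P => ?_,
    fun h => ⟨e8.dualLabelledL hQ', e8.dualLabelledL_injective hQ' h0, e8.range_dualLabelledL hQ',
      e8.lie_dualLabelledL hQ h⟩⟩
  · rw [← e8.range_labelledL hQ']; rfl
  · obtain ⟨T', -, hT⟩ := e8.exists_isDualOp_actsBy x
    exact (hT Q hQ).1 h P
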